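/- Let $\sigma_k(n)=\sum_{t\mid n}t^k$ and $E_k(q)=\sum_{n\ge1}\sigma_{k-1}(n)q^n$. For a fixed point free involution $\tau$ of a finite set, call a permutation $v$ of that set \emph{$\tau$-twisted} if $\tau v\tau v=\mathrm{id}$ and no cycle $\gamma$ of $v$ satisfies $\tau\gamma^{-1}\tau=\gamma$ (so that the cycles of $v$ come in pairs $\gamma,\ \bar\gamma=\tau\gamma^{-1}\tau$). \emph{Real coverings.} For $d\ge1$ let $\tau=(1\,\bar1)\cdots(d\,\bar d)$. A connected real simply ramified covering of the torus of genus $g\ge1$ and degree $2d$ is given by permutations $\sigma,\alpha$ and transpositions $\eta_1,\dots,\eta_{g-1}$ of $\{1,\bar1,\dots,d,\bar d\}$ such that $\sigma$ is $\tau$-twisted, $\alpha\tau=\tau\alpha$, $\tau\eta_i\tau\neq\eta_i$ for all $i$, $$\eta_{g-1}\cdots\eta_1\,\sigma\,(\tau\eta_1\tau)\cdots(\tau\eta_{g-1}\tau)=\alpha\sigma\alpha^{-1},$$ and the group generated by $\sigma,\alpha,\tau,\eta_1,\dots,\eta_{g-1}$ is transitive. Let $T_{g,d}$ be the number of such data divided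 by $2^{g-1}\cdot 2^d d!$, and let $F_g(q)=\sum_{d\ge1}T_{g,d}\,q^d$. \emph{Real origami.} A real origami of degree $2n$ is a triple $(\tau,h,v)$ of permutations of $\{1,\dots,2n\}$ such that $\tau$ is a fixed point free involution, $\tau h\tau h^{-1}=\mathrm{id}$, $v$ is $\tau$-twisted, and the group generated by $h,v,\tau$ is transitive. It lies in $\mathcal H(1,1)$ if $hvh^{-1}v^{-1}$ has cycle type $[2,2,1^{2n-4}]$. Let $N_n(1,1)$ be the number of real origami of degree $2n$ in $\mathcal H(1,1)$, divided by $(2n)!$. \emph{Quantum modular forms.} Let $\varphi(q)$ be a power series converging for $|q|<1$ and put $f(z)=\varphi(e^{2\pi i z})$ for $\operatorname{Im}z>0$. Then $\varphi$ is a quantum modular form of weight $k$ if (i) at every $x\in\mathbb Q$ the function $f$ has, as $z\to x$ non-tangentially in the upper half-plane, an asymptotic expansion in a formal Laurent series in $z-x$; and (ii) for every $\begin{pmatrix}a&b\\c&d\end{pmatrix}\in SL_2(\mathbb Z)$ the function $$f(z)-(cz+d)^{-k}f\!\left(\frac{az+b}{cz+d}\right),\qquad \operatorname{Im} z>0,\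 cz+d\notin(-\infty,0],$$ extends holomorphically to $\{z\in\mathbb C: cz+d\notin(-\infty,0]\}$ (in particular it is real-analytic on the set of real $x$ with $cx+d>0$). A finite sum of quantum modular forms of weights $k\in K$ is a quantum modular form of mixed weight, with weights in $K$. \textbf{Theorem.} One has $$F_2(q)=\tfrac12\bigl(E_3(q)-E_2(q)\bigr).$$ In particular, $F_2(q)$ is a quantum modular form of mixed weight, with weights in $\{2,3\}$. Moreover $F_2(q)=\sum_{n\ge1}N_n(1,1)\,q^n$, i.e. $T_{2,n}=N_n(1,1)$ for all $n\ge1$. -/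

import Mathlib

noncomputable section

namespace RealOrigami

open Equiv.Perm

/-! ### Real origami and real coverings through their monodromy permutations -/

/-- `τ` is an involution without fixed points. -/
def IsFPFInvolution {α : Type*} (τ : Equiv.Perm α) : Prop :=
  τ * τ = 1 ∧ ∀ x, τ x ≠ x

/-- `v` is inverted by conjugation with the fixed point free involution `τ`, i.e. `τvτv = id`, and
its cycle decomposition is `γ₁γ̄₁⋯γₘγ̄ₘ` with `γ̄ᵢ = τγᵢ⁻¹τ`.  The map `γ ↦ τγ⁻¹τ` is an involution on
the cycles of `v` and the cycles get paired exactly when none of them is mapped to itself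
(a fixed point `x` of `v`, as a cycle of length one, is always paired with `τ x ≠ x`). -/
def IsTwisted {α : Type*} [Fintype α] [DecidableEq α] (τ v : Equiv.Perm α) : Prop :=
  τ * v * τ * v = 1 ∧ ∀ γ ∈ v.cycleFactorsFinset, τ * γ⁻¹ * τ ≠ γ

/-- The triple `(τ, h, v)` is a (connected) real origami: an origami with horizontal and vertical
permutations `h`, `v`, equipped with the real structure `τ`.  Connectedness means that the quotient
by the real structure is connected. -/
structure IsRealOrigami {α : Type*} [Fintype α] [DecidableEq α] (τ h v : Equiv.Perm α) : Prop where
  involution : IsFPFInvolution τ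
  horizontal : τ * h * τ * h⁻¹ = 1
  vertical : IsTwisted τ v
  transitive : MulAction.IsPretransitive
    (Subgroup.closure ({h, v, τ} : Set (Equiv.Perm α))) α

/-- The weighted number of real origami of degree `2n` in the stratum `H(1,1)`, i.e. with exactly
two simple zeros: the commutator `[h, v]` has cycle structure `[2, 2, 1, …, 1]` (Mathlib's
`cycleType` omits the fixed points).  Dividing the number of labelled objects by `(2n)!` is the same
as counting isomorphism classes with weight `1 / |Aut|`. -/
def origamiCount (n : ℕ) : ℚ :=
  (Nat.card {p : Equiv.Perm (Fin (2 * n)) × Equiv.Perm (Fin (2 * n)) × Equiv.Perm (Fin (2 * n)) //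
      IsRealOrigami p.1 p.2.1 p.2.2 ∧
      (p.2.1 * p.2.2 * p.2.1⁻¹ * p.2.2⁻¹).cycleType = {2, 2}} : ℚ) / (2 * n).factorial

/-- The standard fixed point free involution `(1 1̄)(2 2̄)⋯(d d̄)` of `{1, 1̄, …, d, d̄}`. -/
def bar (d : ℕ) : Equiv.Perm (Fin d × Bool) :=
  Equiv.prodCongr (Equiv.refl (Fin d)) Equiv.boolNot

/-- `(σ, η₁, …, η_b, α)` is the monodromy datum of a connected real simply ramified covering of the
torus of degree `2d` with `b` pairs of complex conjugate simple critical points: `α` (the monodromy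
along the parallel) commutes with `τ = bar d`, `σ` (the monodromy along the meridian) is twisted by
`τ`, each `ηᵢ` is a transposition different from its conjugate `τηᵢτ`, and
`η_b ⋯ η₁ σ (τη₁τ) ⋯ (τη_bτ) = α σ α⁻¹`. -/
structure IsRealCovering (d b : ℕ) (σ : Equiv.Perm (Fin d × Bool))
    (η : Fin b → Equiv.Perm (Fin d × Bool)) (α : Equiv.Perm (Fin d × Bool)) : Prop where
  twisted : IsTwisted (bar d) σ
  simple : ∀ i, (η i).IsSwap ∧ bar d * η i * bar d ≠ η i
  commute : bar d * α = α * bar d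
  monodromy : (List.ofFn η).reverse.prod * σ * (List.ofFn fun i => bar d * η i * bar d).prod
    = α * σ * α⁻¹
  transitive : MulAction.IsPretransitive
    (Subgroup.closure ({σ, α, bar d} ∪ Set.range η : Set (Equiv.Perm (Fin d × Bool))))
    (Fin d × Bool)

/-- The weighted number of connected real simply ramified coverings of the torus of genus `g ≥ 1`
and degree `2d`; such a covering has `g - 1` pairs of conjugate critical points.  The labelled
data are divided by the order `2 ^ d * d!` of the centralizer of `τ` and by `2 ^ (g - 1)`, as `ηᵢ` and
`τηᵢτ` stand for the same pair of critical points. -/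
def coveringCount (g d : ℕ) : ℚ :=
  (Nat.card {p : Equiv.Perm (Fin d × Bool) × (Fin (g - 1) → Equiv.Perm (Fin d × Bool)) ×
      Equiv.Perm (Fin d × Bool) // IsRealCovering d (g - 1) p.1 p.2.1 p.2.2} : ℚ) /
    (2 ^ (g - 1) * (2 ^ d * d.factorial))

/-- The generating function `∑_{n ≥ 1} a n q ^ n`. -/
def genFun (a : ℕ → ℚ) : PowerSeries ℚ :=
  PowerSeries.mk fun n => if n = 0 then 0 else a n

/-- `F_g(q)`, the generating function of connected genus `g` real simply ramified coverings of the
torus. -/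
def F (g : ℕ) : PowerSeries ℚ := genFun (coveringCount g)

/-- The Eisenstein series `E_k = ∑_{n ≥ 1} σ_{k-1}(n) q ^ n`, for `k ≥ 1`. -/
def E (k : ℕ) : PowerSeries ℚ :=
  genFun fun n => ∑ t ∈ n.divisors, (t : ℚ) ^ (k - 1)

/-! ### Quantum modular forms -/

/-- The function `z ↦ φ(e ^ {2πiz})` defined by a power series `φ(q)`. -/
def qFun (φ : PowerSeries ℂ) (z : ℂ) : ℂ :=
  ∑' n : ℕ, PowerSeries.coeff n φ * Complex.exp (2 * Real.pi * Complex.I * n * z)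

/-- A `q`-series `φ(q)` is a (strong) quantum modular form of weight `k` for `SL(2, ℤ)`: writing
`f(z) = φ(e ^ {2πiz})` for `z` in the upper half-plane,
* at every rational `x` the function `f` has an asymptotic expansion in a formal Laurent series in
  `z - x`, as `z → x` non-tangentially (this attaches a formal series to each rational number);
* for each `γ = (a, b; c, d)` the failure of modularity `h_γ(z) = f(z) - (cz+d)^{-k} f(γz)` extends
  to a holomorphic function on `{z | cz+d ∉ (-∞, 0]}`, so that it is real-analytic on the set of all
  real `x` with `cx+d > 0`. (The points with `cx+d < 0` are dealt with by `-γ`.) -/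
structure IsQuantumModular (k : ℤ) (φ : PowerSeries ℂ) : Prop where
  summable : ∀ z : ℂ, 0 < z.im → Summable fun n : ℕ =>
    PowerSeries.coeff n φ * Complex.exp (2 * Real.pi * Complex.I * n * z)
  expansion : ∀ x : ℚ, ∃ (m : ℕ) (a : ℕ → ℂ), ∀ (C : ℝ) (N : ℕ),
    (fun z : ℂ => (z - x) ^ m * qFun φ z - ∑ j ∈ Finset.range N, a j * (z - x) ^ j)
      =O[nhdsWithin (x : ℂ) {z : ℂ | 0 < z.im ∧ |z.re - x| ≤ C * z.im}]
        (fun z : ℂ => (z - x) ^ N)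
  cocycle : ∀ γ : Matrix.SpecialLinearGroup (Fin 2) ℤ, ∃ h : ℂ → ℂ,
    DifferentiableOn ℂ h {z : ℂ | (γ.1 1 0 : ℂ) * z + (γ.1 1 1 : ℂ) ∈ Complex.slitPlane} ∧
    ∀ z : ℂ, 0 < z.im → (γ.1 1 0 : ℂ) * z + (γ.1 1 1 : ℂ) ∈ Complex.slitPlane →
      h z = qFun φ z - ((γ.1 1 0 : ℂ) * z + (γ.1 1 1 : ℂ)) ^ (-k) *
        qFun φ (((γ.1 0 0 : ℂ) * z + (γ.1 0 1 : ℂ)) / ((γ.1 1 0 : ℂ) * z + (γ.1 1 1 : ℂ)))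

/-- `φ` is a quantum modular form of mixed weight, with weights in the finite set `K`: a sum of
quantum modular forms of the weights `k ∈ K`. -/
def IsMixedQuantumModular (K : Finset ℤ) (φ : PowerSeries ℂ) : Prop :=
  ∃ ψ : ℤ → PowerSeries ℂ, (∀ k ∈ K, IsQuantumModular k (ψ k)) ∧ φ = ∑ k ∈ K, ψ k

end RealOrigami

end

/-! ### Twisted permutations as products of two fixed point free involutions -/

noncomputable section

namespace RealOrigami

open Equiv Equiv.Perm

variable {α : Type*}

/-! Write `v = τρ`. Then `v` is `τ`-twisted exactly when `ρ = τv` is again a fixed point free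
involution (`isTwisted_iff`), and both counts concern `τ`, `ρ` and some `h` commuting with `τ` such
that `hρh⁻¹ = (i j)ρ(i j)`. In the graph of `τ`-edges and `ρ`-edges every component is an even
cycle, made of two `v`-cycles exchanged by `τ`. Conjugation by `h` preserves the number of
components, whereas the switch `ρ ↦ (i j)ρ(i j)` merges two components if `i`, `j` lie in different
ones, and splits one if `i ≠ j` lie in the same `v`-cycle. So `j` lies in the `v`-cycle of `τ i`
(`sameCycle_of_conj_swap`). In that case the switch is conjugation by the reflection `u` of an arc
from `i` to `j`, which commutes with `τ` (`exists_commute_conj_eq`), and `u⁻¹h` commutes with both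
involutions: it gives an unramified torus triple. Conversely a torus triple, a point `i` and a point
`j` of the `v`-cycle of `τ i` give a switch datum. If `v` has order `ℓ`, there are `ℓ` choices of
`j`; the degenerate one (`τ i` for coverings, `ρ i` for origami) is discarded, leaving `2n(ℓ - 1)`
pairs.

In a torus triple the dihedral group generated by `τ` and `ρ` acts freely, and `h` permutes its
orbits cyclically. Triples with a base point are thus labellings of an explicit model with `2ℓ`
gluing parameters, so there are `2ℓ(2n)!/(2n)` triples for each `ℓ ∣ n` (`card_torusTriple`). Every
origami comes from four pairs `(i, j)` and every covering from two, so both weighted counts equal `½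
∑ (ℓ² - ℓ)` over `ℓ ∣ n`.

For quantum modularity, the cocycles and the expansion at `0` suffice, since `SL(2, ℤ)` moves every
rational to `0` (`IsQuantumModular.of_expansion_zero`). In weight two everything follows from the
quasimodularity of `E2`. In weight three the series is a multiple of `∑ sign(m)(mz + n)⁻³`; its
defect under a matrix only involves the lattice vectors in a double cone, where the summands stay
holomorphic on the cut plane. Its expansion at `0` comes from the asymptotics of Hurwitz sums. -/

theorem mapsTo_of_mem_closure [Finite α] {G : Set (Perm α)} {S : Set α}
    (hS : ∀ g ∈ G, Set.MapsTo g S S) {g : Perm α} (hg : g ∈ Subgroup.closure G) :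
    Set.MapsTo g S S := by
  induction hg using Subgroup.closure_induction with
  | mem g hg => exact hS g hg
  | one => exact fun x hx => hx
  | mul g h _ _ hg hh => exact fun x hx => hg (hh hx)
  | inv g _ hg =>
    obtain ⟨k, hk⟩ := (isOfFinOrder_of_finite g).mem_powers_iff_mem_zpowers.2
      (Subgroup.inv_mem _ (Subgroup.mem_zpowers g))
    have : g ^ k = g⁻¹ := hk
    rw [← this, Perm.coe_pow]
    exact hg.iterate k

/-- Orbits are themselves stable sets, and by finiteness stability under generators passes to
inverses. Phrasing transitivity through stable sets makes it easy to change the generators. -/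
theorem isPretransitive_closure_iff [Finite α] (G : Set (Perm α)) :
    MulAction.IsPretransitive (Subgroup.closure G) α ↔
      ∀ S : Set α, S.Nonempty → (∀ g ∈ G, Set.MapsTo g S S) → S = Set.univ := by
  constructor
  · rintro ⟨ht⟩ S ⟨x, hx⟩ hS
    refine Set.eq_univ_of_forall fun y => ?_
    obtain ⟨⟨g, hg⟩, rfl⟩ := ht x y
    exact mapsTo_of_mem_closure hS hg hx
  · intro h
    refine ⟨fun x y => ?_⟩
    have := h (MulAction.orbit (Subgroup.closure G) x) ⟨x, MulAction.mem_orbit_self x⟩ (by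
      rintro g hg _ ⟨k, rfl⟩
      exact ⟨⟨g, Subgroup.subset_closure hg⟩ * k, mul_smul _ k x⟩)
    have hy : y ∈ MulAction.orbit (Subgroup.closure G) x := this ▸ Set.mem_univ y
    exact hy

theorem IsFPFInvolution.apply_apply {τ : Perm α} (h : IsFPFInvolution τ) (x : α) :
    τ (τ x) = x := by
  rw [← mul_apply, h.1, one_apply]

theorem IsFPFInvolution.inv_eq {τ : Perm α} (h : IsFPFInvolution τ) : τ⁻¹ = τ :=
  inv_eq_of_mul_eq_one_left h.1

theorem IsFPFInvolution.conj {τ : Perm α} (h : IsFPFInvolution τ) (g : Perm α) :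
    IsFPFInvolution (g * τ * g⁻¹) := by
  refine ⟨by rw [show g * τ * g⁻¹ * (g * τ * g⁻¹) = g * (τ * τ) * g⁻¹ by group, h.1]; group,
    fun x hx => h.2 (g⁻¹ x) ?_⟩
  rw [Perm.eq_inv_iff_eq]
  exact hx

theorem twist_zpow_apply {τ v : Perm α} (hτ : τ * τ = 1) (hv : τ * v * τ * v = 1) (a : ℤ) (x : α) :
    τ ((v ^ a) x) = (v ^ (-a)) (τ x) := by
  have h1 : τ * v * τ⁻¹ = v⁻¹ := by
    rw [inv_eq_of_mul_eq_one_left hτ]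
    exact eq_inv_of_mul_eq_one_left hv
  have h2 : τ * v ^ a * τ⁻¹ = v ^ (-a) := by rw [← conj_zpow, h1, inv_zpow, zpow_neg]
  rw [← h2]
  simp

/-- A midpoint argument: if `τ x = v^a x`, the point halfway from `x` to `τ x` along the cycle is
fixed by `τ` when `a` is even and by `τv` when `a` is odd. -/
theorem zpow_apply_ne {τ v : Perm α} (hτ : IsFPFInvolution τ) (hv : IsFPFInvolution (τ * v))
    (a : ℤ) (x : α) : (v ^ a) x ≠ τ x := by
  intro h
  have hv' : τ * v * τ * v = 1 := by rw [mul_assoc (τ * v)]; exact hv.1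
  rcases Int.even_or_odd' a with ⟨b, rfl | rfl⟩
  · apply hτ.2 ((v ^ b) x)
    rw [twist_zpow_apply hτ.1 hv', ← h, ← mul_apply, ← zpow_add]
    ring_nf
  · apply hv.2 ((v ^ b) x)
    have hb : (τ * v) ((v ^ b) x) = τ ((v ^ (1 + b)) x) := by rw [zpow_add, zpow_one]; rfl
    rw [hb, twist_zpow_apply hτ.1 hv', ← h, ← mul_apply, ← zpow_add]
    ring_nf

/-- A fixed point of `τv` satisfies `v x = τ x`, and the cycle through it is its own mirror image.
Conversely a self-mirrored cycle contains both `x` and `τ x`, which `zpow_apply_ne` forbids. -/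
theorem isTwisted_iff [Fintype α] [DecidableEq α] {τ v : Perm α} (hτ : IsFPFInvolution τ) :
    IsTwisted τ v ↔ IsFPFInvolution (τ * v) := by
  constructor
  · rintro ⟨h1, h2⟩
    refine ⟨by rw [← mul_assoc]; exact h1, fun x hx => ?_⟩
    have hvx : v x = τ x := by
      rw [mul_apply] at hx
      rw [← hτ.apply_apply (v x), hx]
    have hne : v x ≠ x := hvx ▸ hτ.2 x
    refine h2 (v.cycleOf x) (cycleOf_mem_cycleFactorsFinset_iff.2 (mem_support.2 hne)) ?_
    have hs : ∀ y, SameCycle v x (τ y) ↔ SameCycle v x y := by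
      have aux : ∀ y, SameCycle v x y → SameCycle v x (τ y) := by
        rintro _ ⟨a, rfl⟩
        refine ⟨-a + 1, ?_⟩
        rw [twist_zpow_apply hτ.1 h1, ← hvx, zpow_add, zpow_one, mul_apply]
      refine fun y => ⟨fun h => ?_, aux y⟩
      simpa [hτ.apply_apply] using aux _ h
    have hinv : ∀ y, τ (v⁻¹ (τ y)) = v y := fun y => by
      have := twist_zpow_apply hτ.1 h1 (-1) (τ y)
      simpa [hτ.apply_apply] using this
    ext y
    rw [cycleOf_inv, mul_apply, mul_apply, cycleOf_apply, cycleOf_apply]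
    by_cases h : SameCycle v x y
    · rw [if_pos (sameCycle_inv.2 ((hs y).2 h)), if_pos h, hinv]
    · rw [if_neg (fun h' => h ((hs y).1 (sameCycle_inv.1 h'))), if_neg h, hτ.apply_apply]
  · intro h
    refine ⟨by rw [mul_assoc (τ * v)]; exact h.1, fun γ hγ hγ' => ?_⟩
    obtain ⟨x, hx⟩ := (mem_cycleFactorsFinset_iff.1 hγ).1.nonempty_support
    have hx' : τ x ∈ γ.support := by
      rw [mem_support, ← hγ', mul_apply, mul_apply, hτ.apply_apply, τ.injective.ne_iff, ne_eq,
        inv_eq_iff_eq]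
      exact (mem_support.1 hx).symm
    rw [cycle_is_cycleOf hx hγ, mem_support_cycleOf_iff] at hx'
    obtain ⟨a, ha⟩ := hx'.1
    exact zpow_apply_ne hτ h a x ha

end RealOrigami
end

/-! ### Realizing a switch by the reflection of an arc -/

noncomputable section

namespace RealOrigami

open Equiv Equiv.Perm

variable {α : Type*}

theorem mapsTo_zpow_mul [Finite α] {τ ρ : Perm α} {S : Set α} (h1 : Set.MapsTo τ S S)
    (h2 : Set.MapsTo ρ S S) (a : ℤ) : Set.MapsTo ((τ * ρ) ^ a : Perm α) S S := by
  refine mapsTo_of_mem_closure (G := {τ, ρ}) (by simp [h1, h2]) (zpow_mem (mul_mem ?_ ?_) a)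
  · exact Subgroup.subset_closure (by simp)
  · exact Subgroup.subset_closure (by simp)

theorem zpow_apply_zpow_apply (v : Perm α) (a b : ℤ) (x : α) :
    (v ^ a) ((v ^ b) x) = (v ^ (a + b)) x := by
  rw [zpow_add, mul_apply]

theorem mem_iff_of_sameCycle [Finite α] {τ ρ : Perm α} {S : Set α} (h1 : Set.MapsTo τ S S)
    (h2 : Set.MapsTo ρ S S) {x y : α} (h : SameCycle (τ * ρ) x y) : x ∈ S ↔ y ∈ S := by
  obtain ⟨a, rfl⟩ := h
  refine ⟨fun hx => mapsTo_zpow_mul h1 h2 a hx, fun hx => ?_⟩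
  have := mapsTo_zpow_mul h1 h2 (-a) hx
  rwa [zpow_apply_zpow_apply, neg_add_cancel, zpow_zero] at this

variable [DecidableEq α]

theorem commute_swap_swap_apply {τ : Perm α} (hτ : IsFPFInvolution τ) (a b : α) :
    swap a b * swap (τ a) (τ b) = swap (τ a) (τ b) * swap a b := by
  by_cases hab : a = b
  · simp [hab]
  by_cases h : b = τ a
  · subst h
    rw [hτ.apply_apply, swap_comm]
  · have h' : a ≠ τ b := fun h' => h (by rw [h', hτ.apply_apply])
    refine (disjoint_swap_swap ?_).commute.eq
    simp [hab, h, h', (hτ.2 a).symm, (hτ.2 b).symm]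

theorem conj_swap {τ : Perm α} (hτ : IsFPFInvolution τ) (a b : α) :
    τ * swap a b * τ = swap (τ a) (τ b) := by
  have := mul_swap_eq_swap_mul τ a b
  rw [this, mul_assoc, hτ.1, mul_one]

/-- Switching two `ρ`-edges at one pair of ends or at the opposite pair gives the same involution,
because `(a b)` commutes with `ρ(a b)ρ = (ρa ρb)`. -/
theorem swap_conj_eq {ρ : Perm α} (hρ : IsFPFInvolution ρ) (a b : α) :
    swap (ρ a) (ρ b) * ρ * swap (ρ a) (ρ b) = swap a b * ρ * swap a b := by
  rw [← conj_swap hρ]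
  calc ρ * swap a b * ρ * ρ * (ρ * swap a b * ρ)
      = ρ * swap a b * (ρ * ρ) * ρ * swap a b * ρ := by group
    _ = (ρ * swap a b * ρ) * swap a b * ρ := by rw [hρ.1, mul_one]
    _ = swap a b * (ρ * swap a b * ρ) * ρ := by
      rw [conj_swap hρ, ← commute_swap_swap_apply hρ]
    _ = swap a b * ρ * swap a b * (ρ * ρ) := by group
    _ = _ := by rw [hρ.1, mul_one]

theorem mapsTo_swap {S : Set α} {i j : α} (h : i ∈ S ↔ j ∈ S) : Set.MapsTo (swap i j) S S := by
  intro x hx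
  rw [swap_apply_def]
  split_ifs with h1 h2
  · exact h.1 (h1 ▸ hx)
  · exact h.2 (h2 ▸ hx)
  · exact hx

theorem IsFPFInvolution.swap_conj {ρ : Perm α} (hρ : IsFPFInvolution ρ) (i j : α) :
    IsFPFInvolution (swap i j * ρ * swap i j) := by
  have := hρ.conj (swap i j)
  rwa [swap_inv] at this

/-- The arc from `i` to `j` that starts with the edge `i — τ i` also ends with a `τ`-edge. Its
reflection `u` preserves the `τ`-edges and the inner `ρ`-edges, and exchanges the ends of the two
outer `ρ`-edges. The last clause ensures that multiplying by `u` does not affect connectedness. -/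
theorem exists_commute_conj_eq [Finite α] {τ ρ : Perm α} (hτ : IsFPFInvolution τ)
    (hρ : IsFPFInvolution ρ) (i j : α) (hij : SameCycle (τ * ρ) (τ i) j) :
    ∃ u : Perm α, τ * u = u * τ ∧ u * ρ * u⁻¹ = swap i j * ρ * swap i j ∧
      ∀ S : Set α, Set.MapsTo τ S S → Set.MapsTo ρ S S → Set.MapsTo u S S := by
  -- The arc has `2n - 1` edges. The shift by one admits the degenerate start `n = 0`, where `j = ρ
  -- i` and the switch does nothing.
  suffices H : ∀ (n : ℕ) (i j : α), j = ((τ * ρ) ^ ((n : ℤ) - 1)) (τ i) →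
      ∃ u : Perm α, τ * u = u * τ ∧ u * ρ * u⁻¹ = swap i j * ρ * swap i j ∧
      ∀ S : Set α, Set.MapsTo τ S S → Set.MapsTo ρ S S → Set.MapsTo u S S by
    obtain ⟨n, -, -, hn⟩ := hij.exists_pow_eq''
    exact H (n + 1) i j (by simp [hn])
  clear hij i j
  have hS : ∀ {i j : α} {a : ℤ}, j = ((τ * ρ) ^ a) (τ i) → ∀ S : Set α, Set.MapsTo τ S S →
      Set.MapsTo ρ S S → Set.MapsTo (swap i j) S S := by
    rintro i _ a rfl S h1 h2
    refine mapsTo_swap ?_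
    rw [← mem_iff_of_sameCycle h1 h2 ⟨a, rfl⟩]
    exact ⟨fun h => h1 h, fun h => by simpa [hτ.apply_apply] using h1 h⟩
  have hτi : ∀ i : α, τ * swap i (τ i) = swap i (τ i) * τ := fun i => by
    rw [mul_swap_eq_swap_mul, hτ.apply_apply, swap_comm]
  intro n
  induction n using Nat.twoStepInduction with
  | zero =>
    rintro i j hj
    have hj' : j = ρ i := by
      rw [hj]
      simp [hτ.inv_eq, hρ.inv_eq, hτ.apply_apply]
    refine ⟨1, by simp, ?_, fun S _ _ x hx => hx⟩
    subst hj'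
    have h1 : ρ * swap i (ρ i) = swap i (ρ i) * ρ := by
      rw [mul_swap_eq_swap_mul, hρ.apply_apply, swap_comm]
    rw [mul_assoc (swap i (ρ i)), h1, ← mul_assoc, swap_mul_self]
    simp
  | one =>
    rintro i j hj
    refine ⟨swap i j, ?_, by rw [swap_inv], hS hj⟩
    have hj' : j = τ i := by rw [hj]; simp
    subst hj'
    exact hτi i
  | more n ih _ =>
    intro i j hj
    by_cases hj' : j = τ i
    · subst hj'
      exact ⟨swap i (τ i), hτi i, by rw [swap_inv], hS hj⟩
    have hv : τ * (τ * ρ) * τ * (τ * ρ) = 1 := by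
      simp [mul_assoc, hτ.1, hρ.1, ← mul_assoc τ τ]
    have e1 : ∀ x, ρ (τ x) = ((τ * ρ) ^ (-1 : ℤ)) x := fun x => by
      simp [hτ.inv_eq, hρ.inv_eq]
    -- Both ends move two edges inward, lowering `n` by two. By `swap_conj_eq` the inner switch is
    -- the switch at `τ i`, `τ j`; the reflection of the longer arc also exchanges `i` with `j` and
    -- `τ i` with `τ j`.
    obtain ⟨u, hu1, hu2, hu3⟩ := ih (ρ (τ i)) (ρ (τ j)) (by
      rw [e1, e1, twist_zpow_apply hτ.1 hv, hj, zpow_apply_zpow_apply, zpow_apply_zpow_apply]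
      push_cast
      ring_nf)
    refine ⟨swap i j * swap (τ i) (τ j) * u, ?_, ?_, fun S h1 h2 => ?_⟩
    · calc τ * (swap i j * swap (τ i) (τ j) * u)
          = τ * swap i j * swap (τ i) (τ j) * u := by group
        _ = swap (τ i) (τ j) * (τ * swap (τ i) (τ j)) * u := by
          rw [mul_swap_eq_swap_mul τ i j]; group
        _ = swap i j * swap (τ i) (τ j) * (τ * u) := by
          rw [mul_swap_eq_swap_mul τ (τ i) (τ j), hτ.apply_apply, hτ.apply_apply, commute_swap_swap_apply hτ]
          group
        _ = _ := by rw [hu1]; group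
    · have hu2' : u * ρ * u⁻¹ = swap (τ i) (τ j) * ρ * swap (τ i) (τ j) := by
        rw [hu2, swap_conj_eq hρ]
      calc swap i j * swap (τ i) (τ j) * u * ρ * (swap i j * swap (τ i) (τ j) * u)⁻¹
          = swap i j * swap (τ i) (τ j) * (u * ρ * u⁻¹) * swap (τ i) (τ j) * swap i j := by
            simp [mul_assoc]
        _ = swap i j * (swap (τ i) (τ j) * swap (τ i) (τ j)) * ρ *
              (swap (τ i) (τ j) * swap (τ i) (τ j)) * swap i j := by rw [hu2']; group
        _ = _ := by simp
    · have h3 := hS hj S h1 h2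
      have h4 : Set.MapsTo (swap (τ i) (τ j)) S S := by
        rw [← conj_swap hτ]
        exact fun x hx => h1 (h3 (h1 hx))
      exact fun x hx => h3 (h4 (hu3 S h1 h2 hx))

end RealOrigami
end

/-! ### Which switches are conjugations commuting with `τ` -/

noncomputable section

namespace RealOrigami

open Equiv Equiv.Perm

variable {α : Type*}

/-- The sets that are stable under two permutations. -/
def stableSets (τ ρ : Perm α) : Set (Set α) := {S | Set.MapsTo τ S S ∧ Set.MapsTo ρ S S}

/-- Stable sets are the unions of components, so their number measures the number of components; `h`
carries the stable sets of one pair to those of the other. -/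
theorem ncard_stableSets_conj {τ ρ h : Perm α} (hc : τ * h = h * τ) :
    (stableSets τ (h * ρ * h⁻¹)).ncard = (stableSets τ ρ).ncard := by
  have : stableSets τ (h * ρ * h⁻¹) = (fun S => h '' S) '' stableSets τ ρ := by
    ext S
    constructor
    · rintro ⟨h1, h2⟩
      refine ⟨(h⁻¹ : Perm α) '' S, ⟨?_, ?_⟩, by simp [Set.image_image]⟩
      · rintro _ ⟨x, hx, rfl⟩
        refine ⟨τ x, h1 hx, ?_⟩
        have : h⁻¹ * τ = τ * h⁻¹ := by
          rw [inv_mul_eq_iff_eq_mul, ← mul_assoc, ← hc, mul_assoc, mul_inv_cancel, mul_one]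
        exact congrArg (fun f : Perm α => f x) this
      · rintro _ ⟨x, hx, rfl⟩
        exact ⟨_, h2 hx, by simp⟩
    · rintro ⟨S, ⟨h1, h2⟩, rfl⟩
      refine ⟨?_, ?_⟩
      · rintro _ ⟨x, hx, rfl⟩
        exact ⟨τ x, h1 hx, (congrArg (fun f : Perm α => f x) hc).symm⟩
      · rintro _ ⟨x, hx, rfl⟩
        exact ⟨ρ x, h2 hx, by simp⟩
  rw [this, Set.ncard_image_of_injective _ (Set.image_injective.2 h.injective)]

theorem compl_mem_stableSets {τ ρ : Perm α} (hτ : IsFPFInvolution τ) (hρ : IsFPFInvolution ρ)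
    {S : Set α} (hS : S ∈ stableSets τ ρ) : Sᶜ ∈ stableSets τ ρ :=
  ⟨fun x hx hx' => hx (by simpa [hτ.apply_apply] using hS.1 hx'),
    fun x hx hx' => hx (by simpa [hρ.apply_apply] using hS.2 hx')⟩

theorem component_mem_stableSets {τ ρ : Perm α} (hτ : IsFPFInvolution τ) (hρ : IsFPFInvolution ρ)
    (i : α) : {x | SameCycle (τ * ρ) i x ∨ SameCycle (τ * ρ) (τ i) x} ∈ stableSets τ ρ := by
  have hv : τ * (τ * ρ) * τ * (τ * ρ) = 1 := by
    simp [mul_assoc, hτ.1, hρ.1, ← mul_assoc τ τ]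
  have h1 : Set.MapsTo τ {x | SameCycle (τ * ρ) i x ∨ SameCycle (τ * ρ) (τ i) x}
      {x | SameCycle (τ * ρ) i x ∨ SameCycle (τ * ρ) (τ i) x} := by
    rintro _ (⟨a, rfl⟩ | ⟨a, rfl⟩)
    · exact Or.inr ⟨-a, (twist_zpow_apply hτ.1 hv a i).symm⟩
    · exact Or.inl ⟨-a, by rw [twist_zpow_apply hτ.1 hv, hτ.apply_apply]⟩
  refine ⟨h1, fun x hx => ?_⟩
  have : ρ x = τ ((τ * ρ) x) := by rw [mul_apply, hτ.apply_apply]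
  rw [this]
  refine h1 ?_
  rcases hx with hx | hx
  · exact Or.inl (sameCycle_apply_right.2 hx)
  · exact Or.inr (sameCycle_apply_right.2 hx)

theorem even_ncard_of_mapsTo [Finite α] {τ : Perm α} (hτ : IsFPFInvolution τ) {S : Set α}
    (hS : Set.MapsTo τ S S) : Even S.ncard := by
  classical
  have := Fintype.ofFinite α
  rw [Set.ncard_eq_toFinset_card']
  have : ∑ x ∈ S.toFinset, (1 : ZMod 2) = 0 :=
    Finset.sum_involution (fun x _ => τ x) (fun _ _ => by decide) (fun x _ _ => hτ.2 x)
      (fun x hx => by simpa using hS (by simpa using hx)) (fun x _ => hτ.apply_apply x)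
  rw [Finset.sum_const, nsmul_one] at this
  exact (ZMod.natCast_eq_zero_iff_even).1 this

variable [DecidableEq α]

theorem sameCycle_swap_apply {v : Perm α} {i j : α} (h : SameCycle v i j) (x : α) :
    SameCycle v x (swap i j x) := by
  rw [swap_apply_def]
  split_ifs with h1 h2
  · exact h1 ▸ h
  · exact h2 ▸ h.symm
  · exact SameCycle.refl _ _

/-- A switch between different components would merge them: all sets stable after the switch are
stable before it, but the component `K` of `i` is no longer stable. This contradicts the equality of
the numbers of stable sets. -/
theorem sameCycle_or_of_conj_swap [Finite α] {τ ρ h : Perm α} (hτ : IsFPFInvolution τ)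
    (hρ : IsFPFInvolution ρ) (hc : τ * h = h * τ) {i j : α}
    (he : h * ρ * h⁻¹ = swap i j * ρ * swap i j) :
    SameCycle (τ * ρ) i j ∨ SameCycle (τ * ρ) (τ i) j := by
  by_contra hj
  have hρ' := hρ.swap_conj i j
  set ρ' := swap i j * ρ * swap i j with hρ'_def
  set K := {x | SameCycle (τ * ρ) i x ∨ SameCycle (τ * ρ) (τ i) x} with hK_def
  have hK : K ∈ stableSets τ ρ := component_mem_stableSets hτ hρ i
  have hi : i ∈ K := Or.inl (SameCycle.refl _ _)
  have hjK : j ∉ K := hj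
  -- Parity: if `i ∈ S` and `j ∉ S`, then `S ∩ K` is `τ`-stable while `(S ∩ K) \ {i}` is `ρ`-stable,
  -- so both would have even cardinality.
  have key : ∀ S ∈ stableSets τ ρ', i ∈ S → j ∈ S := by
    intro S hS hiS
    by_contra hjS
    have e1 : Even (S ∩ K).ncard := even_ncard_of_mapsTo hτ
      (fun x hx => ⟨hS.1 hx.1, hK.1 hx.2⟩)
    have e2 : Even ((S ∩ K) \ {i}).ncard := by
      refine even_ncard_of_mapsTo hρ ?_
      rintro x ⟨⟨hx1, hx2⟩, hxi : x ≠ i⟩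
      have hxj : x ≠ j := fun h => hjK (h ▸ hx2)
      have hx3 : ρ' x = swap i j (ρ x) := by
        rw [hρ'_def, mul_apply, mul_apply, swap_apply_of_ne_of_ne hxi hxj]
      have hx4 : ρ x ≠ j := fun h => hjK (h ▸ hK.2 hx2)
      have hx5 : ρ x ≠ i := fun h => by
        rw [h, swap_apply_left] at hx3
        exact hjS (hx3 ▸ hS.2 hx1)
      rw [swap_apply_of_ne_of_ne hx5 hx4] at hx3
      exact ⟨⟨hx3 ▸ hS.2 hx1, hK.2 hx2⟩, hx5⟩
    rw [Set.ncard_sdiff_singleton_of_mem (show i ∈ S ∩ K from ⟨hiS, hi⟩)] at e2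
    have : 0 < (S ∩ K).ncard := (Set.ncard_pos (Set.toFinite _)).2 ⟨i, hiS, hi⟩
    rcases e1 with ⟨a, ha⟩
    rcases e2 with ⟨b, hb⟩
    omega
  have hsub : stableSets τ ρ' ⊆ stableSets τ ρ := by
    intro S hS
    have hij : i ∈ S ↔ j ∈ S := ⟨key S hS, fun h => by
      by_contra h'
      exact key Sᶜ (compl_mem_stableSets hτ hρ' hS) h' h⟩
    refine ⟨hS.1, fun x hx => ?_⟩
    have : ρ x = swap i j (ρ' (swap i j x)) := by simp [hρ'_def]
    rw [this]
    exact mapsTo_swap hij (hS.2 (mapsTo_swap hij hx))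
  have heq : stableSets τ ρ' = stableSets τ ρ := by
    refine Set.eq_of_subset_of_ncard_le hsub ?_ (Set.toFinite _)
    rw [← ncard_stableSets_conj hc, he]
  have hK' : K ∈ stableSets τ ρ' := heq ▸ hK
  apply hjK
  have h1 : ρ i ∈ K := hK.2 hi
  have h2 := hK'.2 h1
  have h3 : ρ i ≠ j := fun h => hjK (h ▸ h1)
  rwa [hρ'_def, mul_apply, mul_apply, swap_apply_of_ne_of_ne (hρ.2 i) h3, hρ.apply_apply, swap_apply_left] at h2

/-- A switch inside one `v`-cycle splits it, while every stable set remains stable. Since the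
numbers of stable sets agree, the components are unchanged, so the new cycle through `i` would have
the same support as the old one. -/
theorem not_sameCycle_of_conj_swap [Finite α] {τ ρ h : Perm α} (hτ : IsFPFInvolution τ)
    (hρ : IsFPFInvolution ρ) (hc : τ * h = h * τ) {i j : α} (hij : i ≠ j)
    (he : h * ρ * h⁻¹ = swap i j * ρ * swap i j) : ¬ SameCycle (τ * ρ) i j := by
  intro hs
  have := Fintype.ofFinite α
  have hρ' := hρ.swap_conj i j
  set ρ' := swap i j * ρ * swap i j with hρ'_def
  have hsub : stableSets τ ρ ⊆ stableSets τ ρ' := by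
    rintro S ⟨h1, h2⟩
    have hS := mapsTo_swap (mem_iff_of_sameCycle h1 h2 hs)
    exact ⟨h1, fun x hx => hS (h2 (hS hx))⟩
  have heq : stableSets τ ρ = stableSets τ ρ' := by
    refine Set.eq_of_subset_of_ncard_le hsub ?_ (Set.toFinite _)
    rw [← he, ncard_stableSets_conj hc]
  have hv : τ * (τ * ρ) * τ * (τ * ρ) = 1 := by
    simp [mul_assoc, hτ.1, hρ.1, ← mul_assoc τ τ]
  have hne : ∀ x, SameCycle (τ * ρ) i x → ¬ SameCycle (τ * ρ) (τ i) x := by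
    intro x h1 h2
    obtain ⟨a, ha⟩ := h1.trans h2.symm
    exact zpow_apply_ne hτ (by rwa [← mul_assoc, hτ.1, one_mul]) a i ha
  have hs' : SameCycle (τ * ρ) (τ i) (τ j) := by
    obtain ⟨a, rfl⟩ := hs
    exact ⟨-a, (twist_zpow_apply hτ.1 hv a i).symm⟩
  have hv' : ∀ x, (τ * ρ') x = swap (τ i) (τ j) ((τ * ρ) (swap i j x)) := by
    intro x
    rw [← conj_swap hτ]
    simp [hρ'_def, hτ.apply_apply]
  have hstep : ∀ x, SameCycle (τ * ρ) x ((τ * ρ') x) := fun x => by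
    rw [hv']
    exact ((sameCycle_swap_apply hs x).trans (sameCycle_apply_right.2 (SameCycle.refl _ _))).trans
      (sameCycle_swap_apply hs' _)
  have hle : ∀ x y, SameCycle (τ * ρ') x y → SameCycle (τ * ρ) x y := by
    intro x y hxy
    obtain ⟨n, -, -, rfl⟩ := hxy.exists_pow_eq''
    clear hxy
    induction n with
    | zero => exact SameCycle.refl _ _
    | succ n ih =>
      rw [pow_succ', mul_apply]
      exact ih.trans (hstep _)
  have hiff : ∀ x, SameCycle (τ * ρ') i x ↔ SameCycle (τ * ρ) i x := by
    refine fun x => ⟨hle i x, fun hx => ?_⟩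
    have h1 := component_mem_stableSets hτ hρ' i
    rw [← heq] at h1
    rcases (mem_iff_of_sameCycle h1.1 h1.2 hx).1 (Or.inl (SameCycle.refl _ _)) with h2 | h2
    · exact h2
    · exact absurd (hle _ _ h2) (hne x hx)
  -- The factor `(τi τj)` of the new meridian plays no role here, as `τ i` and `τ j` lie in the
  -- other `v`-cycle. The two cycles have equal length, hence equal sign, yet differ by a
  -- transposition.
  have hcyc : cycleOf (τ * ρ') i = cycleOf (τ * ρ) i * swap i j := by
    ext x
    rw [mul_apply, cycleOf_apply, cycleOf_apply]
    by_cases hx : SameCycle (τ * ρ) i x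
    · have h1 : SameCycle (τ * ρ) i ((τ * ρ) (swap i j x)) :=
        sameCycle_apply_right.2 (hx.trans (sameCycle_swap_apply hs x))
      rw [if_pos ((hiff x).2 hx), if_pos (sameCycle_apply_right.1 h1), hv',
        swap_apply_of_ne_of_ne]
      · intro h2
        exact hne _ h1 (h2 ▸ SameCycle.refl _ _)
      · intro h2
        exact hne _ h1 (h2 ▸ hs')
    · have h1 : swap i j x = x := swap_apply_of_ne_of_ne
        (fun h => hx (h ▸ SameCycle.refl _ _)) (fun h => hx (h ▸ hs))
      rw [h1, if_neg hx, if_neg (fun h => hx ((hiff x).1 h))]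
  have hi1 : (τ * ρ) i ≠ i := fun h => hij (hs.eq_of_left h)
  have hi2 : (τ * ρ') i ≠ i := fun h => hij (((hiff j).2 hs).eq_of_left h)
  have hsupp : (cycleOf (τ * ρ') i).support = (cycleOf (τ * ρ) i).support := by
    ext x
    rw [mem_support_cycleOf_iff' hi2, mem_support_cycleOf_iff' hi1, hiff]
  have hsign := congrArg sign hcyc
  rw [Perm.sign_mul, sign_swap hij, (isCycle_cycleOf _ hi1).sign, (isCycle_cycleOf _ hi2).sign,
    hsupp] at hsign
  rcases Nat.even_or_odd (cycleOf (τ * ρ) i).support.card with h | h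
  · simp [h.neg_one_pow] at hsign
  · simp [h.neg_one_pow] at hsign

theorem sameCycle_of_conj_swap [Finite α] {τ ρ h : Perm α} (hτ : IsFPFInvolution τ)
    (hρ : IsFPFInvolution ρ) (hc : τ * h = h * τ) {i j : α} (hij : i ≠ j)
    (he : h * ρ * h⁻¹ = swap i j * ρ * swap i j) : SameCycle (τ * ρ) (τ i) j :=
  (sameCycle_or_of_conj_swap hτ hρ hc he).resolve_left (not_sameCycle_of_conj_swap hτ hρ hc hij he)

end RealOrigami
end

/-! ### Torus triples and switch data -/

noncomputable section

namespace RealOrigami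

open Equiv Equiv.Perm

variable {α : Type*}

/-- No proper nonempty subset is stable under the three permutations. -/
def IsConnected (τ ρ h : Perm α) : Prop :=
  ∀ S : Set α, S.Nonempty → Set.MapsTo τ S S → Set.MapsTo ρ S S → Set.MapsTo h S S → S = Set.univ

/-- The monodromy of a connected unramified real covering of a real torus: two fixed point free
involutions and a permutation commuting with both, acting transitively. -/
structure IsTorusTriple (τ ρ h : Perm α) : Prop where
  left : IsFPFInvolution τ
  right : IsFPFInvolution ρ
  comm_left : τ * h = h * τ
  comm_right : ρ * h = h * ρ
  connected : IsConnected τ ρ h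

theorem isConnected_mul_iff [Finite α] {τ ρ u h : Perm α}
    (hu : ∀ S : Set α, Set.MapsTo τ S S → Set.MapsTo ρ S S → Set.MapsTo u S S) :
    IsConnected τ ρ (u * h) ↔ IsConnected τ ρ h := by
  refine ⟨fun H S h1 h2 h3 h4 => H S h1 h2 h3 fun x hx => hu S h2 h3 (h4 hx),
    fun H S h1 h2 h3 h4 => H S h1 h2 h3 fun x hx => ?_⟩
  have h5 : Set.MapsTo (u⁻¹ : Perm α) S S :=
    mapsTo_of_mem_closure (G := {u}) (by simpa using hu S h2 h3)
      (inv_mem (Subgroup.subset_closure (by simp)))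
  simpa using h5 (h4 hx)

theorem IsTorusTriple.twist {τ ρ h : Perm α} (H : IsTorusTriple τ ρ h) :
    τ * (τ * ρ) * τ * (τ * ρ) = 1 := by
  simp [mul_assoc, H.left.1, H.right.1, ← mul_assoc τ τ]

theorem IsTorusTriple.commute {τ ρ h : Perm α} (H : IsTorusTriple τ ρ h) :
    Commute (τ * ρ) h := by
  rw [Commute, SemiconjBy, mul_assoc, H.comm_right, ← mul_assoc, H.comm_left, mul_assoc]

theorem IsTorusTriple.apply_mul {τ ρ h : Perm α} (H : IsTorusTriple τ ρ h) (x : α) :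
    τ ((τ * ρ) x) = ρ x := by
  rw [mul_apply, H.left.apply_apply]

/-- A power of the meridian permutation with a fixed point is trivial. -/
theorem IsTorusTriple.zpow_eq_one {τ ρ h : Perm α} (H : IsTorusTriple τ ρ h) {a : ℤ} {x : α}
    (hx : ((τ * ρ) ^ a) x = x) : (τ * ρ) ^ a = 1 := by
  -- The fixed points of `v^a` form a nonempty set stable under `τ`, `ρ` and `h`, hence are
  -- everything by connectedness.
  have hτS : Set.MapsTo τ {y | ((τ * ρ) ^ a) y = y} {y | ((τ * ρ) ^ a) y = y} := by
    intro y (hy : ((τ * ρ) ^ a) y = y)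
    show ((τ * ρ) ^ a) (τ y) = τ y
    conv_lhs => rw [← neg_neg a, ← twist_zpow_apply H.left.1 H.twist]
    rw [τ.injective.eq_iff, zpow_neg, inv_eq_iff_eq]
    exact hy.symm
  have hS := H.connected {y | ((τ * ρ) ^ a) y = y} ⟨x, hx⟩ hτS (by
    intro y (hy : ((τ * ρ) ^ a) y = y)
    rw [← H.apply_mul]
    refine hτS ?_
    show ((τ * ρ) ^ a) ((τ * ρ) y) = (τ * ρ) y
    conv_lhs => rw [← mul_apply, ← zpow_add_one, add_comm, zpow_add, zpow_one, mul_apply, hy]) (by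
    intro y (hy : ((τ * ρ) ^ a) y = y)
    show ((τ * ρ) ^ a) (h y) = h y
    rw [← mul_apply, (H.commute.zpow_left a).eq, mul_apply, hy])
  ext y
  have : y ∈ {y | ((τ * ρ) ^ a) y = y} := hS ▸ Set.mem_univ y
  exact this

/-- The cyclic group generated by `τρ` acts freely by `IsTorusTriple.zpow_eq_one`, so all its orbits
have the size of the group. -/
theorem IsTorusTriple.card_sameCycle [Finite α] {τ ρ h : Perm α} (H : IsTorusTriple τ ρ h) (x : α) :
    Nat.card {y // SameCycle (τ * ρ) x y} = orderOf (τ * ρ) := by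
  rw [← Nat.card_zpowers]
  refine (Nat.card_congr (Equiv.ofBijective
    (fun g : Subgroup.zpowers (τ * ρ) => (⟨g.1 x, ?_⟩ : {y // SameCycle (τ * ρ) x y})) ⟨?_, ?_⟩)).symm
  · obtain ⟨a, ha⟩ := g.2
    exact ⟨a, by rw [← ha]⟩
  · rintro ⟨_, a, rfl⟩ ⟨_, b, rfl⟩ hab
    have hab' : ((τ * ρ) ^ a) x = ((τ * ρ) ^ b) x := congrArg Subtype.val hab
    have : ((τ * ρ) ^ (-b + a)) x = x := by
      rw [← zpow_apply_zpow_apply, hab', zpow_apply_zpow_apply, neg_add_cancel, zpow_zero, one_apply]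
    have h1 := H.zpow_eq_one this
    rw [neg_add_eq_sub, zpow_sub, mul_inv_eq_one] at h1
    exact Subtype.ext h1
  · rintro ⟨_, a, rfl⟩
    exact ⟨⟨_, a, rfl⟩, rfl⟩

/-- The function `q` is the degenerate partner to be left out: `τ i` for coverings and `ρ i` for
origami. -/
theorem IsTorusTriple.card_pairs [Finite α] {τ ρ h : Perm α} (H : IsTorusTriple τ ρ h)
    {q : α → α} (hq : ∀ i, SameCycle (τ * ρ) (τ i) (q i)) :
    Nat.card {p : α × α // SameCycle (τ * ρ) (τ p.1) p.2 ∧ p.2 ≠ q p.1} =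
      Nat.card α * (orderOf (τ * ρ) - 1) := by
  have := Fintype.ofFinite α
  let e : {p : α × α // SameCycle (τ * ρ) (τ p.1) p.2 ∧ p.2 ≠ q p.1} ≃
      Σ i : α, {j : α // SameCycle (τ * ρ) (τ i) j ∧ j ≠ q i} :=
    { toFun := fun p => ⟨p.1.1, p.1.2, p.2⟩
      invFun := fun p => ⟨(p.1, p.2.1), p.2.2⟩
      left_inv := fun _ => rfl
      right_inv := fun _ => rfl }
  rw [Nat.card_congr e, Nat.card_sigma]
  have : ∀ i : α, Nat.card {j : α // SameCycle (τ * ρ) (τ i) j ∧ j ≠ q i} =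
      orderOf (τ * ρ) - 1 := by
    intro i
    rw [← H.card_sameCycle (τ i)]
    have h1 : {j : α | SameCycle (τ * ρ) (τ i) j ∧ j ≠ q i} =
      {j | SameCycle (τ * ρ) (τ i) j} \ {q i} := rfl
    have h2 := Set.ncard_sdiff_singleton_of_mem (show q i ∈ {j | SameCycle (τ * ρ) (τ i) j} from hq i)
    rw [← h1] at h2
    exact h2
  simp only [this, Finset.sum_const, Finset.card_univ, Nat.card_eq_fintype_card, smul_eq_mul]

variable [DecidableEq α]

/-- Data `(τ, ρ, h, i, j)` such that `h` commutes with `τ` and conjugates `ρ` to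
`(i j) ρ (i j)`. -/
structure IsSwitchDatum (τ ρ h : Perm α) (i j : α) : Prop where
  left : IsFPFInvolution τ
  right : IsFPFInvolution ρ
  comm : τ * h = h * τ
  ne : i ≠ j
  conj : h * ρ * h⁻¹ = swap i j * ρ * swap i j
  connected : IsConnected τ ρ h

open Classical in
/-- A permutation commuting with `τ` that reverses the arc between `i` and `j` in the cycle of
`τ`- and `ρ`-edges. -/
def reversal (τ ρ : Perm α) (i j : α) : Perm α :=
  if H : ∃ u : Perm α, τ * u = u * τ ∧ u * ρ * u⁻¹ = swap i j * ρ * swap i j ∧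
      ∀ S : Set α, Set.MapsTo τ S S → Set.MapsTo ρ S S → Set.MapsTo u S S then H.choose else 1

theorem reversal_spec [Finite α] {τ ρ : Perm α} (hτ : IsFPFInvolution τ)
    (hρ : IsFPFInvolution ρ) {i j : α} (hij : SameCycle (τ * ρ) (τ i) j) :
    τ * reversal τ ρ i j = reversal τ ρ i j * τ ∧
      reversal τ ρ i j * ρ * (reversal τ ρ i j)⁻¹ = swap i j * ρ * swap i j ∧
      ∀ S : Set α, Set.MapsTo τ S S → Set.MapsTo ρ S S → Set.MapsTo (reversal τ ρ i j) S S := by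
  have H := exists_commute_conj_eq hτ hρ i j hij
  rw [reversal, dif_pos H]
  exact H.choose_spec

/-- The reversal performs the same switch as `reversal τ ρ i j * h`, so the remaining factor `h`
centralizes `ρ`; it centralizes `τ` because the reversal does. -/
theorem isSwitchDatum_iff [Finite α] {τ ρ h : Perm α} {i j : α} :
    IsSwitchDatum τ ρ (reversal τ ρ i j * h) i j ↔
      IsTorusTriple τ ρ h ∧ SameCycle (τ * ρ) (τ i) j := by
  constructor
  · rintro ⟨hτ, hρ, hc, hij, he, ht⟩
    have hs := sameCycle_of_conj_swap hτ hρ hc hij he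
    obtain ⟨u1, u2, u3⟩ := reversal_spec hτ hρ hs
    refine ⟨⟨hτ, hρ, ?_, ?_, (isConnected_mul_iff u3).1 ht⟩, hs⟩
    · rw [← mul_assoc, u1, mul_assoc, mul_assoc] at hc
      exact mul_left_cancel hc
    · rw [← u2] at he
      have : reversal τ ρ i j * (h * ρ * h⁻¹) * (reversal τ ρ i j)⁻¹ =
          reversal τ ρ i j * ρ * (reversal τ ρ i j)⁻¹ := by
        rw [← he]; group
      rw [mul_left_inj, mul_right_inj, mul_inv_eq_iff_eq_mul] at this
      exact this.symm
  · rintro ⟨⟨hτ, hρ, h1, h2, ht⟩, hs⟩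
    obtain ⟨u1, u2, u3⟩ := reversal_spec hτ hρ hs
    refine ⟨hτ, hρ, ?_, ?_, ?_, (isConnected_mul_iff u3).2 ht⟩
    · rw [← mul_assoc, u1, mul_assoc, h1, mul_assoc]
    · rintro rfl
      obtain ⟨a, ha⟩ := hs.symm
      exact zpow_apply_ne hτ (by rwa [← mul_assoc, hτ.1, one_mul]) a i ha
    · rw [← u2]
      have : h * ρ * h⁻¹ = ρ := by rw [← h2]; group
      calc reversal τ ρ i j * h * ρ * (reversal τ ρ i j * h)⁻¹
          = reversal τ ρ i j * (h * ρ * h⁻¹) * (reversal τ ρ i j)⁻¹ := by group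
        _ = _ := by rw [this]

theorem card_switchDatum [Finite α] (q : Perm α → Perm α → α → α) :
    Nat.card {p : (Perm α × Perm α × Perm α) × α × α //
      IsSwitchDatum p.1.1 p.1.2.1 p.1.2.2 p.2.1 p.2.2 ∧ p.2.2 ≠ q p.1.1 p.1.2.1 p.2.1} =
    Nat.card {p : (Perm α × Perm α × Perm α) × α × α //
      IsTorusTriple p.1.1 p.1.2.1 p.1.2.2 ∧ SameCycle (p.1.1 * p.1.2.1) (p.1.1 p.2.1) p.2.2 ∧
        p.2.2 ≠ q p.1.1 p.1.2.1 p.2.1} := by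
  -- The reversal depends only on `τ`, `ρ`, `i`, `j`, and has the default value `1`, so multiplying
  -- `h` by it is a bijection of all tuples, with no condition on them.
  let e : (Perm α × Perm α × Perm α) × α × α ≃ (Perm α × Perm α × Perm α) × α × α :=
    { toFun := fun p => ((p.1.1, p.1.2.1, reversal p.1.1 p.1.2.1 p.2.1 p.2.2 * p.1.2.2), p.2)
      invFun := fun p => ((p.1.1, p.1.2.1, (reversal p.1.1 p.1.2.1 p.2.1 p.2.2)⁻¹ * p.1.2.2), p.2)
      left_inv := fun _ => by simp
      right_inv := fun _ => by simp }
  refine (Nat.card_congr (e.subtypeEquiv fun p => ?_)).symm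
  rw [← and_assoc, ← isSwitchDatum_iff]
  exact Iff.rfl

theorem card_switchDatum_eq_sum [Finite α]
    [Fintype {t : Perm α × Perm α × Perm α // IsTorusTriple t.1 t.2.1 t.2.2}]
    {q : Perm α → Perm α → α → α}
    (hq : ∀ τ ρ, IsFPFInvolution τ → IsFPFInvolution ρ → ∀ i, SameCycle (τ * ρ) (τ i) (q τ ρ i)) :
    Nat.card {p : (Perm α × Perm α × Perm α) × α × α //
      IsSwitchDatum p.1.1 p.1.2.1 p.1.2.2 p.2.1 p.2.2 ∧ p.2.2 ≠ q p.1.1 p.1.2.1 p.2.1} =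
    ∑ t : {t : Perm α × Perm α × Perm α // IsTorusTriple t.1 t.2.1 t.2.2},
      Nat.card α * (orderOf (t.1.1 * t.1.2.1) - 1) := by
  rw [card_switchDatum q]
  let e : {p : (Perm α × Perm α × Perm α) × α × α //
      IsTorusTriple p.1.1 p.1.2.1 p.1.2.2 ∧ SameCycle (p.1.1 * p.1.2.1) (p.1.1 p.2.1) p.2.2 ∧
        p.2.2 ≠ q p.1.1 p.1.2.1 p.2.1} ≃
      Σ t : {t : Perm α × Perm α × Perm α // IsTorusTriple t.1 t.2.1 t.2.2},
        {p : α × α // SameCycle (t.1.1 * t.1.2.1) (t.1.1 p.1) p.2 ∧ p.2 ≠ q t.1.1 t.1.2.1 p.1} :=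
    { toFun := fun p => ⟨⟨p.1.1, p.2.1⟩, p.1.2, p.2.2⟩
      invFun := fun p => ⟨(p.1.1, p.2.1), p.1.2, p.2.2⟩
      left_inv := fun _ => rfl
      right_inv := fun _ => rfl }
  rw [Nat.card_congr e, Nat.card_sigma]
  exact Finset.sum_congr rfl fun t _ => t.2.card_pairs (hq _ _ t.2.left t.2.right)

end RealOrigami
end

/-! ### Counting torus triples by dihedral models -/

noncomputable section

namespace RealOrigami

open Equiv Equiv.Perm DihedralGroup

variable {α β : Type*}

theorem eq_univ_of_dihedral {ℓ : ℕ} [NeZero ℓ] {S : Set (DihedralGroup ℓ)} (hS : S.Nonempty)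
    (h0 : ∀ g ∈ S, sr 0 * g ∈ S) (h1 : ∀ g ∈ S, sr 1 * g ∈ S) : S = Set.univ := by
  obtain ⟨g, hg⟩ := hS
  have hr : ∀ k : ℕ, (r 1 : DihedralGroup ℓ) ^ k * g ∈ S := by
    intro k
    induction k with
    | zero => simpa using hg
    | succ k ih =>
      have : (r 1 : DihedralGroup ℓ) ^ (k + 1) * g = sr 0 * (sr 1 * (r 1 ^ k * g)) := by
        rw [pow_succ', ← mul_assoc (sr 0), sr_mul_sr, sub_zero, mul_assoc]
      rw [this]
      exact h0 _ (h1 _ ih)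
  have hr' : ∀ a : ZMod ℓ, r a * g ∈ S := fun a => by
    have := hr a.val
    rwa [r_one_pow, ZMod.natCast_zmod_val] at this
  refine Set.eq_univ_of_forall fun g' => ?_
  rw [← inv_mul_cancel_right g' g]
  rcases g' * g⁻¹ with a | a
  · exact hr' a
  · have := h0 _ (hr' a)
    rwa [← mul_assoc, sr_mul_r, zero_add] at this

section Model

variable (k ℓ : ℕ)

/-- Left multiplication by `g` on the second factor. -/
def modelLeft (g : DihedralGroup ℓ) : Perm (Fin (k + 1) × DihedralGroup ℓ) :=
  Equiv.prodCongr (Equiv.refl _) (Equiv.mulLeft g)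

/-- The cyclic shift of the components, twisted by right multiplication with `c` when passing from
the last component to the first. -/
def modelShift (c : DihedralGroup ℓ) : Perm (Fin (k + 1) × DihedralGroup ℓ) :=
  Equiv.prodShear (finRotate (k + 1))
    (fun i => if i = Fin.last k then Equiv.mulRight c else Equiv.refl _)

variable {k ℓ}

theorem modelLeft_apply (g : DihedralGroup ℓ) (y : Fin (k + 1) × DihedralGroup ℓ) :
    modelLeft k ℓ g y = (y.1, g * y.2) := rfl

theorem modelShift_last (c g : DihedralGroup ℓ) :
    modelShift k ℓ c (Fin.last k, g) = (0, g * c) := by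
  simp [modelShift]

theorem modelShift_castSucc (c g : DihedralGroup ℓ) (i : Fin k) :
    modelShift k ℓ c (i.castSucc, g) = (i.succ, g) := by
  simp [modelShift, (Fin.castSucc_lt_last i).ne]

theorem modelLeft_mul (g g' : DihedralGroup ℓ) :
    modelLeft k ℓ g * modelLeft k ℓ g' = modelLeft k ℓ (g * g') := by
  ext1 y
  simp [modelLeft_apply, mul_assoc]

theorem modelLeft_one : modelLeft k ℓ 1 = 1 := by
  ext1 y
  simp [modelLeft_apply]

theorem isFPFInvolution_modelLeft_sr (a : ZMod ℓ) : IsFPFInvolution (modelLeft k ℓ (sr a)) := by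
  refine ⟨by rw [modelLeft_mul, sr_mul_self, modelLeft_one], fun y hy => ?_⟩
  have : sr a * y.2 = y.2 := congrArg Prod.snd hy
  rw [mul_eq_right] at this
  cases this

theorem modelLeft_comm_modelShift (g c : DihedralGroup ℓ) :
    modelLeft k ℓ g * modelShift k ℓ c = modelShift k ℓ c * modelLeft k ℓ g := by
  ext1 ⟨i, g'⟩
  rw [mul_apply, mul_apply, modelLeft_apply, modelLeft_apply]
  refine Fin.lastCases ?_ (fun i => ?_) i
  · rw [modelShift_last, modelShift_last, mul_assoc]
  · rw [modelShift_castSucc, modelShift_castSucc]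

theorem orderOf_model : orderOf (modelLeft k ℓ (sr 0) * modelLeft k ℓ (sr 1)) = ℓ := by
  let f : DihedralGroup ℓ →* Perm (Fin (k + 1) × DihedralGroup ℓ) :=
    { toFun := modelLeft k ℓ
      map_one' := modelLeft_one
      map_mul' := fun g g' => (modelLeft_mul g g').symm }
  have hf : Function.Injective f := by
    intro g g' h
    have := congrArg (fun p : Perm (Fin (k + 1) × DihedralGroup ℓ) => (p (0, 1)).2) h
    simpa [f, modelLeft_apply] using this
  have : modelLeft k ℓ (sr 0) * modelLeft k ℓ (sr 1) = f (r 1) := by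
    rw [modelLeft_mul, sr_mul_sr, sub_zero]
    rfl
  rw [this, orderOf_injective f hf, orderOf_r_one]

theorem isTorusTriple_model [NeZero ℓ] (c : DihedralGroup ℓ) :
    IsTorusTriple (modelLeft k ℓ (sr 0)) (modelLeft k ℓ (sr 1)) (modelShift k ℓ c) := by
  refine ⟨isFPFInvolution_modelLeft_sr 0, isFPFInvolution_modelLeft_sr 1,
    modelLeft_comm_modelShift _ c, modelLeft_comm_modelShift _ c, fun S hS h0 h1 hh => ?_⟩
  have hrow : ∀ i g, (i, g) ∈ S → ∀ g', (i, g') ∈ S := by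
    intro i g hg g'
    have := eq_univ_of_dihedral (S := {g | (i, g) ∈ S}) ⟨g, hg⟩ (fun g hg => h0 hg)
      (fun g hg => h1 hg)
    have h : g' ∈ {g | (i, g) ∈ S} := this ▸ Set.mem_univ g'
    exact h
  obtain ⟨⟨i, g⟩, hi⟩ := hS
  have hlast : (Fin.last k, (1 : DihedralGroup ℓ)) ∈ S := by
    induction i using Fin.reverseInduction with
    | last => exact hrow _ _ hi _
    | cast i ih =>
      refine ih ?_
      rw [← modelShift_castSucc c]
      exact hh hi
  have hall : ∀ (i : Fin (k + 1)) (g : DihedralGroup ℓ), (i, g) ∈ S := by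
    intro i
    induction i using Fin.induction with
    | zero =>
      have := hh hlast
      rw [modelShift_last] at this
      exact hrow _ _ this
    | succ i ih =>
      intro g
      rw [← modelShift_castSucc c]
      exact hh (ih g)
  exact Set.eq_univ_of_forall fun y => hall y.1 y.2

end Model

theorem IsTorusTriple.permCongr {τ ρ h : Perm β} (H : IsTorusTriple τ ρ h) (e : β ≃ α) :
    IsTorusTriple (e.permCongr τ) (e.permCongr ρ) (e.permCongr h) := by
  have hinv : ∀ {τ : Perm β}, IsFPFInvolution τ → IsFPFInvolution (e.permCongr τ) := fun hτ =>
    ⟨by rw [← Equiv.permCongr_mul, hτ.1]; ext; simp, fun x hx => hτ.2 (e.symm x) (by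
      rw [Equiv.permCongr_apply] at hx
      rw [Equiv.eq_symm_apply, hx])⟩
  refine ⟨hinv H.left, hinv H.right, ?_, ?_, fun S hS h0 h1 hh => ?_⟩
  · rw [← Equiv.permCongr_mul, ← Equiv.permCongr_mul, H.comm_left]
  · rw [← Equiv.permCongr_mul, ← Equiv.permCongr_mul, H.comm_right]
  · have hmap : ∀ {p : Perm β}, Set.MapsTo (e.permCongr p) S S → Set.MapsTo p (e ⁻¹' S) (e ⁻¹' S) :=
      fun hp y hy => by simpa using hp hy
    obtain ⟨x, hx⟩ := hS
    have := H.connected (e ⁻¹' S) ⟨e.symm x, by simpa using hx⟩ (hmap h0) (hmap h1) (hmap hh)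
    refine Set.eq_univ_of_forall fun x => ?_
    have hx : e.symm x ∈ e ⁻¹' S := this ▸ Set.mem_univ _
    simpa using hx

theorem orderOf_permCongr (e : β ≃ α) (p q : Perm β) :
    orderOf (e.permCongr p * e.permCongr q) = orderOf (p * q) := by
  rw [← Equiv.permCongr_mul]
  exact orderOf_injective (Equiv.permCongrHom e).toMonoidHom (Equiv.permCongrHom e).injective _

/-- The action of the dihedral group generated by two involutions. -/
def dihedralHom {τ ρ h : Perm α} (H : IsTorusTriple τ ρ h) {ℓ : ℕ} (hℓ : orderOf (τ * ρ) = ℓ) :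
    DihedralGroup ℓ →* Perm α where
  toFun
    | r a => (τ * ρ) ^ (a.cast : ℤ)
    | sr a => τ * (τ * ρ) ^ (a.cast : ℤ)
  map_one' := by
    rw [DihedralGroup.one_def]
    simp
  map_mul' := by
    have hc : ∀ b : ℤ, (τ * ρ) ^ (((b : ZMod ℓ)).cast : ℤ) = (τ * ρ) ^ b := fun b => by
      rw [ZMod.coe_intCast, ← hℓ, zpow_mod_orderOf]
    have ht : ∀ b : ℤ, (τ * ρ) ^ b * τ = τ * (τ * ρ) ^ (-b) := fun b => by
      ext x
      rw [mul_apply, mul_apply, twist_zpow_apply H.left.1 H.twist, neg_neg]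
    rintro (a | a) (b | b)
    all_goals
      obtain ⟨a, rfl⟩ := ZMod.intCast_surjective a
      obtain ⟨b, rfl⟩ := ZMod.intCast_surjective b
      simp only [r_mul_r, r_mul_sr, sr_mul_r, sr_mul_sr, ← Int.cast_add, ← Int.cast_sub, hc]
    · rw [zpow_add]
    · rw [← mul_assoc, ht, mul_assoc, ← zpow_add, neg_add_eq_sub]
    · rw [zpow_add, mul_assoc]
    · rw [mul_assoc, ← mul_assoc _ τ, ht, ← mul_assoc, ← mul_assoc, H.left.1, one_mul, ← zpow_add,
        neg_add_eq_sub]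

section Dihedral

variable {τ ρ h : Perm α} (H : IsTorusTriple τ ρ h) {ℓ : ℕ} (hℓ : orderOf (τ * ρ) = ℓ)

theorem dihedralHom_sr (a : ZMod ℓ) : dihedralHom H hℓ (sr a) = τ * (τ * ρ) ^ (a.cast : ℤ) := rfl

theorem dihedralHom_sr_zero : dihedralHom H hℓ (sr 0) = τ := by
  rw [dihedralHom_sr]
  simp

theorem dihedralHom_sr_one : dihedralHom H hℓ (sr 1) = ρ := by
  rw [dihedralHom_sr, ← Int.cast_one, ZMod.coe_intCast, ← hℓ, zpow_mod_orderOf, zpow_one,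
    ← mul_assoc, H.left.1, one_mul]

theorem commute_dihedralHom (g : DihedralGroup ℓ) : Commute h (dihedralHom H hℓ g) := by
  rcases g with a | a
  · exact (H.commute.zpow_left _).symm
  · exact Commute.mul_right H.comm_left.symm (H.commute.zpow_left _).symm

/-- Freeness of the dihedral action: rotations are covered by `IsTorusTriple.zpow_eq_one`, and a
reflection with a fixed point would put `x` and `τ x` into one `v`-cycle. -/
theorem eq_one_of_dihedralHom_apply {g : DihedralGroup ℓ} {x : α}
    (hx : dihedralHom H hℓ g x = x) : g = 1 := by
  rcases g with a | a
  · have := H.zpow_eq_one hx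
    rw [← orderOf_dvd_iff_zpow_eq_one, hℓ, ← ZMod.intCast_zmod_eq_zero_iff_dvd] at this
    rw [DihedralGroup.one_def, ← this]
    simp
  · rw [dihedralHom_sr, mul_apply] at hx
    refine absurd ?_ (zpow_apply_ne H.left (v := τ * ρ) (by
      rw [← mul_assoc, H.left.1, one_mul]; exact H.right) (a.cast) x)
    rw [← hx, H.left.apply_apply, hx]

/-- The points of a torus triple, seen from a base point. -/
def dihedralOrbit (k : ℕ) (x : α) (y : Fin (k + 1) × DihedralGroup ℓ) : α :=
  (h ^ (y.1 : ℕ)) (dihedralHom H hℓ y.2 x)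

theorem pow_apply_dihedralHom (n : ℕ) (g : DihedralGroup ℓ) (x : α) :
    (h ^ n) (dihedralHom H hℓ g x) = dihedralHom H hℓ g ((h ^ n) x) := by
  rw [← mul_apply, ((commute_dihedralHom H hℓ g).pow_left n).eq, mul_apply]

theorem dihedralHom_dihedralOrbit (k : ℕ) (x : α) (g : DihedralGroup ℓ)
    (y : Fin (k + 1) × DihedralGroup ℓ) :
    dihedralHom H hℓ g (dihedralOrbit H hℓ k x y) = dihedralOrbit H hℓ k x (modelLeft k ℓ g y) := by
  rw [dihedralOrbit, dihedralOrbit, ← pow_apply_dihedralHom, modelLeft_apply, map_mul, mul_apply]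

/-- Here `k + 1` is the least positive number of steps of `h` that brings `x` back to its dihedral
orbit, and `c` is the group element describing where it returns. Minimality and freeness give
injectivity, connectedness gives surjectivity. -/
theorem exists_dihedralOrbit_bijective [Finite α] (x : α) :
    ∃ (k : ℕ) (c : DihedralGroup ℓ), Function.Bijective (dihedralOrbit H hℓ k x) ∧
      ∀ y, h (dihedralOrbit H hℓ k x y) = dihedralOrbit H hℓ k x (modelShift k ℓ c y) := by
  classical
  have hex : ∃ k, ∃ c : DihedralGroup ℓ, (h ^ (k + 1)) x = dihedralHom H hℓ c x := by
    -- The exponent being minimized is `k + 1`, so the order of `h` is entered with one subtracted.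
    refine ⟨orderOf h - 1, 1, ?_⟩
    rw [Nat.sub_add_cancel (orderOf_pos h), pow_orderOf_eq_one, map_one]
  obtain ⟨c, hc⟩ := Nat.find_spec hex
  have hmin : ∀ m, m < Nat.find hex → ∀ c : DihedralGroup ℓ,
      (h ^ (m + 1)) x ≠ dihedralHom H hℓ c x := fun m hm c h' => Nat.find_min hex hm ⟨c, h'⟩
  set k := Nat.find hex
  have hshift : ∀ y, h (dihedralOrbit H hℓ k x y) =
      dihedralOrbit H hℓ k x (modelShift k ℓ c y) := by
    rintro ⟨i, g⟩
    have h1 : h (dihedralOrbit H hℓ k x (i, g)) = (h ^ ((i : ℕ) + 1)) (dihedralHom H hℓ g x) := by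
      rw [pow_succ', mul_apply]
      rfl
    rw [h1]
    refine Fin.lastCases ?_ (fun i => ?_) i
    · rw [modelShift_last, Fin.val_last, pow_apply_dihedralHom, hc, ← mul_apply, ← map_mul]
      simp [dihedralOrbit]
    · rw [modelShift_castSucc]
      simp [dihedralOrbit]
  refine ⟨k, c, ⟨?_, ?_⟩, hshift⟩
  · have aux : ∀ (i j : Fin (k + 1)) (g g' : DihedralGroup ℓ), i ≤ j →
        dihedralOrbit H hℓ k x (i, g) = dihedralOrbit H hℓ k x (j, g') → (i, g) = (j, g') := by
      intro i j g g' hij he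
      obtain ⟨d, hd⟩ := Nat.exists_eq_add_of_le (Fin.le_def.1 hij)
      have h1 : dihedralHom H hℓ g x = dihedralHom H hℓ g' ((h ^ d) x) := by
        rw [← pow_apply_dihedralHom]
        rw [dihedralOrbit, dihedralOrbit, hd, pow_add, mul_apply] at he
        exact (h ^ (i : ℕ)).injective he
      have h2 : (h ^ d) x = dihedralHom H hℓ (g'⁻¹ * g) x := by
        rw [map_mul, mul_apply, h1, ← mul_apply, ← map_mul, inv_mul_cancel, map_one, one_apply]
      have hd0 : d = 0 := by
        by_contra hne
        obtain ⟨d, rfl⟩ := Nat.exists_eq_succ_of_ne_zero hne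
        exact hmin d (by have := j.2; omega) _ h2
      subst hd0
      have h3 := eq_one_of_dihedralHom_apply H hℓ (g := g'⁻¹ * g) (x := x) (by
        rw [← h2]; simp)
      rw [inv_mul_eq_one] at h3
      exact Prod.ext (Fin.ext (by simpa using hd.symm)) h3.symm
    rintro ⟨i, g⟩ ⟨j, g'⟩ he
    rcases le_total i j with hij | hij
    · exact aux _ _ _ _ hij he
    · exact (aux _ _ _ _ hij he.symm).symm
  · rw [← Set.range_eq_univ]
    refine H.connected _ ⟨_, (0, 1), rfl⟩ ?_ ?_ ?_
    · rintro _ ⟨y, rfl⟩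
      exact ⟨_, by rw [← dihedralHom_dihedralOrbit, dihedralHom_sr_zero]⟩
    · rintro _ ⟨y, rfl⟩
      exact ⟨_, by rw [← dihedralHom_dihedralOrbit, dihedralHom_sr_one]⟩
    · rintro _ ⟨y, rfl⟩
      exact ⟨_, (hshift y).symm⟩

end Dihedral

/-- Torus triples with a given order of the meridian. -/
abbrev TorusTriple (α : Type*) (ℓ : ℕ) : Type _ :=
  {t : Perm α × Perm α × Perm α // IsTorusTriple t.1 t.2.1 t.2.2 ∧ orderOf (t.1 * t.2.1) = ℓ}

/-- The torus triple with a base point obtained by transporting the model along a labelling. -/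
def labelledModel (k ℓ : ℕ) [NeZero ℓ]
    (p : DihedralGroup ℓ × (Fin (k + 1) × DihedralGroup ℓ ≃ α)) : TorusTriple α ℓ × α :=
  (⟨(p.2.permCongr (modelLeft k ℓ (sr 0)), p.2.permCongr (modelLeft k ℓ (sr 1)),
    p.2.permCongr (modelShift k ℓ p.1)), (isTorusTriple_model p.1).permCongr p.2,
    (orderOf_permCongr _ _ _).trans orderOf_model⟩, p.2 (0, 1))

/-- The image of the base point determines the labelling, by following the three permutations; then
`c` is read off where the shift closes up. -/
theorem labelledModel_injective (k ℓ : ℕ) [NeZero ℓ] :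
    Function.Injective (labelledModel (α := α) k ℓ) := by
  rintro ⟨c, e⟩ ⟨c', e'⟩ hp
  simp only [labelledModel, Prod.mk.injEq, Subtype.mk.injEq] at hp
  obtain ⟨⟨h0, h1, hh⟩, hx⟩ := hp
  have hmove : ∀ {p p' : Perm (Fin (k + 1) × DihedralGroup ℓ)}, e.permCongr p = e'.permCongr p' →
      ∀ y, e y = e' y → e (p y) = e' (p' y) := by
    intro p p' hpp y hy
    have := congrArg (fun f : Perm α => f (e y)) hpp
    simp only [Equiv.permCongr_apply, Equiv.symm_apply_apply] at this
    rw [this, hy, Equiv.symm_apply_apply]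
  have hrow : ∀ (i : Fin (k + 1)) (g : DihedralGroup ℓ), e (i, g) = e' (i, g) := by
    intro i
    induction i using Fin.induction with
    | zero =>
      intro g
      have := eq_univ_of_dihedral (S := {g | e (0, g) = e' (0, g)}) ⟨1, hx⟩
        (fun g hg => hmove h0 _ hg) (fun g hg => hmove h1 _ hg)
      have hg : g ∈ {g | e (0, g) = e' (0, g)} := this ▸ Set.mem_univ g
      exact hg
    | succ i ih =>
      intro g
      have := hmove hh _ (ih g)
      rwa [modelShift_castSucc, modelShift_castSucc] at this
  have he : e = e' := Equiv.ext fun y => hrow y.1 y.2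
  subst he
  have := hmove hh (Fin.last k, 1) rfl
  rw [modelShift_last, modelShift_last, e.injective.eq_iff] at this
  simpa using this

theorem exists_labelledModel_eq [Finite α] {ℓ : ℕ} [NeZero ℓ] (t : TorusTriple α ℓ) (x : α) :
    ∃ k p, labelledModel k ℓ p = (t, x) := by
  obtain ⟨⟨τ, ρ, h⟩, H, hℓ⟩ := t
  obtain ⟨k, c, hb, hc⟩ := exists_dihedralOrbit_bijective H hℓ x
  let e := Equiv.ofBijective _ hb
  have key : ∀ {p : Perm (Fin (k + 1) × DihedralGroup ℓ)} {f : Perm α},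
      (∀ y, f (e y) = e (p y)) → e.permCongr p = f := by
    intro p f hf
    ext z
    obtain ⟨y, rfl⟩ := e.surjective z
    rw [Equiv.permCongr_apply, Equiv.symm_apply_apply, hf]
  refine ⟨k, (c, e), ?_⟩
  simp only [labelledModel, Prod.mk.injEq, Subtype.mk.injEq]
  refine ⟨⟨key fun y => ?_, key fun y => ?_, key hc⟩, ?_⟩
  · have := dihedralHom_dihedralOrbit H hℓ k x (sr 0) y
    rwa [dihedralHom_sr_zero] at this
  · have := dihedralHom_dihedralOrbit H hℓ k x (sr 1) y
    rwa [dihedralHom_sr_one] at this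
  · simp [e, dihedralOrbit]

/-- The factor `2n` on the left chooses a base point. Pointed triples have no automorphisms: they
correspond to `c` (`2ℓ` choices) together with a labelling (`(2n)!` choices), and `k` is forced by
`(k + 1)ℓ = n`. -/
theorem card_torusTriple [Finite α] {n ℓ : ℕ} (hn : 0 < n) (hα : Nat.card α = 2 * n) :
    Nat.card (TorusTriple α ℓ) * (2 * n) = if ℓ ∣ n then 2 * ℓ * (2 * n).factorial else 0 := by
  classical
  have := Fintype.ofFinite α
  have hX : Nonempty α := by
    by_contra h
    rw [not_nonempty_iff] at h
    simp at hα
    omega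
  rcases Nat.eq_zero_or_pos ℓ with rfl | hℓ
  · rw [if_neg (by rw [zero_dvd_iff]; exact hn.ne')]
    have : IsEmpty (TorusTriple α 0) := ⟨fun t => (orderOf_pos (t.1.1 * t.1.2.1)).ne' t.2.2⟩
    simp
  have : NeZero ℓ := ⟨hℓ.ne'⟩
  have hcard : ∀ k, Nat.card (Fin (k + 1) × DihedralGroup ℓ) = 2 * ((k + 1) * ℓ) := fun k => by
    rw [Nat.card_prod, DihedralGroup.nat_card, Nat.card_fin]
    ring
  have huniq : ∀ k (p : DihedralGroup ℓ × (Fin (k + 1) × DihedralGroup ℓ ≃ α)),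
      (k + 1) * ℓ = n := by
    intro k p
    have := Nat.card_congr p.2
    rw [hcard, hα] at this
    omega
  split_ifs with hd
  · obtain ⟨m, rfl⟩ := hd
    obtain ⟨k, rfl⟩ := Nat.exists_eq_succ_of_ne_zero (show m ≠ 0 by rintro rfl; simp at hn)
    have hbij : Function.Bijective (labelledModel (α := α) k ℓ) := by
      refine ⟨labelledModel_injective k ℓ, fun ⟨t, x⟩ => ?_⟩
      obtain ⟨k', p, hp⟩ := exists_labelledModel_eq t x
      have h1 := huniq k' p
      have h2 : k' = k := by
        rw [mul_comm ℓ] at h1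
        have := Nat.eq_of_mul_eq_mul_right hℓ h1
        omega
      subst h2
      exact ⟨p, hp⟩
    have h1 := Nat.card_congr (Equiv.ofBijective _ hbij)
    rw [Nat.card_prod, Nat.card_prod, DihedralGroup.nat_card, hα] at h1
    rw [← h1]
    congr 1
    have hY : Nat.card (Fin (k + 1) × DihedralGroup ℓ) = Nat.card α := by
      rw [hcard, hα, mul_comm ℓ]
    have e := (Finite.card_eq.1 hY).some
    rw [Nat.card_congr (Equiv.equivCongr e (Equiv.refl α)), Nat.card_perm, hα]
  · have : IsEmpty (TorusTriple α ℓ) := ⟨fun t => by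
      obtain ⟨k, p, -⟩ := exists_labelledModel_eq t hX.some
      exact hd ⟨k + 1, by rw [← huniq k p, mul_comm]⟩⟩
    simp

theorem sum_torusTriple [Finite α]
    [Fintype {t : Perm α × Perm α × Perm α // IsTorusTriple t.1 t.2.1 t.2.2}]
    {n : ℕ} (hn : 0 < n) (hα : Nat.card α = 2 * n) :
    ∑ t : {t : Perm α × Perm α × Perm α // IsTorusTriple t.1 t.2.1 t.2.2},
      Nat.card α * (orderOf (t.1.1 * t.1.2.1) - 1) =
    (∑ ℓ ∈ n.divisors, (ℓ - 1) * (2 * ℓ)) * (2 * n).factorial := by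
  classical
  have hdiv : ∀ t : {t : Perm α × Perm α × Perm α // IsTorusTriple t.1 t.2.1 t.2.2},
      orderOf (t.1.1 * t.1.2.1) ∈ n.divisors := by
    intro t
    rw [Nat.mem_divisors]
    refine ⟨?_, hn.ne'⟩
    by_contra hd
    have h1 := card_torusTriple (ℓ := orderOf (t.1.1 * t.1.2.1)) hn hα
    rw [if_neg hd, mul_eq_zero, or_iff_left (by omega), Nat.card_eq_zero] at h1
    rcases h1 with h1 | h1
    · exact h1.false ⟨t.1, t.2, rfl⟩
    · exact h1.not_finite inferInstance
  rw [← Finset.sum_fiberwise_of_maps_to (fun t _ => hdiv t), Finset.sum_mul]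
  refine Finset.sum_congr rfl fun ℓ hℓ => ?_
  rw [Finset.sum_congr rfl (fun t ht => by rw [(Finset.mem_filter.1 ht).2]), Finset.sum_const,
    smul_eq_mul]
  have hc : (Finset.univ.filter fun t : {t : Perm α × Perm α × Perm α //
      IsTorusTriple t.1 t.2.1 t.2.2} => orderOf (t.1.1 * t.1.2.1) = ℓ).card =
      Nat.card (TorusTriple α ℓ) := by
    rw [← Fintype.card_subtype, ← Nat.card_eq_fintype_card]
    exact Nat.card_congr (Equiv.subtypeSubtypeEquivSubtypeInter
      (fun t : Perm α × Perm α × Perm α => IsTorusTriple t.1 t.2.1 t.2.2)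
      (fun t => orderOf (t.1 * t.2.1) = ℓ))
  have h1 := card_torusTriple (α := α) (ℓ := ℓ) hn hα
  rw [if_pos (Nat.dvd_of_mem_divisors hℓ)] at h1
  rw [hc, hα, ← mul_assoc, h1]
  ring


end RealOrigami
end

/-! ### Real origami as switch data -/

noncomputable section

namespace RealOrigami

open Equiv Equiv.Perm

variable {α : Type*}

theorem commute_iff_of_involution {τ h : Perm α} (hτ : IsFPFInvolution τ) :
    τ * h * τ * h⁻¹ = 1 ↔ τ * h = h * τ := by
  rw [mul_inv_eq_one]
  constructor
  · intro H
    nth_rw 2 [← H]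
    rw [mul_assoc _ τ τ, hτ.1, mul_one]
  · intro H
    rw [H, mul_assoc, hτ.1, mul_one]

variable [DecidableEq α] [Fintype α]

/-- Two fixed point free involutions differ by a switch of two edges if and only if their product
has cycle type `[2, 2]`. -/
theorem swap_conj_eq_iff {ρ ρ' : Perm α} (hρ : IsFPFInvolution ρ) (hρ' : IsFPFInvolution ρ')
    (i j : α) : (i ≠ j ∧ ρ' = swap i j * ρ * swap i j ∧ j ≠ ρ i) ↔
      (ρ' * ρ).cycleType = {2, 2} ∧ i ∈ (ρ' * ρ).support ∧ j = (ρ' * ρ) i := by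
  constructor
  · rintro ⟨hij, rfl, hj⟩
    have hw : swap i j * ρ * swap i j * ρ = swap i j * swap (ρ i) (ρ j) := by
      rw [← conj_swap hρ]; group
    have hj' : i ≠ ρ j := fun h => hj (by rw [h, hρ.apply_apply])
    have hne : ρ i ≠ ρ j := fun h => hij (ρ.injective h)
    have hi : (swap i j * swap (ρ i) (ρ j)) i = j := by
      rw [mul_apply, swap_apply_of_ne_of_ne (hρ.2 i).symm hj', swap_apply_left]
    rw [hw, mem_support, hi]
    refine ⟨?_, hij.symm, rfl⟩
    rw [Disjoint.cycleType_mul, (isCycle_swap hij).cycleType, (isCycle_swap hne).cycleType,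
      card_support_swap hij, card_support_swap hne]
    · rfl
    · exact disjoint_swap_swap (by simp [hij, (hρ.2 i).symm, hj', hj, (hρ.2 j).symm])
  · rintro ⟨hct, hi, rfl⟩
    set w := ρ' * ρ with hw_def
    have hwi : w i ≠ i := mem_support.1 hi
    have hw2 : ∀ x, w (w x) = x := by
      have h2 : orderOf w = 2 := by
        rw [← lcm_cycleType, hct]
        decide
      intro x
      have := pow_orderOf_eq_one w
      rw [h2, sq] at this
      rw [← mul_apply, this, one_apply]
    -- Since `w = ρ'ρ` is an involution, `ρ'` and `ρ` commute. So `ρ` preserves the support of `w`,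
    -- which consists of exactly four points `i`, `w i`, `ρ i`, `ρ (w i)`.
    have hρw : ∀ x, w (ρ x) = ρ (w x) := by
      intro x
      have h1 : ρ' x = w (ρ x) := by rw [hw_def, mul_apply, hρ.apply_apply]
      have h2 : ρ' (ρ (w x)) = x := hw2 x
      rw [← h1, ← hρ'.apply_apply (ρ (w x)), h2]
    have hsub : ({i, w i, ρ i, ρ (w i)} : Finset α) ⊆ w.support := by
      intro x hx
      simp only [Finset.mem_insert, Finset.mem_singleton] at hx
      rw [mem_support]
      rcases hx with rfl | rfl | rfl | rfl
      · exact hwi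
      · rw [hw2]; exact hwi.symm
      · rw [hρw]; exact fun h => hwi (ρ.injective h)
      · rw [hρw, hw2]; exact fun h => hwi (ρ.injective h).symm
    have hjρ : w i ≠ ρ i := fun h => hρ'.2 (ρ i) h
    have hiρ : i ≠ ρ (w i) := fun h => hjρ (by rw [← hρ.apply_apply (w i), ← h])
    have hsupp : ({i, w i, ρ i, ρ (w i)} : Finset α) = w.support := by
      refine Finset.eq_of_subset_of_card_le hsub ?_
      rw [← sum_cycleType, hct, Finset.card_eq_of_equiv_fin (n := 4)]
      · decide
      · refine Finset.equivFinOfCardEq ?_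
        rw [Finset.card_insert_of_notMem, Finset.card_insert_of_notMem,
          Finset.card_insert_of_notMem, Finset.card_singleton]
        · simpa using fun h => hwi h.symm
        · simp [hjρ, (hρ.2 (w i)).symm]
        · simp [hwi.symm, (hρ.2 i).symm, hiρ]
    have hkey : swap i (w i) * swap (ρ i) (ρ (w i)) = w := by
      ext x
      rw [mul_apply]
      by_cases hx : x ∈ w.support
      · rw [← hsupp] at hx
        simp only [Finset.mem_insert, Finset.mem_singleton] at hx
        rcases hx with rfl | rfl | rfl | rfl
        · rw [swap_apply_of_ne_of_ne (hρ.2 _).symm hiρ, swap_apply_left]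
        · rw [swap_apply_of_ne_of_ne hjρ (hρ.2 _).symm, swap_apply_right, hw2]
        · rw [swap_apply_left, swap_apply_of_ne_of_ne hiρ.symm (hρ.2 _), hρw]
        · rw [swap_apply_right, swap_apply_of_ne_of_ne (hρ.2 _) hjρ.symm, hρw, hw2]
      · rw [notMem_support.1 hx]
        rw [← hsupp] at hx
        simp only [Finset.mem_insert, Finset.mem_singleton, not_or] at hx
        rw [swap_apply_of_ne_of_ne hx.2.2.1 hx.2.2.2, swap_apply_of_ne_of_ne hx.1 hx.2.1]
    refine ⟨hwi.symm, ?_, hjρ⟩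
    rw [← conj_swap hρ] at hkey
    calc ρ' = ρ' * (ρ * ρ) := by rw [hρ.1, mul_one]
      _ = swap i (w i) * (ρ * swap i (w i) * ρ) * ρ := by rw [hkey, hw_def, mul_assoc]
      _ = swap i (w i) * ρ * swap i (w i) * (ρ * ρ) := by group
      _ = _ := by rw [hρ.1, mul_one]

theorem isRealOrigami_iff {τ h ρ : Perm α} :
    IsRealOrigami τ h (τ * ρ) ↔ IsFPFInvolution τ ∧ IsFPFInvolution ρ ∧ τ * h = h * τ ∧
      IsConnected τ ρ h := by
  have hcan : ∀ (_ : IsFPFInvolution τ), τ * (τ * ρ) = ρ := fun hτ => by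
    rw [← mul_assoc, hτ.1, one_mul]
  have hconn : IsFPFInvolution τ → (MulAction.IsPretransitive
      (Subgroup.closure ({h, τ * ρ, τ} : Set (Perm α))) α ↔ IsConnected τ ρ h) := by
    intro hτ
    rw [isPretransitive_closure_iff]
    refine forall₂_congr fun S _ => ?_
    constructor
    · intro H h1 h2 h3
      refine H ?_
      rintro g (rfl | rfl | rfl)
      · exact h3
      · exact fun x hx => h1 (h2 hx)
      · exact h1
    · intro H H'
      refine H (H' τ (by simp)) ?_ (H' h (by simp))
      rw [← hcan hτ]
      exact fun x hx => H' τ (by simp) (H' (τ * ρ) (by simp) hx)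
  constructor
  · rintro ⟨h1, h2, h3, h4⟩
    refine ⟨h1, ?_, (commute_iff_of_involution h1).1 h2, (hconn h1).1 h4⟩
    have := (isTwisted_iff h1).1 h3
    rwa [hcan h1] at this
  · rintro ⟨h1, h2, h3, h4⟩
    refine ⟨h1, (commute_iff_of_involution h1).2 h3, (isTwisted_iff h1).2 ?_, (hconn h1).2 h4⟩
    rwa [hcan h1]

/-- As `h` commutes with `τ`, the commutator of `h` and `τρ` is the conjugate by `τ` of `hρh⁻¹ρ`. -/
theorem cycleType_commutator {τ h ρ : Perm α} (hρ : IsFPFInvolution ρ)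
    (hc : τ * h = h * τ) :
    (h * (τ * ρ) * h⁻¹ * (τ * ρ)⁻¹).cycleType = (h * ρ * h⁻¹ * ρ).cycleType := by
  rw [← cycleType_conj (σ := h * ρ * h⁻¹ * ρ) (τ := τ)]
  congr 1
  rw [mul_inv_rev, hρ.inv_eq]
  calc h * (τ * ρ) * h⁻¹ * (ρ * τ⁻¹) = (h * τ) * ρ * h⁻¹ * ρ * τ⁻¹ := by group
    _ = _ := by rw [← hc]; group

/-- The pair `(i, j)` is not extra structure: `i` is any of the four points moved by `w = hρh⁻¹ρ`,
and `j = w i`. -/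
theorem card_origami :
    Nat.card {p : (Perm α × Perm α × Perm α) × α × α //
      IsSwitchDatum p.1.1 p.1.2.1 p.1.2.2 p.2.1 p.2.2 ∧ p.2.2 ≠ p.1.2.1 p.2.1} =
    4 * Nat.card {p : Perm α × Perm α × Perm α // IsRealOrigami p.1 p.2.1 p.2.2 ∧
      (p.2.1 * p.2.2 * p.2.1⁻¹ * p.2.2⁻¹).cycleType = {2, 2}} := by
  classical
  have hiff : ∀ p : (Perm α × Perm α × Perm α) × α × α,
      (IsSwitchDatum p.1.1 p.1.2.1 p.1.2.2 p.2.1 p.2.2 ∧ p.2.2 ≠ p.1.2.1 p.2.1) ↔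
      ((IsRealOrigami p.1.1 p.1.2.2 (p.1.1 * p.1.2.1) ∧ (p.1.2.2 * (p.1.1 * p.1.2.1) *
        p.1.2.2⁻¹ * (p.1.1 * p.1.2.1)⁻¹).cycleType = {2, 2}) ∧
        p.2.1 ∈ (p.1.2.2 * p.1.2.1 * p.1.2.2⁻¹ * p.1.2.1).support ∧
        p.2.2 = (p.1.2.2 * p.1.2.1 * p.1.2.2⁻¹ * p.1.2.1) p.2.1) := by
    rintro ⟨⟨τ, ρ, h⟩, i, j⟩
    constructor
    · rintro ⟨⟨h1, h2, h3, h4, h5, h6⟩, h7⟩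
      obtain ⟨a1, a2, a3⟩ := (swap_conj_eq_iff h2 (h2.conj h) i j).1 ⟨h4, h5, h7⟩
      exact ⟨⟨isRealOrigami_iff.2 ⟨h1, h2, h3, h6⟩, (cycleType_commutator h2 h3).trans a1⟩, a2, a3⟩
    · rintro ⟨⟨h1, h2⟩, a2, a3⟩
      obtain ⟨b1, b2, b3, b4⟩ := isRealOrigami_iff.1 h1
      have a1 := (cycleType_commutator b2 b3).symm.trans h2
      obtain ⟨c1, c2, c3⟩ := (swap_conj_eq_iff b2 (b2.conj h) i j).2 ⟨a1, a2, a3⟩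
      exact ⟨⟨b1, b2, b3, c1, c2, b4⟩, c3⟩
  rw [Nat.card_congr (Equiv.subtypeEquivRight hiff)]
  let O := {p : Perm α × Perm α × Perm α // IsRealOrigami p.1 p.2.1 p.2.2 ∧
      (p.2.1 * p.2.2 * p.2.1⁻¹ * p.2.2⁻¹).cycleType = {2, 2}}
  let w : O → Perm α := fun o => o.1.2.1 * (o.1.1 * o.1.2.2) * o.1.2.1⁻¹ * (o.1.1 * o.1.2.2)
  have hinv : ∀ {τ : Perm α}, IsFPFInvolution τ → ∀ v, τ * (τ * v) = v := fun hτ v => by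
    rw [← mul_assoc, hτ.1, one_mul]
  have hw : ∀ o, (w o).support.card = 4 := by
    rintro ⟨⟨τ, h, v⟩, h1, h2⟩
    rw [← hinv h1.involution v] at h1 h2
    obtain ⟨b1, b2, b3, b4⟩ := isRealOrigami_iff.1 h1
    have a1 := (cycleType_commutator b2 b3).symm.trans h2
    have := sum_cycleType (h * (τ * v) * h⁻¹ * (τ * v))
    rw [a1] at this
    exact this.symm
  let e : {p : (Perm α × Perm α × Perm α) × α × α //
      ((IsRealOrigami p.1.1 p.1.2.2 (p.1.1 * p.1.2.1) ∧ (p.1.2.2 * (p.1.1 * p.1.2.1) *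
        p.1.2.2⁻¹ * (p.1.1 * p.1.2.1)⁻¹).cycleType = {2, 2}) ∧
        p.2.1 ∈ (p.1.2.2 * p.1.2.1 * p.1.2.2⁻¹ * p.1.2.1).support ∧
        p.2.2 = (p.1.2.2 * p.1.2.1 * p.1.2.2⁻¹ * p.1.2.1) p.2.1)} ≃
      Σ o : O, (w o).support :=
    { toFun := fun p => ⟨⟨(p.1.1.1, p.1.1.2.2, p.1.1.1 * p.1.1.2.1), p.2.1⟩, p.1.2.1, by
        have := p.2.2.1
        simpa only [w, hinv p.2.1.1.involution] using this⟩
      invFun := fun o => ⟨((o.1.1.1, o.1.1.1 * o.1.1.2.2, o.1.1.2.1), o.2.1, w o.1 o.2.1), by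
        have h1 := o.1.2
        refine ⟨?_, o.2.2, rfl⟩
        simpa only [hinv h1.1.involution] using h1⟩
      left_inv := by
        rintro ⟨⟨⟨τ, ρ, h⟩, i, j⟩, h1, h2, h3⟩
        refine Subtype.ext ?_
        simp only [w, hinv h1.1.involution]
        simp only at h3
        rw [h3]
      right_inv := by
        rintro ⟨⟨⟨τ, h, v⟩, h1⟩, i, hi⟩
        have : τ * (τ * v) = v := hinv h1.1.involution v
        refine Sigma.ext (Subtype.ext ?_) ?_
        · simp only [this]
        · simp only
          congr! }
  rw [Nat.card_congr e, Nat.card_sigma]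
  have hw' : ∀ o, Nat.card (w o).support = 4 := fun o => by
    rw [Nat.card_eq_fintype_card, Fintype.card_coe, hw]
  simp only [hw', Finset.sum_const, Finset.card_univ, smul_eq_mul, O, Nat.card_eq_fintype_card]
  rw [mul_comm]

end RealOrigami
end

/-! ### Real coverings as switch data, and the two counts -/

noncomputable section

namespace RealOrigami

open Equiv Equiv.Perm

variable {α : Type*} [DecidableEq α]

theorem swap_conj_ne_iff {τ : Perm α} (hτ : IsFPFInvolution τ) {i j : α} (hij : i ≠ j) :
    τ * swap i j * τ ≠ swap i j ↔ j ≠ τ i := by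
  rw [conj_swap hτ, not_iff_not]
  constructor
  · intro h
    have h1 := congrArg (fun f : Perm α => f i) h
    simp only [swap_apply_left] at h1
    rw [swap_apply_def, if_neg (hτ.2 i).symm] at h1
    split_ifs at h1 with h2
    · exact h1.symm
    · exact absurd h1 hij
  · rintro rfl
    rw [hτ.apply_apply, swap_comm]

theorem eq_swap_iff [Fintype α] {s : Perm α} {i j : α} :
    (i ≠ j ∧ s = swap i j) ↔ s.IsSwap ∧ i ∈ s.support ∧ j = s i := by
  constructor
  · rintro ⟨h, rfl⟩
    exact ⟨⟨i, j, h, rfl⟩, by simp [h.symm], by simp⟩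
  · rintro ⟨⟨x, y, hxy, rfl⟩, hi, rfl⟩
    rw [support_swap hxy, Finset.mem_insert, Finset.mem_singleton] at hi
    rcases hi with rfl | rfl
    · simp [hxy]
    · simp [hxy.symm, swap_comm]

/-- The monodromy data of real coverings with one pair of simple critical points, for an arbitrary
fixed point free involution. -/
structure IsSimpleCovering [Fintype α] (τ σ η a : Perm α) : Prop where
  twisted : IsTwisted τ σ
  isSwap : η.IsSwap
  ne : τ * η * τ ≠ η
  commute : τ * a = a * τ
  monodromy : η * σ * (τ * η * τ) = a * σ * a⁻¹
  connected : ∀ S : Set α, S.Nonempty → Set.MapsTo τ S S → Set.MapsTo σ S S → Set.MapsTo a S S →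
    Set.MapsTo η S S → S = Set.univ

/-- With `σ = τρ` and `η = τ(i j)τ` the left side of the monodromy relation is `τ(i j)ρ(i j)`, so
the relation becomes the switch condition. Including `η` among the generators adds nothing to
transitivity, as `j` lies in the `v`-cycle of `τ i`. -/
theorem isSimpleCovering_iff [Fintype α] {τ ρ h : Perm α} {i j : α} (hτ : IsFPFInvolution τ)
    (hij : i ≠ j) :
    IsSimpleCovering τ (τ * ρ) (τ * swap i j * τ) h ↔ IsSwitchDatum τ ρ h i j ∧ j ≠ τ i := by
  have hcan : ∀ g : Perm α, τ * (τ * g) = g := fun g => by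
    rw [← mul_assoc, hτ.1, one_mul]
  have hcan' : τ * (τ * swap i j * τ) * τ = swap i j := by
    rw [mul_assoc τ (swap i j) τ, hcan, mul_assoc, hτ.1, mul_one]
  have hmono : τ * h = h * τ → (τ * swap i j * τ * (τ * ρ) * (τ * (τ * swap i j * τ) * τ) =
      h * (τ * ρ) * h⁻¹ ↔ h * ρ * h⁻¹ = swap i j * ρ * swap i j) := by
    intro hc
    rw [hcan', mul_assoc (τ * swap i j) τ, hcan, ← mul_assoc h τ, ← hc, mul_assoc τ h,
      mul_assoc τ (h * ρ), mul_assoc τ _ ρ, mul_assoc τ, mul_right_inj, eq_comm]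
  constructor
  · rintro ⟨h1, -, h3, h4, h5, h6⟩
    have hρ : IsFPFInvolution ρ := by
      have := (isTwisted_iff hτ).1 h1
      rwa [hcan] at this
    have he := (hmono h4).1 h5
    have hs := sameCycle_of_conj_swap hτ hρ h4 hij he
    refine ⟨⟨hτ, hρ, h4, hij, he, fun S a1 a2 a3 a4 => ?_⟩, ?_⟩
    · have hsw : Set.MapsTo (swap i j) S S := by
        refine mapsTo_swap ?_
        rw [← mem_iff_of_sameCycle a2 a3 hs]
        exact ⟨fun h => a2 h, fun h => by simpa [hτ.apply_apply] using a2 h⟩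
      exact h6 S a1 a2 (fun x hx => a2 (a3 hx)) a4 (fun x hx => a2 (hsw (a2 hx)))
    · rw [hcan'] at h3
      exact (swap_conj_ne_iff hτ hij).1 h3.symm
  · rintro ⟨⟨-, h2, h3, -, h5, h6⟩, h7⟩
    refine ⟨(isTwisted_iff hτ).2 (by rwa [hcan]), ?_, ?_, h3, (hmono h3).2 h5,
      fun S a1 a2 a3 a4 a5 => h6 S a1 a2 ?_ a4⟩
    · rw [conj_swap hτ]
      exact ⟨_, _, fun h => hij (τ.injective h), rfl⟩
    · rw [hcan']
      exact ((swap_conj_ne_iff hτ hij).2 h7).symm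
    · rw [← hcan ρ]
      exact fun x hx => a2 (a3 hx)

/-- Switch data over `τ` count simple coverings twice. -/
theorem card_simpleCovering [Fintype α] {τ : Perm α} (hτ : IsFPFInvolution τ) :
    Nat.card {p : (Perm α × Perm α) × α × α //
      IsSwitchDatum τ p.1.1 p.1.2 p.2.1 p.2.2 ∧ p.2.2 ≠ τ p.2.1} =
    2 * Nat.card {p : Perm α × Perm α × Perm α // IsSimpleCovering τ p.1 p.2.1 p.2.2} := by
  classical
  have hcan : ∀ g : Perm α, τ * (τ * g) = g := fun g => by
    rw [← mul_assoc, hτ.1, one_mul]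
  have hcan' : ∀ g : Perm α, τ * (τ * g * τ) * τ = g := fun g => by
    rw [mul_assoc τ g τ, hcan, mul_assoc, hτ.1, mul_one]
  have hswap : ∀ {s : Perm α}, s.IsSwap → (τ * s * τ).IsSwap := by
    rintro _ ⟨x, y, hxy, rfl⟩
    rw [conj_swap hτ]
    exact ⟨_, _, fun h => hxy (τ.injective h), rfl⟩
  let C := {p : Perm α × Perm α × Perm α // IsSimpleCovering τ p.1 p.2.1 p.2.2}
  let e : {p : (Perm α × Perm α) × α × α //
      IsSwitchDatum τ p.1.1 p.1.2 p.2.1 p.2.2 ∧ p.2.2 ≠ τ p.2.1} ≃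
      Σ c : C, (τ * c.1.2.1 * τ).support :=
    { toFun := fun p => ⟨⟨(τ * p.1.1.1, τ * swap p.1.2.1 p.1.2.2 * τ, p.1.1.2),
          (isSimpleCovering_iff hτ p.2.1.ne).2 p.2⟩, p.1.2.1, by
          rw [hcan', mem_support, swap_apply_left]
          exact p.2.1.ne.symm⟩
      invFun := fun c => ⟨((τ * c.1.1.1, c.1.1.2.2), c.2.1, (τ * c.1.1.2.1 * τ) c.2.1), by
          obtain ⟨h1, h2⟩ := eq_swap_iff.2 ⟨hswap c.1.2.isSwap, c.2.2, rfl⟩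
          rw [← isSimpleCovering_iff hτ h1, ← h2, hcan', hcan]
          exact c.1.2⟩
      left_inv := by
        rintro ⟨⟨⟨ρ, h⟩, i, j⟩, h1, h2⟩
        refine Subtype.ext ?_
        simp only [hcan, hcan', swap_apply_left]
      right_inv := by
        rintro ⟨⟨⟨σ, η, a⟩, h1⟩, i, hi⟩
        obtain ⟨h2, h3⟩ := eq_swap_iff.2 ⟨hswap h1.isSwap, hi, rfl⟩
        have h4 : τ * swap i ((τ * η * τ) i) * τ = η := by rw [← h3, hcan']
        refine Sigma.ext (Subtype.ext ?_) ?_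
        · simp only [hcan]
          rw [h4]
        · simp only
          congr! }
  have hw : ∀ c : C, Nat.card (τ * c.1.2.1 * τ).support = 2 := fun c => by
    rw [Nat.card_eq_fintype_card, Fintype.card_coe, card_support_eq_two]
    exact hswap c.2.isSwap
  rw [Nat.card_congr e, Nat.card_sigma]
  simp only [hw, Finset.sum_const, Finset.card_univ, smul_eq_mul, C, Nat.card_eq_fintype_card]
  rw [mul_comm]

omit [DecidableEq α] in
theorem IsConnected.conj {τ ρ h : Perm α} (H : IsConnected τ ρ h) (g : Perm α) :
    IsConnected (g * τ * g⁻¹) (g * ρ * g⁻¹) (g * h * g⁻¹) := by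
  intro S hS h0 h1 hh
  have hmap : ∀ {p : Perm α}, Set.MapsTo (g * p * g⁻¹ : Perm α) S S →
      Set.MapsTo p (g ⁻¹' S) (g ⁻¹' S) := fun hp y hy => by simpa using hp hy
  obtain ⟨x, hx⟩ := hS
  have := H (g ⁻¹' S) ⟨g⁻¹ x, by simpa using hx⟩ (hmap h0) (hmap h1) (hmap hh)
  refine Set.eq_univ_of_forall fun x => ?_
  have hx : g⁻¹ x ∈ g ⁻¹' S := this ▸ Set.mem_univ _
  simpa using hx

theorem IsSwitchDatum.conj' {τ ρ h : Perm α} {i j : α} (H : IsSwitchDatum τ ρ h i j)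
    (g : Perm α) :
    IsSwitchDatum (g * τ * g⁻¹) (g * ρ * g⁻¹) (g * h * g⁻¹) (g i) (g j) := by
  refine ⟨H.left.conj g, H.right.conj g, ?_, fun h => H.ne (g.injective h), ?_, H.connected.conj g⟩
  · calc g * τ * g⁻¹ * (g * h * g⁻¹) = g * (τ * h) * g⁻¹ := by group
      _ = _ := by rw [H.comm]; group
  · have hs : swap (g i) (g j) = g * swap i j * g⁻¹ := by
      rw [mul_swap_eq_swap_mul, mul_inv_cancel_right]
    calc g * h * g⁻¹ * (g * ρ * g⁻¹) * (g * h * g⁻¹)⁻¹ = g * (h * ρ * h⁻¹) * g⁻¹ := by group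
      _ = _ := by rw [H.conj, hs]; group

theorem card_switchDatum_conj [Fintype α] (τ g : Perm α) :
    Nat.card {p : (Perm α × Perm α) × α × α //
      IsSwitchDatum (g * τ * g⁻¹) p.1.1 p.1.2 p.2.1 p.2.2 ∧ p.2.2 ≠ (g * τ * g⁻¹) p.2.1} =
    Nat.card {p : (Perm α × Perm α) × α × α //
      IsSwitchDatum τ p.1.1 p.1.2 p.2.1 p.2.2 ∧ p.2.2 ≠ τ p.2.1} := by
  let c : Perm α ≃ Perm α := (MulAut.conj g).toEquiv
  let e : (Perm α × Perm α) × α × α ≃ (Perm α × Perm α) × α × α :=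
    (c.prodCongr c).prodCongr (g.prodCongr g)
  refine (Nat.card_congr (e.subtypeEquiv fun p => ?_)).symm
  have he : e p = ((g * p.1.1 * g⁻¹, g * p.1.2 * g⁻¹), g p.2.1, g p.2.2) := rfl
  rw [he]
  refine and_congr ⟨fun H => H.conj' g, fun H => ?_⟩ (not_congr ?_)
  · have := H.conj' g⁻¹
    simpa [mul_assoc] using this
  · simp

theorem IsFPFInvolution.cycleType_eq [Fintype α] [Nonempty α] {n : ℕ} (hα : Fintype.card α = 2 * n)
    {τ : Perm α} (hτ : IsFPFInvolution τ) : τ.cycleType = Multiset.replicate n 2 := by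
  have hne : τ ≠ 1 := fun h => hτ.2 (Classical.arbitrary α) (by rw [h, one_apply])
  have ho : orderOf τ = 2 := orderOf_eq_prime (by rw [sq, hτ.1]) hne
  obtain ⟨m, hm⟩ := cycleType_prime_order (ho.symm ▸ Nat.prime_two)
  have hs := sum_cycleType τ
  have hsupp : τ.support = Finset.univ := Finset.eq_univ_iff_forall.2 fun x => mem_support.2 (hτ.2 x)
  rw [hm, hsupp, Finset.card_univ, hα, ho, Multiset.sum_replicate, smul_eq_mul] at hs
  rw [hm, ho]
  congr 1
  omega

theorem isFPFInvolution_iff_isConj [Fintype α] [Nonempty α] {n : ℕ} (hα : Fintype.card α = 2 * n)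
    {τ : Perm α} (hτ : IsFPFInvolution τ) (τ' : Perm α) : IsConj τ τ' ↔ IsFPFInvolution τ' := by
  constructor
  · intro h
    obtain ⟨g, rfl⟩ := isConj_iff.1 h
    exact hτ.conj g
  · intro h
    rw [isConj_iff_cycleType_eq, hτ.cycleType_eq hα, h.cycleType_eq hα]

theorem card_isFPFInvolution [Fintype α] [Nonempty α] {n : ℕ} (hn : 0 < n)
    (hα : Fintype.card α = 2 * n) {τ : Perm α} (hτ : IsFPFInvolution τ) :
    Nat.card {τ' : Perm α // IsFPFInvolution τ'} * (2 ^ n * n.factorial) = (2 * n).factorial := by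
  have h1 := card_isConj_mul_eq τ
  rw [hτ.cycleType_eq hα, hα] at h1
  have h2 : (Multiset.replicate n 2).toFinset = {2} := by
    rw [Multiset.toFinset_replicate, if_neg hn.ne']
  rw [h2] at h1
  simp only [Multiset.sum_replicate, smul_eq_mul, Multiset.prod_replicate, Finset.prod_singleton,
    Multiset.count_replicate_self] at h1
  rw [mul_comm n 2, Nat.sub_self, Nat.factorial_zero, one_mul] at h1
  rw [← h1]
  congr 1
  exact Nat.card_congr (Equiv.subtypeEquivRight fun τ' =>
    (isFPFInvolution_iff_isConj hα hτ τ').symm)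

/-- All fixed point free involutions are conjugate, so each contributes as many switch data as the
standard one. This relates the count with `τ` fixed to the one with `τ` varying. -/
theorem card_switchDatum_eq_mul [Fintype α] [Nonempty α] {n : ℕ} (hα : Fintype.card α = 2 * n)
    {τ : Perm α} (hτ : IsFPFInvolution τ) :
    Nat.card {p : (Perm α × Perm α × Perm α) × α × α //
      IsSwitchDatum p.1.1 p.1.2.1 p.1.2.2 p.2.1 p.2.2 ∧ p.2.2 ≠ p.1.1 p.2.1} =
    Nat.card {τ' : Perm α // IsFPFInvolution τ'} *
      (2 * Nat.card {p : Perm α × Perm α × Perm α // IsSimpleCovering τ p.1 p.2.1 p.2.2}) := by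
  classical
  let e : {p : (Perm α × Perm α × Perm α) × α × α //
      IsSwitchDatum p.1.1 p.1.2.1 p.1.2.2 p.2.1 p.2.2 ∧ p.2.2 ≠ p.1.1 p.2.1} ≃
      Σ τ : {τ' : Perm α // IsFPFInvolution τ'}, {p : (Perm α × Perm α) × α × α //
      IsSwitchDatum τ.1 p.1.1 p.1.2 p.2.1 p.2.2 ∧ p.2.2 ≠ τ.1 p.2.1} :=
    { toFun := fun p => ⟨⟨p.1.1.1, p.2.1.left⟩, (p.1.1.2, p.1.2), p.2⟩
      invFun := fun p => ⟨((p.1.1, p.2.1.1), p.2.1.2), p.2.2⟩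
      left_inv := fun _ => rfl
      right_inv := fun _ => rfl }
  rw [Nat.card_congr e, Nat.card_sigma, ← card_simpleCovering hτ]
  have : ∀ τ' : {τ' : Perm α // IsFPFInvolution τ'}, Nat.card {p : (Perm α × Perm α) × α × α //
      IsSwitchDatum τ'.1 p.1.1 p.1.2 p.2.1 p.2.2 ∧ p.2.2 ≠ τ'.1 p.2.1} =
      Nat.card {p : (Perm α × Perm α) × α × α //
      IsSwitchDatum τ p.1.1 p.1.2 p.2.1 p.2.2 ∧ p.2.2 ≠ τ p.2.1} := by
    rintro ⟨τ', hτ'⟩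
    obtain ⟨g, rfl⟩ := isConj_iff.1 ((isFPFInvolution_iff_isConj hα hτ τ').2 hτ')
    exact card_switchDatum_conj τ g
  simp only [this, Finset.sum_const, Finset.card_univ, smul_eq_mul, Nat.card_eq_fintype_card]

theorem isFPFInvolution_bar (d : ℕ) : IsFPFInvolution (bar d) := by
  refine ⟨?_, ?_⟩
  · ext x <;> simp [bar]
  · rintro ⟨x, b⟩ h
    simp [bar] at h

theorem isRealCovering_one_iff (d : ℕ) (σ a : Perm (Fin d × Bool))
    (η : Fin 1 → Perm (Fin d × Bool)) :
    IsRealCovering d 1 σ η a ↔ IsSimpleCovering (bar d) σ (η 0) a := by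
  have hconn : MulAction.IsPretransitive
    (Subgroup.closure ({σ, a, bar d} ∪ Set.range η : Set (Equiv.Perm (Fin d × Bool))))
    (Fin d × Bool) ↔ ∀ S : Set (Fin d × Bool), S.Nonempty → Set.MapsTo (bar d) S S →
      Set.MapsTo σ S S → Set.MapsTo a S S → Set.MapsTo (η 0) S S → S = Set.univ := by
    rw [isPretransitive_closure_iff]
    refine forall₂_congr fun S _ => ⟨fun H h1 h2 h3 h4 => H ?_, fun H H' => H (H' _ (by simp))
      (H' _ (by simp)) (H' _ (by simp)) (H' _ (by simp))⟩
    rintro g ((rfl | rfl | rfl) | ⟨i, rfl⟩)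
    · exact h2
    · exact h3
    · exact h1
    · rw [Subsingleton.elim i 0]
      exact h4
  constructor
  · rintro ⟨h1, h2, h3, h4, h5⟩
    refine ⟨h1, (h2 0).1, (h2 0).2, h3, ?_, hconn.1 h5⟩
    simpa using h4
  · rintro ⟨h1, h2, h3, h4, h5, h6⟩
    refine ⟨h1, fun i => ?_, h4, ?_, hconn.2 h6⟩
    · rw [Subsingleton.elim i 0]
      exact ⟨h2, h3⟩
    · simpa using h5

theorem cast_sum_divisors (n : ℕ) :
    ((∑ ℓ ∈ n.divisors, (ℓ - 1) * (2 * ℓ) : ℕ) : ℚ) = 2 * ∑ ℓ ∈ n.divisors, ((ℓ : ℚ) ^ 2 - ℓ) := by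
  rw [Nat.cast_sum, Finset.mul_sum]
  refine Finset.sum_congr rfl fun ℓ hℓ => ?_
  rw [Nat.cast_mul, Nat.cast_sub (Nat.pos_of_mem_divisors hℓ)]
  push_cast
  ring

theorem coveringCount_two {n : ℕ} (hn : 0 < n) :
    coveringCount 2 n = (∑ ℓ ∈ n.divisors, ((ℓ : ℚ) ^ 2 - ℓ)) / 2 := by
  have hα : Fintype.card (Fin n × Bool) = 2 * n := by simp [mul_comm]
  have : Nonempty (Fin n × Bool) := ⟨(⟨0, hn⟩, true)⟩
  have hτ := isFPFInvolution_bar n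
  have h1 := card_switchDatum_eq_mul hα hτ
  have h2 := card_isFPFInvolution hn hα hτ
  classical
  -- The choice `j = τ i` is the one for which `η` equals its conjugate.
  have h3 := card_switchDatum_eq_sum (α := Fin n × Bool) (q := fun τ _ i => τ i)
    (fun _ _ _ _ _ => SameCycle.refl _ _)
  rw [sum_torusTriple hn (by rw [Nat.card_eq_fintype_card, hα]), h1, ← h2] at h3
  have h4 : Nat.card {p : Perm (Fin n × Bool) × (Fin (2 - 1) → Perm (Fin n × Bool)) ×
      Perm (Fin n × Bool) // IsRealCovering n (2 - 1) p.1 p.2.1 p.2.2} =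
      Nat.card {p : Perm (Fin n × Bool) × Perm (Fin n × Bool) × Perm (Fin n × Bool) //
        IsSimpleCovering (bar n) p.1 p.2.1 p.2.2} := by
    refine Nat.card_congr (Equiv.subtypeEquiv ((Equiv.refl _).prodCongr
      ((Equiv.funUnique (Fin 1) _).prodCongr (Equiv.refl _))) fun p => ?_)
    exact isRealCovering_one_iff n p.1 p.2.2 p.2.1
  rw [coveringCount, h4]
  have h5 : (Nat.card {τ' : Perm (Fin n × Bool) // IsFPFInvolution τ'} : ℚ) ≠ 0 := by
    have : Nat.card {τ' : Perm (Fin n × Bool) // IsFPFInvolution τ'} ≠ 0 := by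
      intro h
      rw [h, zero_mul] at h2
      exact (Nat.factorial_pos _).ne h2
    exact_mod_cast this
  have h6 := congrArg (Nat.cast (R := ℚ)) h3
  rw [Nat.cast_mul, Nat.cast_mul (∑ ℓ ∈ n.divisors, _), cast_sum_divisors] at h6
  push_cast at h6
  rw [div_eq_div_iff (by positivity) (by norm_num)]
  apply mul_left_cancel₀ h5
  rw [show (2 : ℚ) ^ (2 - 1) = 2 by norm_num]
  linear_combination h6

theorem origamiCount_eq {n : ℕ} (hn : 0 < n) :
    origamiCount n = (∑ ℓ ∈ n.divisors, ((ℓ : ℚ) ^ 2 - ℓ)) / 2 := by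
  have hα : Nat.card (Fin (2 * n)) = 2 * n := by simp
  have h1 := card_origami (α := Fin (2 * n))
  classical
  -- The choice `j = ρ i` gives the trivial switch, hence a trivial commutator; it is `v⁻¹(τ i)`,
  -- whence the exponent `-1`.
  have h3 := card_switchDatum_eq_sum (α := Fin (2 * n)) (q := fun _ ρ i => ρ i)
    (fun τ ρ hτ hρ i => ⟨-1, by simp [hτ.inv_eq, hρ.inv_eq, hτ.apply_apply]⟩)
  rw [sum_torusTriple hn hα, h1] at h3
  have h6 := congrArg (Nat.cast (R := ℚ)) h3
  rw [Nat.cast_mul, Nat.cast_mul (∑ ℓ ∈ n.divisors, _), cast_sum_divisors] at h6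
  push_cast at h6
  rw [origamiCount, div_eq_div_iff (by positivity) (by norm_num)]
  linear_combination h6 / 2

theorem F_two_eq : F 2 = (1 / 2 : ℚ) • (E 3 - E 2) := by
  ext n
  rcases Nat.eq_zero_or_pos n with rfl | hn
  · simp [F, E, genFun]
  · simp only [F, E, genFun, PowerSeries.coeff_mk, map_smul, map_sub, if_neg hn.ne',
      coveringCount_two hn, ← Finset.sum_sub_distrib, smul_eq_mul]
    norm_num
    ring

theorem F_two_eq_origami : F 2 = genFun origamiCount := by
  ext n
  rcases Nat.eq_zero_or_pos n with rfl | hn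
  · simp [F, genFun]
  · simp only [F, genFun, PowerSeries.coeff_mk, if_neg hn.ne', coveringCount_two hn,
      origamiCount_eq hn]

end RealOrigami
end

/-! ### Non-tangential asymptotic expansions -/

noncomputable section

namespace RealOrigami

open Asymptotics Filter Topology

/-- Neighbourhoods of the real point `x` in a sector of the upper half-plane with vertex `x`. -/
def sector (x C : ℝ) : Filter ℂ :=
  nhdsWithin (x : ℂ) {z : ℂ | 0 < z.im ∧ |z.re - x| ≤ C * z.im}

theorem sector_le_nhds (x C : ℝ) : sector x C ≤ 𝓝 (x : ℂ) := nhdsWithin_le_nhds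

theorem eventually_sector (x C : ℝ) :
    ∀ᶠ z in sector x C, 0 < z.im ∧ |z.re - x| ≤ C * z.im :=
  self_mem_nhdsWithin

theorem eventually_sector_ne (x C : ℝ) : ∀ᶠ z in sector x C, z - (x : ℂ) ≠ 0 := by
  filter_upwards [eventually_sector x C] with z hz h
  rw [sub_eq_zero] at h
  simp [h] at hz

instance (x : ℝ) : (sector x 1).NeBot := by
  have h : Tendsto (fun t : ℝ => (x : ℂ) + t * Complex.I) (𝓝[>] 0) (sector x 1) := by
    refine tendsto_nhdsWithin_iff.2 ⟨?_, ?_⟩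
    · have : Tendsto (fun t : ℝ => (x : ℂ) + t * Complex.I) (𝓝 0) (𝓝 ((x : ℂ) + (0 : ℝ) * Complex.I)) :=
        Continuous.tendsto (by fun_prop) 0
      simpa using this.mono_left nhdsWithin_le_nhds
    · filter_upwards [self_mem_nhdsWithin] with t ht
      have ht' : 0 < t := ht
      simp [ht', ht'.le]
  exact h.neBot

/-- The function `(z - x) ^ m * f z` is approximated to any order by analytic functions as `z` tends
to `x` non-tangentially. -/
def HasExpansion (f : ℂ → ℂ) (x : ℝ) (m : ℕ) : Prop :=
  ∀ N : ℕ, ∃ A : ℂ → ℂ, AnalyticAt ℂ A x ∧ ∀ C : ℝ,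
    (fun z => (z - x) ^ m * f z - A z) =O[sector x C] fun z => (z - x) ^ N

theorem exists_taylor {A : ℂ → ℂ} {x : ℂ} (hA : AnalyticAt ℂ A x) :
    ∃ a : ℕ → ℂ, a 0 = A x ∧ a 1 = deriv A x ∧ ∀ N : ℕ,
      (fun z => A z - ∑ j ∈ Finset.range N, a j * (z - x) ^ j) =O[𝓝 x] fun z => (z - x) ^ N := by
  obtain ⟨p, hp⟩ := hA
  refine ⟨p.coeff, hp.coeff_zero _, hp.deriv.symm, fun N => ?_⟩
  have h1 := hp.isBigO_sub_partialSum_pow N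
  have h2 : Tendsto (fun z => z - x) (𝓝 x) (𝓝 0) := by
    simpa using (continuous_id.sub continuous_const).tendsto (f := fun z : ℂ => z - x) x
  have h3 := h1.comp_tendsto h2
  refine (h3.congr (fun z => ?_) (fun z => rfl)).trans (IsBigO.of_bound 1 ?_)
  · simp [FormalMultilinearSeries.partialSum, mul_comm]
  · exact Eventually.of_forall fun z => by simp

theorem coeff_eq_zero_of_isBigO {l : Filter ℂ} [l.NeBot] {x : ℂ} (hl : l ≤ 𝓝 x)
    (hne : ∀ᶠ z in l, z - x ≠ 0) {N : ℕ} {b : ℕ → ℂ}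
    (h : (fun z => ∑ j ∈ Finset.range N, b j * (z - x) ^ j) =O[l] fun z => (z - x) ^ N) :
    ∀ j < N, b j = 0 := by
  have ht : Tendsto (fun z : ℂ => z - x) l (𝓝 0) := by
    have : Tendsto (fun z : ℂ => z - x) (𝓝 x) (𝓝 0) := by
      simpa using (continuous_id.sub continuous_const).tendsto (f := fun z : ℂ => z - x) x
    exact this.mono_left hl
  induction N generalizing b with
  | zero => simp
  | succ N ih =>
    have hpow : Tendsto (fun z : ℂ => (z - x) ^ (N + 1)) l (𝓝 0) := by
      simpa using ht.pow (N + 1)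
    have h0 : b 0 = 0 := by
      have h1 := h.trans_tendsto hpow
      have h2 : Tendsto (fun z => ∑ j ∈ Finset.range (N + 1), b j * (z - x) ^ j) l
          (𝓝 (∑ j ∈ Finset.range (N + 1), b j * (0 : ℂ) ^ j)) :=
        tendsto_finsetSum _ fun j _ => (ht.pow j).const_mul (b j)
      have h3 := tendsto_nhds_unique h2 h1
      rw [Finset.sum_range_succ'] at h3
      simpa using h3
    have h1 : (fun z => ∑ j ∈ Finset.range N, b (j + 1) * (z - x) ^ j) =O[l]
        fun z => (z - x) ^ N := by
      obtain ⟨K, hK⟩ := h.bound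
      refine IsBigO.of_bound K ?_
      filter_upwards [hK, hne] with z hz hz0
      rw [Finset.sum_range_succ', h0, zero_mul, add_zero] at hz
      have e : ∑ j ∈ Finset.range N, b (j + 1) * (z - x) ^ (j + 1) =
          (∑ j ∈ Finset.range N, b (j + 1) * (z - x) ^ j) * (z - x) := by
        rw [Finset.sum_mul]
        exact Finset.sum_congr rfl fun j _ => by ring
      rw [e, pow_succ, norm_mul, norm_mul, ← mul_assoc] at hz
      exact le_of_mul_le_mul_right hz (norm_pos_iff.2 hz0)
    rintro (_ | j) hj
    · exact h0
    · exact ih h1 j (by omega)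

theorem isBigO_pow_of_le {x C : ℝ} {M N : ℕ} (h : N ≤ M) :
    (fun z : ℂ => (z - x) ^ M) =O[sector x C] fun z => (z - x) ^ N := by
  have ht : Tendsto (fun z : ℂ => z - x) (sector x C) (𝓝 0) := by
    have : Tendsto (fun z : ℂ => z - x) (𝓝 x) (𝓝 0) := by
      simpa using (continuous_id.sub continuous_const).tendsto (f := fun z : ℂ => z - x) (x : ℂ)
    exact this.mono_left (sector_le_nhds x C)
  refine IsBigO.of_bound 1 ?_
  filter_upwards [ht.norm.eventually_le_const (show ‖(0 : ℂ)‖ < 1 by simp)] with z hz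
  rw [norm_pow, norm_pow, one_mul]
  exact pow_le_pow_of_le_one (norm_nonneg _) hz h

/-- The approximating analytic function may depend on the order, but by uniqueness of expansions the
Taylor coefficients agree where they overlap. Uniqueness is tested in a single sector, which makes
the coefficients independent of `C`. -/
theorem HasExpansion.exists_coeff {f : ℂ → ℂ} {x : ℝ} {m : ℕ} (hf : HasExpansion f x m) :
    ∃ a : ℕ → ℂ, ∀ (C : ℝ) (N : ℕ),
      (fun z => (z - x) ^ m * f z - ∑ j ∈ Finset.range N, a j * (z - x) ^ j) =O[sector x C]
        fun z => (z - x) ^ N := by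
  choose A hA hAC using hf
  choose a _ _ ha using fun N => exists_taylor (hA N)
  have h1 : ∀ (C : ℝ) (N M : ℕ), M ≤ N →
      (fun z => (z - x) ^ m * f z - ∑ j ∈ Finset.range M, a N j * (z - x) ^ j) =O[sector x C]
        fun z => (z - x) ^ M := by
    intro C N M hM
    have e1 := ((hAC N C).trans (isBigO_pow_of_le hM)).add ((ha N M).mono (sector_le_nhds x C))
    exact e1.congr_left fun z => by ring
  have h2 : ∀ N j, j < N → a N j = a (j + 1) j := by
    intro N j hj
    have e1 := (h1 1 (j + 1) (j + 1) le_rfl).sub (h1 1 N (j + 1) hj)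
    have e2 : (fun z : ℂ => ∑ i ∈ Finset.range (j + 1), (a N i - a (j + 1) i) * (z - x) ^ i)
        =O[sector x 1] fun z => (z - x) ^ (j + 1) :=
      e1.congr_left fun z => by
        simp only [sub_mul, Finset.sum_sub_distrib]
        ring
    exact sub_eq_zero.1
      (coeff_eq_zero_of_isBigO (sector_le_nhds x 1) (eventually_sector_ne x 1) e2 j (by omega))
  refine ⟨fun j => a (j + 1) j, fun C N => ?_⟩
  refine (h1 C N N le_rfl).congr_left fun z => ?_
  rw [Finset.sum_congr rfl fun j hj => by rw [h2 N j (Finset.mem_range.1 hj)]]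

theorem norm_sub_le_of_mem_sector {x C : ℝ} {z : ℂ} (h0 : 0 < z.im)
    (h : |z.re - x| ≤ C * z.im) : ‖z - x‖ ≤ (C + 1) * z.im := by
  refine (Complex.norm_le_abs_re_add_abs_im _).trans ?_
  simp only [Complex.sub_re, Complex.ofReal_re, Complex.sub_im, Complex.ofReal_im, sub_zero,
    abs_of_pos h0]
  linarith

theorem moebius_im {a b c d : ℤ} (hdet : a * d - b * c = 1) (z : ℂ) :
    (((a : ℂ) * z + b) / ((c : ℂ) * z + d)).im = z.im / Complex.normSq ((c : ℂ) * z + d) := by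
  have hdet' : (a : ℝ) * d - b * c = 1 := by exact_mod_cast hdet
  rw [Complex.div_im, ← sub_div]
  congr 1
  simp
  linear_combination z.im * hdet'

/-- Sectors map into sectors since `az + b = a(z - x)`, the imaginary part is divided by `|cz +
d|²`, and `|cz + d|` is bounded by `W` near `x`. -/
theorem tendsto_moebius_sector {a b c d : ℤ} {x : ℝ}
    (hdet : a * d - b * c = 1) (hx : (a : ℝ) * x + b = 0) (hw : (c : ℝ) * x + d ≠ 0) (C : ℝ) :
    ∃ C' : ℝ, Tendsto (fun z : ℂ => ((a : ℂ) * z + b) / ((c : ℂ) * z + d)) (sector x C)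
      (sector 0 C') := by
  have hw' : (c : ℂ) * x + d ≠ 0 := by exact_mod_cast hw
  have hx' : (a : ℂ) * x + b = 0 := by exact_mod_cast hx
  have hcw : ContinuousAt (fun z : ℂ => (c : ℂ) * z + d) (x : ℂ) := by fun_prop
  have hcs : ContinuousAt (fun z : ℂ => ((a : ℂ) * z + b) / ((c : ℂ) * z + d)) (x : ℂ) := by
    refine ContinuousAt.div (by fun_prop) hcw hw'
  set W := ‖(c : ℂ) * x + d‖ + 1
  refine ⟨‖(a : ℂ)‖ * |C + 1| * W, tendsto_nhdsWithin_iff.2 ⟨?_, ?_⟩⟩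
  · have := hcs.tendsto.mono_left (sector_le_nhds x C)
    simpa [hx'] using this
  · have h1 : ∀ᶠ z in sector x C, (c : ℂ) * z + d ≠ 0 :=
      (hcw.eventually_ne hw').filter_mono (sector_le_nhds x C)
    have h2 : ∀ᶠ z in sector x C, ‖(c : ℂ) * z + d‖ ≤ W := by
      have := hcw.norm.tendsto.eventually_le_const (show ‖(c : ℂ) * x + d‖ < W by simp [W])
      exact this.filter_mono (sector_le_nhds x C)
    filter_upwards [h1, h2, eventually_sector x C] with z hz1 hz2 ⟨hz3, hz4⟩
    have hpos : 0 < ‖(c : ℂ) * z + d‖ := norm_pos_iff.2 hz1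
    rw [moebius_im hdet, Complex.normSq_eq_norm_sq]
    refine ⟨by positivity, ?_⟩
    rw [sub_zero]
    refine (Complex.abs_re_le_norm _).trans ?_
    have hnum : (a : ℂ) * z + b = a * (z - x) := by linear_combination hx'
    rw [hnum, norm_div, norm_mul]
    have h3 := norm_sub_le_of_mem_sector hz3 hz4
    have h4 : ‖z - (x : ℂ)‖ ≤ |C + 1| * z.im :=
      h3.trans (mul_le_mul_of_nonneg_right (le_abs_self _) hz3.le)
    calc ‖(a : ℂ)‖ * ‖z - x‖ / ‖(c : ℂ) * z + d‖
        ≤ ‖(a : ℂ)‖ * (|C + 1| * z.im) / ‖(c : ℂ) * z + d‖ := by gcongr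
      _ = ‖(a : ℂ)‖ * |C + 1| * ‖(c : ℂ) * z + d‖ * (z.im / ‖(c : ℂ) * z + d‖ ^ 2) := by
        field_simp
      _ ≤ _ := by gcongr

/-- Expansions are transported by Möbius transformations. -/
theorem HasExpansion.of_moebius {f h : ℂ → ℂ} {k : ℤ} {a b c d : ℤ} {x : ℝ} {m : ℕ}
    (hdet : a * d - b * c = 1) (hx : (a : ℝ) * x + b = 0) (hw : (c : ℝ) * x + d ≠ 0)
    (hh : AnalyticAt ℂ h x)
    (hfh : ∀ᶠ z : ℂ in 𝓝 (x : ℂ), 0 < z.im → h z = f z - ((c : ℂ) * z + d) ^ (-k) *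
      f (((a : ℂ) * z + b) / ((c : ℂ) * z + d)))
    (hf : HasExpansion f 0 m) : HasExpansion f x m := by
  intro N
  obtain ⟨A, hA, hAC⟩ := hf N
  have hw' : (c : ℂ) * x + d ≠ 0 := by exact_mod_cast hw
  have hx' : (a : ℂ) * x + b = 0 := by exact_mod_cast hx
  have ha : (a : ℂ) ≠ 0 := by
    rintro h0
    have h0' : a = 0 := by exact_mod_cast h0
    subst h0'
    have hb : b = 0 := by simpa using hx'
    simp [hb] at hdet
  have hwa : AnalyticAt ℂ (fun z : ℂ => (c : ℂ) * z + d) x := by fun_prop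
  have hsa : AnalyticAt ℂ (fun z : ℂ => ((a : ℂ) * z + b) / ((c : ℂ) * z + d)) x :=
    AnalyticAt.div (by fun_prop) hwa hw'
  have hua : AnalyticAt ℂ (fun z : ℂ => ((c : ℂ) * z + d) ^ ((m : ℤ) - k) / (a : ℂ) ^ m) x :=
    (hwa.zpow hw').div_const
  -- With `s = (az + b)/(cz + d)` one has `(z - x)^m = s^m (cz + d)^m / a^m`. So the modular term of
  -- `(z - x)^m f(z)` is `(cz + d)^(m-k) a^(-m)` times `s^m f(s)`, which `A s` approximates.
  refine ⟨fun z => (z - x) ^ m * h z + ((c : ℂ) * z + d) ^ ((m : ℤ) - k) / (a : ℂ) ^ m *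
    A (((a : ℂ) * z + b) / ((c : ℂ) * z + d)), ?_, fun C => ?_⟩
  · refine AnalyticAt.add (AnalyticAt.mul (by fun_prop) hh) (hua.mul ?_)
    refine AnalyticAt.fun_comp ?_ hsa
    simpa [hx'] using hA
  · obtain ⟨C', hC'⟩ := tendsto_moebius_sector hdet hx hw C
    have h1 := (hAC C').comp_tendsto hC'
    have h2 : (fun z : ℂ => ((c : ℂ) * z + d) ^ ((m : ℤ) - k) / (a : ℂ) ^ m) =O[sector x C]
        fun _ => (1 : ℂ) := (hua.continuousAt.tendsto.isBigO_one ℂ).mono (sector_le_nhds x C)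
    have h3 : (fun z : ℂ => (a : ℂ) / ((c : ℂ) * z + d)) =O[sector x C]
        fun _ => (1 : ℂ) := by
      have : AnalyticAt ℂ (fun z : ℂ => (a : ℂ) / ((c : ℂ) * z + d)) x :=
        AnalyticAt.div (by fun_prop) hwa hw'
      exact (this.continuousAt.tendsto.isBigO_one ℂ).mono (sector_le_nhds x C)
    have h5 : ((fun z : ℂ => (z - (0 : ℝ)) ^ N) ∘ fun z : ℂ => ((a : ℂ) * z + b) / ((c : ℂ) * z + d))
        =O[sector x C] fun z => (z - (x : ℂ)) ^ N := by
      have := (h3.pow N).mul (isBigO_refl (fun z : ℂ => (z - (x : ℂ)) ^ N) (sector x C))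
      refine (this.congr (fun z => ?_) (fun z => by simp))
      have hnum : (a : ℂ) * z + b = a * (z - x) := by linear_combination hx'
      simp only [Function.comp_apply, Complex.ofReal_zero, sub_zero]
      rw [hnum, ← mul_pow]
      ring
    have h4 := h2.mul (h1.trans h5)
    refine (h4.congr' ?_ (by simp))
    have hne : ∀ᶠ z in sector x C, (c : ℂ) * z + d ≠ 0 :=
      (hwa.continuousAt.eventually_ne hw').filter_mono (sector_le_nhds x C)
    filter_upwards [hne, hfh.filter_mono (sector_le_nhds x C), eventually_sector x C] with
      z hz1 hz2 hz3
    have hnum : (a : ℂ) * z + b = a * (z - x) := by linear_combination hx'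
    simp only [Function.comp_apply, Complex.ofReal_zero, sub_zero]
    rw [hz2 hz3.1, zpow_sub₀ hz1, zpow_natCast, zpow_neg]
    set s := ((a : ℂ) * z + b) / ((c : ℂ) * z + d) with hs
    have hsz : s ^ m * ((c : ℂ) * z + d) ^ m = a ^ m * (z - x) ^ m := by
      rw [← mul_pow, ← mul_pow, hs, div_mul_cancel₀ _ hz1, hnum]
    field_simp
    linear_combination (f s) * hsz

end RealOrigami
end

/-! ### Reduction to the expansion at zero, and weight two -/

noncomputable section

namespace RealOrigami

open Asymptotics Filter Topology

/-- Some matrix of `SL(2, ℤ)` moves a given rational `x` to `0`. Its cocycle is analytic at `x`, so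
the expansion at `0` is transported to `x`. -/
theorem IsQuantumModular.of_expansion_zero {k : ℤ} {φ : PowerSeries ℂ} {m : ℕ}
    (hsum : ∀ z : ℂ, 0 < z.im → Summable fun n : ℕ =>
      PowerSeries.coeff n φ * Complex.exp (2 * Real.pi * Complex.I * n * z))
    (hexp : HasExpansion (qFun φ) 0 m)
    (hcoc : ∀ γ : Matrix.SpecialLinearGroup (Fin 2) ℤ, ∃ h : ℂ → ℂ,
      DifferentiableOn ℂ h {z : ℂ | (γ.1 1 0 : ℂ) * z + (γ.1 1 1 : ℂ) ∈ Complex.slitPlane} ∧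
      ∀ z : ℂ, 0 < z.im → (γ.1 1 0 : ℂ) * z + (γ.1 1 1 : ℂ) ∈ Complex.slitPlane →
        h z = qFun φ z - ((γ.1 1 0 : ℂ) * z + (γ.1 1 1 : ℂ)) ^ (-k) *
          qFun φ (((γ.1 0 0 : ℂ) * z + (γ.1 0 1 : ℂ)) / ((γ.1 1 0 : ℂ) * z + (γ.1 1 1 : ℂ)))) :
    IsQuantumModular k φ where
  summable := hsum
  cocycle := hcoc
  expansion x := by
    obtain ⟨u, v, huv⟩ : IsCoprime x.num (x.den : ℤ) := by
      rw [Int.isCoprime_iff_gcd_eq_one, Int.gcd, Int.natAbs_natCast]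
      exact x.reduced
    have hdet : (x.den : ℤ) * v - (-x.num) * u = 1 := by linear_combination huv
    have hden : (x.den : ℝ) ≠ 0 := by exact_mod_cast x.den_nz
    have hxr : (x : ℝ) * x.den = x.num := by exact_mod_cast Rat.mul_den_eq_num x
    have hx0 : (((x.den : ℤ) : ℤ) : ℝ) * (x : ℝ) + ((-x.num : ℤ) : ℝ) = 0 := by
      push_cast
      linear_combination hxr
    have hwx : (u : ℝ) * (x : ℝ) + (v : ℝ) = 1 / x.den := by
      have : (u : ℝ) * x.num + v * x.den = 1 := by exact_mod_cast huv
      field_simp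
      linear_combination this + u * hxr
    have hwpos : 0 < (u : ℝ) * (x : ℝ) + (v : ℝ) := by
      rw [hwx]
      have : (0 : ℝ) < x.den := by exact_mod_cast x.den_pos
      positivity
    -- The Bézout coefficients complete the first row to determinant one, and `ux + v = 1/x.den` is
    -- positive, so `x` lies in the domain of the cocycle.
    obtain ⟨h, hdiff, hh⟩ := hcoc ⟨!![(x.den : ℤ), -x.num; u, v], by
      rw [Matrix.det_fin_two_of]; exact hdet⟩
    simp only [Matrix.of_apply, Matrix.cons_val', Matrix.cons_val_zero, Matrix.cons_val_one,
      Matrix.cons_val_fin_one] at hdiff hh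
    have hopen : IsOpen {z : ℂ | (u : ℂ) * z + (v : ℂ) ∈ Complex.slitPlane} :=
      Complex.isOpen_slitPlane.preimage (by fun_prop : Continuous fun z : ℂ => (u : ℂ) * z + v)
    have hmem : ((x : ℝ) : ℂ) ∈ {z : ℂ | (u : ℂ) * z + (v : ℂ) ∈ Complex.slitPlane} := by
      have e : (u : ℂ) * ((x : ℝ) : ℂ) + (v : ℂ) = (((u : ℝ) * (x : ℝ) + (v : ℝ) : ℝ) : ℂ) := by
        push_cast; rfl
      rw [Set.mem_ofPred_eq, e, Complex.ofReal_mem_slitPlane]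
      exact hwpos
    have hana : AnalyticAt ℂ h ((x : ℝ) : ℂ) := hdiff.analyticAt (hopen.mem_nhds hmem)
    have key : HasExpansion (qFun φ) (x : ℝ) m := by
      refine HasExpansion.of_moebius (k := k) hdet hx0 hwpos.ne' hana ?_ hexp
      filter_upwards [hopen.mem_nhds hmem] with z hz hz0
      exact hh z hz0 hz
    obtain ⟨a, ha⟩ := key.exists_coeff
    refine ⟨m, a, fun C N => ?_⟩
    have := ha C N
    rw [sector] at this
    simpa only [Complex.ofReal_ratCast] using this

theorem qFun_smul (c : ℂ) (φ : PowerSeries ℂ) (z : ℂ) : qFun (c • φ) z = c * qFun φ z := by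
  simp only [qFun, map_smul, smul_eq_mul, mul_assoc, tsum_mul_left]

theorem IsQuantumModular.smul {k : ℤ} {φ : PowerSeries ℂ} (c : ℂ) (hφ : IsQuantumModular k φ) :
    IsQuantumModular k (c • φ) where
  summable z hz := by
    simpa only [map_smul, smul_eq_mul, mul_assoc] using (hφ.summable z hz).mul_left c
  expansion x := by
    obtain ⟨m, a, ha⟩ := hφ.expansion x
    refine ⟨m, fun j => c * a j, fun C N => ((ha C N).const_mul_left c).congr_left fun z => ?_⟩
    rw [qFun_smul, mul_sub, Finset.mul_sum]
    simp only [mul_assoc, mul_left_comm]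
  cocycle γ := by
    obtain ⟨h, hd, hh⟩ := hφ.cocycle γ
    refine ⟨fun z => c * h z, hd.const_mul c, fun z hz hw => ?_⟩
    have e := hh z hz hw
    beta_reduce
    rw [qFun_smul, qFun_smul, e, mul_sub, mul_left_comm]

theorem HasExpansion.of_forall_isBigO {f g : ℂ → ℂ} {m : ℕ}
    (hg : AnalyticAt ℂ g 0)
    (h : ∀ (N : ℕ) (C : ℝ), (fun z => z ^ m * f z - g z) =O[sector 0 C] fun z => z ^ N) :
    HasExpansion f 0 m := fun N =>
  ⟨g, by simpa using hg, fun C => by simpa using h N C⟩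

/-! ### The weight two Eisenstein series -/

theorem coeff_map_E (k n : ℕ) :
    PowerSeries.coeff n (PowerSeries.map (algebraMap ℚ ℂ) (E k)) =
      (ArithmeticFunction.sigma (k - 1) n : ℂ) := by
  rw [PowerSeries.coeff_map, E, genFun, PowerSeries.coeff_mk]
  split_ifs with h
  · simp [h]
  · rw [ArithmeticFunction.sigma_apply]
    push_cast
    simp

theorem summable_map_E {k : ℕ} (hk : 1 ≤ k) {z : ℂ} (hz : 0 < z.im) : Summable fun n : ℕ =>
    PowerSeries.coeff n (PowerSeries.map (algebraMap ℚ ℂ) (E k)) *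
      Complex.exp (2 * Real.pi * Complex.I * n * z) := by
  refine (EisensteinSeries.summable_sigma_mul_cexp_pow hk ⟨z, hz⟩).congr fun n => ?_
  rw [coeff_map_E, ← Complex.exp_nat_mul]
  ring_nf

theorem qFun_map_E {k : ℕ} (hk : 1 ≤ k) {z : ℂ} (hz : 0 < z.im) :
    qFun (PowerSeries.map (algebraMap ℚ ℂ) (E k)) z =
      ∑' n : ℕ+, (ArithmeticFunction.sigma (k - 1) n : ℂ) *
        Complex.exp (2 * Real.pi * Complex.I * z) ^ (n : ℕ) := by
  rw [qFun, ← tsum_zero_pnat_eq_tsum_nat (summable_map_E hk hz), coeff_map_E]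
  simp only [ArithmeticFunction.map_zero, Nat.cast_zero, zero_mul, zero_add]
  refine tsum_congr fun n => ?_
  rw [coeff_map_E, ← Complex.exp_nat_mul]
  ring_nf

theorem qFun_map_E_two {z : ℂ} (hz : 0 < z.im) :
    qFun (PowerSeries.map (algebraMap ℚ ℂ) (E 2)) z =
      (1 - EisensteinSeries.E2 ⟨z, hz⟩) / 24 := by
  rw [qFun_map_E one_le_two hz, EisensteinSeries.E2_eq_tsum_cexp, sub_sub_cancel,
    mul_div_cancel_left₀ _ (by norm_num)]
  rfl

/-- This is the quasimodularity of `E2`; the first summand comes from the constant term `1/24`,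
which the series `E 2` lacks. -/
theorem qFun_map_E_two_cocycle (γ : Matrix.SpecialLinearGroup (Fin 2) ℤ) {z : ℂ} (hz : 0 < z.im) :
    qFun (PowerSeries.map (algebraMap ℚ ℂ) (E 2)) z -
      ((γ.1 1 0 : ℂ) * z + (γ.1 1 1 : ℂ)) ^ (-2 : ℤ) *
        qFun (PowerSeries.map (algebraMap ℚ ℂ) (E 2))
          (((γ.1 0 0 : ℂ) * z + (γ.1 0 1 : ℂ)) / ((γ.1 1 0 : ℂ) * z + (γ.1 1 1 : ℂ))) =
      (1 - ((γ.1 1 0 : ℂ) * z + (γ.1 1 1 : ℂ)) ^ (-2 : ℤ)) / 24 -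
        1 / (2 * riemannZeta 2) * (2 * Real.pi * Complex.I * γ.1 1 0 /
          ((γ.1 1 0 : ℂ) * z + (γ.1 1 1 : ℂ))) / 24 := by
  have h1 := congrFun (EisensteinSeries.E2_slash_action γ) ⟨z, hz⟩
  have h2 : ((γ • (⟨z, hz⟩ : UpperHalfPlane) : UpperHalfPlane) : ℂ) =
      ((γ.1 0 0 : ℂ) * z + (γ.1 0 1 : ℂ)) / ((γ.1 1 0 : ℂ) * z + (γ.1 1 1 : ℂ)) := by
    rw [UpperHalfPlane.coe_specialLinearGroup_apply]
    simp
  have h3 : UpperHalfPlane.denom γ (z : ℂ) = (γ.1 1 0 : ℂ) * z + (γ.1 1 1 : ℂ) := by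
    simp [UpperHalfPlane.denom]
  rw [ModularForm.SL_slash_apply] at h1
  have h4 := (γ • (⟨z, hz⟩ : UpperHalfPlane)).2
  have h5 : qFun (PowerSeries.map (algebraMap ℚ ℂ) (E 2)) ((γ • (⟨z, hz⟩ : UpperHalfPlane) :
      UpperHalfPlane) : ℂ) = (1 - EisensteinSeries.E2 (γ • (⟨z, hz⟩ : UpperHalfPlane))) / 24 :=
    qFun_map_E_two h4
  rw [← h2, h5, qFun_map_E_two hz, ← h3]
  simp only [EisensteinSeries.D2, Pi.sub_apply, Pi.smul_apply, smul_eq_mul] at h1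
  linear_combination (1/24) * h1

/-- There is no constant term, so one factor `q` comes out of the series; the rest is bounded by its
value at `|q| = e^{-2π}`. -/
theorem norm_qFun_map_E_le {k : ℕ} (hk : 1 ≤ k) : ∃ B : ℝ, ∀ z : ℂ, 1 ≤ z.im →
    ‖qFun (PowerSeries.map (algebraMap ℚ ℂ) (E k)) z‖ ≤ B * Real.exp (-(2 * Real.pi * z.im)) := by
  set r : ℝ := Real.exp (-(2 * Real.pi)) with hr
  have hr0 : 0 < r := Real.exp_pos _
  have hs : Summable fun n : ℕ+ => (ArithmeticFunction.sigma (k - 1) n : ℝ) * r ^ ((n : ℕ) - 1) := by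
    have h1 := (EisensteinSeries.summable_sigma_mul_cexp_pow hk UpperHalfPlane.I).norm
    have h2 := (h1.comp_injective PNat.coe_injective).mul_right r⁻¹
    refine h2.congr fun n => ?_
    have hn : (n : ℕ) = ((n : ℕ) - 1) + 1 := by have := n.pos; omega
    have e : ‖Complex.exp (2 * Real.pi * Complex.I * (UpperHalfPlane.I : ℂ))‖ = r := by
      rw [Complex.norm_exp]
      simp [hr]
    simp only [Function.comp_apply, norm_mul, norm_pow, e, Complex.norm_natCast]
    rw [mul_assoc]
    congr 1
    conv_lhs => rw [hn, pow_succ, mul_assoc, mul_inv_cancel₀ hr0.ne', mul_one]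
  refine ⟨∑' n : ℕ+, (ArithmeticFunction.sigma (k - 1) n : ℝ) * r ^ ((n : ℕ) - 1), fun z hz => ?_⟩
  have hz0 : 0 < z.im := by linarith
  rw [qFun_map_E hk hz0, ← tsum_mul_right]
  refine tsum_of_norm_bounded (hs.mul_right _).hasSum fun n => ?_
  have hn : (n : ℕ) = ((n : ℕ) - 1) + 1 := by have := n.pos; omega
  have e : ‖Complex.exp (2 * Real.pi * Complex.I * z)‖ = Real.exp (-(2 * Real.pi * z.im)) := by
    rw [Complex.norm_exp]
    simp
  have e2 : Real.exp (-(2 * Real.pi * z.im)) ≤ r := by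
    rw [hr, Real.exp_le_exp]
    nlinarith [Real.pi_pos]
  have h4 : Real.exp (-(2 * Real.pi * z.im)) ^ (n : ℕ) ≤
      r ^ ((n : ℕ) - 1) * Real.exp (-(2 * Real.pi * z.im)) := by
    conv_lhs => rw [hn, pow_succ]
    gcongr
  rw [norm_mul, norm_pow, e, Complex.norm_natCast, mul_assoc (_ : ℝ) (r ^ _)]
  exact mul_le_mul_of_nonneg_left h4 (Nat.cast_nonneg _)

/-- In a sector `Im(-1/z)` is at least a constant times `1/|z|`, so the series at `-1/z` is
exponentially small. -/
theorem isBigO_qFun_inv {k : ℕ} (hk : 1 ≤ k) (N : ℕ) (C : ℝ) :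
    (fun z : ℂ => qFun (PowerSeries.map (algebraMap ℚ ℂ) (E k)) (-1 / z)) =O[sector 0 C]
      fun z => z ^ N := by
  obtain ⟨B, hB⟩ := norm_qFun_map_E_le hk
  have hC : 0 < |C + 1| + 1 := by positivity
  set D := |C + 1| + 1 with hD
  refine IsBigO.of_bound (|B| * (N.factorial * D ^ N)) ?_
  have hev : ∀ᶠ z : ℂ in sector 0 C, ‖z‖ ≤ D⁻¹ := by
    have h0 : Tendsto (fun z : ℂ => ‖z‖) (sector 0 C) (𝓝 0) := by
      have : Tendsto (fun z : ℂ => ‖z‖) (𝓝 0) (𝓝 0) := by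
        simpa using (continuous_norm (E := ℂ)).tendsto 0
      exact this.mono_left (by simpa using sector_le_nhds 0 C)
    exact h0.eventually_le_const (by positivity)
  filter_upwards [hev, eventually_sector 0 C] with z hz1 ⟨hz2, hz3⟩
  have hz0 : 0 < ‖z‖ := norm_pos_iff.2 fun h => by simp [h] at hz2
  have h1 : ‖z‖ ≤ D * z.im := by
    have := norm_sub_le_of_mem_sector hz2 hz3
    rw [Complex.ofReal_zero, sub_zero] at this
    refine this.trans ?_
    gcongr
    rw [hD]
    linarith [le_abs_self (C + 1)]
  have him : (-1 / z).im = z.im / ‖z‖ ^ 2 := by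
    rw [Complex.div_im, Complex.normSq_eq_norm_sq]
    simp [neg_div]
  have h2 : 1 / (D * ‖z‖) ≤ (-1 / z).im := by
    rw [him, div_le_div_iff₀ (by positivity) (by positivity)]
    nlinarith
  have h3 : 1 ≤ (-1 / z).im := by
    refine le_trans ?_ h2
    rw [le_div_iff₀ (by positivity), one_mul]
    calc D * ‖z‖ ≤ D * D⁻¹ := by gcongr
      _ = 1 := mul_inv_cancel₀ hC.ne'
  have h4 := Real.pow_div_factorial_le_exp (1 / (D * ‖z‖)) (by positivity) N
  have h5 : Real.exp (-(2 * Real.pi * (-1 / z).im)) ≤ Real.exp (-(1 / (D * ‖z‖))) := by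
    rw [Real.exp_le_exp, neg_le_neg_iff]
    nlinarith [Real.pi_gt_three]
  have h6 : Real.exp (-(1 / (D * ‖z‖))) ≤ N.factorial * D ^ N * ‖z‖ ^ N := by
    rw [Real.exp_neg]
    refine inv_le_of_inv_le₀ (by positivity) (le_trans (le_of_eq ?_) h4)
    rw [div_pow, mul_pow, one_pow]
    field_simp
  calc ‖qFun (PowerSeries.map (algebraMap ℚ ℂ) (E k)) (-1 / z)‖
      ≤ B * Real.exp (-(2 * Real.pi * (-1 / z).im)) := hB _ h3
    _ ≤ |B| * (N.factorial * D ^ N * ‖z‖ ^ N) := by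
      gcongr
      · exact le_abs_self B
      · exact h5.trans h6
    _ = _ := by rw [norm_pow]; ring

theorem isQuantumModular_E_two :
    IsQuantumModular 2 (PowerSeries.map (algebraMap ℚ ℂ) (E 2)) := by
  refine IsQuantumModular.of_expansion_zero (m := 2) (fun z hz => summable_map_E one_le_two hz)
    -- The function `g` is `z²` times the cocycle of `ModularGroup.S`; what remains of `z² f(z)` is
    -- `f(-1/z)`, which is flat at `0`.
    (HasExpansion.of_forall_isBigO (g := fun z => (z ^ 2 - 1) / 24 -
      1 / (2 * riemannZeta 2) * (2 * Real.pi * Complex.I * z) / 24) (by fun_prop) fun N C => ?_)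
    fun γ => ⟨fun z => (1 - ((γ.1 1 0 : ℂ) * z + (γ.1 1 1 : ℂ)) ^ (-2 : ℤ)) / 24 -
        1 / (2 * riemannZeta 2) * (2 * Real.pi * Complex.I * γ.1 1 0 /
          ((γ.1 1 0 : ℂ) * z + (γ.1 1 1 : ℂ))) / 24, ?_, fun z hz _ =>
      (qFun_map_E_two_cocycle γ hz).symm⟩
  · refine (isBigO_qFun_inv one_le_two N C).congr' ?_ EventuallyEq.rfl
    filter_upwards [eventually_sector 0 C] with z ⟨hz, _⟩
    have hz0 : z ≠ 0 := fun h => by simp [h] at hz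
    have h := qFun_map_E_two_cocycle ModularGroup.S hz
    simp [ModularGroup.S] at h
    have h' := congrArg (fun w => z ^ 2 * w) h
    simp only [mul_sub] at h'
    field_simp at h' ⊢
    linear_combination -h'
  · intro z hz
    have hz0 := Complex.slitPlane_ne_zero hz
    refine DifferentiableAt.differentiableWithinAt ?_
    have hw : DifferentiableAt ℂ (fun z : ℂ => (γ.1 1 0 : ℂ) * z + (γ.1 1 1 : ℂ)) z := by fun_prop
    refine DifferentiableAt.sub ?_ ?_
    · exact ((hw.zpow (Or.inl hz0)).const_sub _).div_const _
    · exact (((differentiableAt_const _).div hw hz0).const_mul _).div_const _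

end RealOrigami
end

noncomputable section

namespace RealOrigami

open Asymptotics Filter Topology Polynomial

/-! ### Asymptotic expansion of the Hurwitz sums -/

/-- The Hurwitz sum `∑_{k ≥ 1} (w + k) ^ (-s)`. -/
def hurwitzSum (s : ℕ) (w : ℂ) : ℂ := ∑' k : ℕ, ((w + (k + 1)) ^ s)⁻¹

/-- Quantitative avoidance of the negative integers by the translates of `w`. -/
def AwayFromNegNat (δ : ℝ) (w : ℂ) : Prop := ∀ k : ℕ, δ * (‖w‖ + k) ≤ ‖w + k‖

theorem AwayFromNegNat.succ_le {δ : ℝ} {w : ℂ} (hw : AwayFromNegNat δ w) (k : ℕ) :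
    δ * (‖w‖ + (k + 1)) ≤ ‖w + (k + 1)‖ := by
  simpa using hw (k + 1)

theorem summable_inv_succ_sq : Summable fun k : ℕ => (((k : ℝ) + 1) ^ 2)⁻¹ := by
  have := (summable_nat_add_iff 1).2 (Real.summable_nat_pow_inv.2 (one_lt_two))
  simpa using this

/-- Of the `s ≥ M + 2` factors `w + k + 1`, `M` supply the decay in `w` and two supply convergence
in `k`. -/
theorem summable_and_norm_tsum_le_of_norm_le {δ K : ℝ} (hδ : 0 < δ) (hK : 0 ≤ K) {w : ℂ}
    (hw : AwayFromNegNat δ w) (hw1 : 1 ≤ ‖w‖) {M s : ℕ} (hs : M + 2 ≤ s) {e : ℕ → ℂ}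
    (he : ∀ k : ℕ, ‖e k‖ ≤ K * ‖((w + (k + 1)) ^ s)⁻¹‖) :
    Summable e ∧ ‖∑' k, e k‖ ≤
      K * (δ ^ s)⁻¹ * (∑' k : ℕ, (((k : ℝ) + 1) ^ 2)⁻¹) * ‖w⁻¹ ^ M‖ := by
  have hb : ∀ k : ℕ, ‖e k‖ ≤ K * (δ ^ s)⁻¹ * (((k : ℝ) + 1) ^ 2)⁻¹ * ‖w⁻¹ ^ M‖ := by
    intro k
    refine (he k).trans ?_
    have h1 := hw.succ_le k
    have h2 : δ ^ s * (‖w‖ ^ M * ((k : ℝ) + 1) ^ 2) ≤ ‖w + (k + 1)‖ ^ s := by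
      calc δ ^ s * (‖w‖ ^ M * ((k : ℝ) + 1) ^ 2)
          ≤ δ ^ s * ((‖w‖ + (k + 1)) ^ M * (‖w‖ + (k + 1)) ^ 2) := by
            have hk0 : (0 : ℝ) ≤ k := Nat.cast_nonneg k
            exact mul_le_mul_of_nonneg_left (mul_le_mul
              (pow_le_pow_left₀ (norm_nonneg _) (by linarith) _)
              (pow_le_pow_left₀ (by positivity) (by linarith) _) (by positivity) (by positivity))
              (by positivity)
        _ = δ ^ s * (‖w‖ + (k + 1)) ^ (M + 2) := by rw [pow_add]
        _ ≤ δ ^ s * (‖w‖ + (k + 1)) ^ s := by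
            gcongr
            have : (0 : ℝ) ≤ k := Nat.cast_nonneg k
            linarith
        _ = (δ * (‖w‖ + (k + 1))) ^ s := by rw [mul_pow]
        _ ≤ _ := by gcongr
    rw [norm_inv, norm_pow, norm_pow, norm_inv, mul_assoc, mul_assoc]
    refine mul_le_mul_of_nonneg_left ?_ hK
    have hw0 : 0 < ‖w‖ := by linarith
    calc (‖w + (k + 1)‖ ^ s)⁻¹ ≤ (δ ^ s * (‖w‖ ^ M * ((k : ℝ) + 1) ^ 2))⁻¹ := by gcongr
      _ = _ := by
        rw [mul_inv, mul_inv, inv_pow]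
        ring
  have hsum := (summable_inv_succ_sq.mul_left (K * (δ ^ s)⁻¹)).mul_right ‖w⁻¹ ^ M‖
  refine ⟨hsum.of_norm_bounded hb, ?_⟩
  rw [← tsum_mul_left, ← tsum_mul_right]
  exact tsum_of_norm_bounded hsum.hasSum hb

/-- `hurwitzSum s w` agrees with the polynomial `p` in `w⁻¹` up to `O(w ^ (-M))` as `w → ∞`. -/
def ApproxHurwitz (M s : ℕ) (p : ℂ[X]) : Prop :=
  ∀ δ : ℝ, 0 < δ → ∃ K : ℝ, ∃ R : ℝ, ∀ w : ℂ, AwayFromNegNat δ w → R ≤ ‖w‖ →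
    ‖hurwitzSum s w - p.eval w⁻¹‖ ≤ K * ‖w⁻¹ ^ M‖

/-- The first two terms are kept apart: with `u = (w + k + 1)⁻¹` the constant one makes a
telescoping difference, and the linear one gives the Hurwitz sum to be solved for. -/
theorem exists_taylor_inv_one_sub_pow (n M : ℕ) : ∃ b : ℕ → ℂ, ∃ K ε : ℝ, 0 ≤ K ∧ 0 < ε ∧
    ∀ u : ℂ, ‖u‖ < ε →
      ‖((1 - u) ^ n)⁻¹ - 1 - n * u - ∑ i ∈ Finset.range M, b i * u ^ (i + 2)‖ ≤
        K * ‖u‖ ^ (M + 2) := by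
  have hA : AnalyticAt ℂ (fun u : ℂ => ((1 - u) ^ n)⁻¹) 0 :=
    AnalyticAt.inv (by fun_prop) (by simp)
  obtain ⟨a, ha0, ha1, ha⟩ := exists_taylor hA
  have hd : deriv (fun u : ℂ => ((1 - u) ^ n)⁻¹) 0 = n := by
    have h1 : HasDerivAt (fun u : ℂ => 1 - u) (-1) 0 := by
      simpa using (hasDerivAt_id (0 : ℂ)).const_sub 1
    have h2 := (h1.fun_pow n).fun_inv (by simp)
    simpa using h2.deriv
  obtain ⟨K, hK0, hK⟩ := (ha (M + 2)).exists_nonneg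
  obtain ⟨ε, hε, hball⟩ := Metric.eventually_nhds_iff.1 hK.bound
  refine ⟨fun i => a (i + 2), K, ε, hK0, hε, fun u hu => ?_⟩
  have h := hball (y := u) (by simpa using hu)
  rw [Finset.sum_range_succ', Finset.sum_range_succ', ha0, ha1, hd] at h
  simp only [sub_zero, norm_pow, zero_add, pow_one, pow_zero, mul_one, one_pow, inv_one] at h
  refine le_trans (le_of_eq ?_) h
  congr 1
  ring

theorem AwayFromNegNat.add_ne_zero {δ : ℝ} (hδ : 0 < δ) {w : ℂ} (hw : AwayFromNegNat δ w)
    (hw0 : 0 < ‖w‖) (k : ℕ) : w + k ≠ 0 := by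
  have h1 := hw k
  have h2 : 0 < δ * (‖w‖ + k) := by positivity
  exact norm_pos_iff.1 (h2.trans_le h1)

theorem hasSum_telescope {w : ℂ} {n : ℕ} (hn : n ≠ 0) :
    HasSum (fun k : ℕ => ((w + k) ^ n)⁻¹ - ((w + (k + 1)) ^ n)⁻¹) (w ^ n)⁻¹ ↔
      Summable (fun k : ℕ => ((w + k) ^ n)⁻¹ - ((w + (k + 1)) ^ n)⁻¹) := by
  refine ⟨fun h => h.summable, fun h => ?_⟩
  have h1 := h.hasSum.tendsto_sum_nat
  have h2 : ∀ N : ℕ, ∑ k ∈ Finset.range N, (((w + k) ^ n)⁻¹ - ((w + (k + 1)) ^ n)⁻¹) =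
      (w ^ n)⁻¹ - ((w + N) ^ n)⁻¹ := by
    intro N
    have := Finset.sum_range_sub' (fun k : ℕ => ((w + k) ^ n)⁻¹) N
    simpa using this
  have h3 : Tendsto (fun N : ℕ => (w ^ n)⁻¹ - ((w + N) ^ n)⁻¹) atTop (𝓝 ((w ^ n)⁻¹ - 0)) := by
    refine tendsto_const_nhds.sub ?_
    have h4 : Tendsto (fun N : ℕ => w + (N : ℂ)) atTop (Bornology.cobounded ℂ) :=
      (tendsto_const_add_cobounded w).comp (tendsto_norm_atTop_iff_cobounded.1 (by
        simpa using tendsto_natCast_atTop_atTop (R := ℝ)))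
    have h5 := (tendsto_inv₀_cobounded.comp h4).pow n
    simpa [hn, Function.comp_def] using h5
  simp only [h2] at h1
  have := tendsto_nhds_unique h1 h3
  rw [sub_zero] at this
  rw [← this]
  exact h.hasSum

/-- Expanding `(w + k)⁻ⁿ - (w + k + 1)⁻ⁿ` in powers of `(w + k + 1)⁻¹` and summing over `k`
telescopes to `w⁻ⁿ`. This expresses `n` times the Hurwitz sum of exponent `n + 1` by `w⁻ⁿ`, sums of
higher exponent and an error `O(w⁻ᴹ)`. -/
theorem ApproxHurwitz.of_succ {M n : ℕ} (hn : 2 ≤ n)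
    (ih : ∀ m, n < m → ∃ p : ℂ[X], p.coeff 0 = 0 ∧ p.coeff 1 = 0 ∧ ApproxHurwitz M (m + 1) p) :
    ∃ p : ℂ[X], p.coeff 0 = 0 ∧ p.coeff 1 = 0 ∧ ApproxHurwitz M (n + 1) p := by
  obtain ⟨b, K, ε, hK, hε, hb⟩ := exists_taylor_inv_one_sub_pow n M
  choose p hp0 hp1 hp using fun i : ℕ => ih (n + 1 + i) (by omega)
  have hn0 : (n : ℂ) ≠ 0 := by exact_mod_cast (by omega : n ≠ 0)
  refine ⟨C (n : ℂ)⁻¹ * (X ^ n - ∑ i ∈ Finset.range M, C (b i) * p i), ?_, ?_, fun δ hδ => ?_⟩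
  · rw [coeff_C_mul, coeff_sub, coeff_X_pow, if_neg (by omega), finsetSum_coeff]
    simp [hp0]
  · rw [coeff_C_mul, coeff_sub, coeff_X_pow, if_neg (by omega), finsetSum_coeff]
    simp [hp1, coeff_C_mul]
  choose Ki Ri hi using fun i => hp i δ hδ
  set Z := ∑' k : ℕ, (((k : ℝ) + 1) ^ 2)⁻¹
  refine ⟨‖(n : ℂ)⁻¹‖ * (∑ i ∈ Finset.range M, ‖b i‖ * Ki i + K * (δ ^ (n + M + 2))⁻¹ * Z),
    max (max 1 (2 / (δ * ε))) (∑ i ∈ Finset.range M, |Ri i|), fun w hw hR => ?_⟩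
  have hw1 : 1 ≤ ‖w‖ := ((le_max_left _ _).trans (le_max_left _ _)).trans hR
  have hw2 : 2 / (δ * ε) ≤ ‖w‖ := ((le_max_right _ _).trans (le_max_left _ _)).trans hR
  have hw3 : ∀ i ∈ Finset.range M, Ri i ≤ ‖w‖ := fun i hi => (le_abs_self _).trans <|
    (Finset.single_le_sum (f := fun i => |Ri i|) (fun _ _ => abs_nonneg _) hi).trans
      ((le_max_right _ _).trans hR)
  have hw0 : 0 < ‖w‖ := by linarith
  set e : ℕ → ℂ := fun k => ((w + k) ^ n)⁻¹ - ((w + (k + 1)) ^ n)⁻¹ -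
    n * ((w + (k + 1)) ^ (n + 1))⁻¹ -
      ∑ i ∈ Finset.range M, b i * ((w + (k + 1)) ^ (n + 1 + i + 1))⁻¹ with he
  have hS : ∀ s, 2 ≤ s → Summable fun k : ℕ => ((w + (k + 1)) ^ s)⁻¹ := fun s hs =>
    (summable_and_norm_tsum_le_of_norm_le hδ zero_le_one hw hw1 (M := 0) (s := s) (by omega)
      (fun k => (one_mul _).ge)).1
  have hek : ∀ k : ℕ, ‖e k‖ ≤ K * ‖((w + (k + 1)) ^ (n + M + 2))⁻¹‖ := by
    intro k
    have hy0 : w + (k + 1) ≠ 0 := by simpa using hw.add_ne_zero hδ hw0 (k + 1)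
    have hk0 := hw.add_ne_zero hδ hw0 k
    set y : ℂ := w + (k + 1) with hy
    have hwy : w + k = y - 1 := by rw [hy]; ring
    have hu : ‖y⁻¹‖ < ε := by
      rw [norm_inv]
      refine inv_lt_of_inv_lt₀ hε ?_
      have h1 : δ * ‖w‖ ≤ ‖y‖ := le_trans (by gcongr; linarith [(Nat.cast_nonneg k : (0:ℝ) ≤ k)])
        (hw.succ_le k)
      have h2 : 2 * ε⁻¹ ≤ δ * ‖w‖ := by
        calc 2 * ε⁻¹ = δ * (2 / (δ * ε)) := by field_simp
          _ ≤ _ := by gcongr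
      have h3 : 0 < ε⁻¹ := by positivity
      linarith
    have h := hb y⁻¹ hu
    have e1 : e k = (y ^ n)⁻¹ * (((1 - y⁻¹) ^ n)⁻¹ - 1 - n * y⁻¹ -
        ∑ i ∈ Finset.range M, b i * y⁻¹ ^ (i + 2)) := by
      simp only [he]
      rw [← hy, hwy]
      have e2 : ((y - 1) ^ n)⁻¹ = (y ^ n)⁻¹ * ((1 - y⁻¹) ^ n)⁻¹ := by
        rw [← mul_inv, ← mul_pow]
        congr 2
        field_simp
      rw [e2, mul_sub, mul_sub, mul_sub, mul_one, Finset.mul_sum]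
      congr 1
      · congr 1
        rw [pow_succ]
        field_simp
      · refine Finset.sum_congr rfl fun i _ => ?_
        rw [show n + 1 + i + 1 = n + (i + 2) by ring, pow_add, inv_pow]
        field_simp
    rw [e1, norm_mul]
    calc ‖(y ^ n)⁻¹‖ * _ ≤ ‖(y ^ n)⁻¹‖ * (K * ‖y⁻¹‖ ^ (M + 2)) := by gcongr
      _ = K * ‖(y ^ (n + M + 2))⁻¹‖ := by
        rw [add_assoc n, pow_add]
        simp only [norm_inv, norm_pow, inv_pow]
        ring
  obtain ⟨hesum, hebound⟩ := summable_and_norm_tsum_le_of_norm_le hδ hK hw hw1 (M := M)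
    (s := n + M + 2) (by omega) hek
  have hS2 : Summable fun k : ℕ => (n : ℂ) * ((w + (k + 1)) ^ (n + 1))⁻¹ :=
    (hS (n + 1) (by omega)).mul_left _
  have hS3 : ∀ i ∈ Finset.range M, Summable fun k : ℕ =>
      b i * ((w + (k + 1)) ^ (n + 1 + i + 1))⁻¹ := fun i _ => (hS _ (by omega)).mul_left _
  have hS3' := summable_sum hS3
  have htel : Summable (fun k : ℕ => ((w + k) ^ n)⁻¹ - ((w + (k + 1)) ^ n)⁻¹) := by
    refine ((hesum.add hS2).add hS3').congr fun k => ?_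
    simp only [he]
    ring
  have htel' := ((hasSum_telescope (by omega)).2 htel).tsum_eq
  have hmain : ∑' k, e k = (w ^ n)⁻¹ - n * hurwitzSum (n + 1) w -
      ∑ i ∈ Finset.range M, b i * hurwitzSum (n + 1 + i + 1) w := by
    simp only [he]
    rw [(htel.sub hS2).tsum_sub hS3', htel.tsum_sub hS2, htel', tsum_mul_left,
      Summable.tsum_finsetSum hS3]
    simp only [tsum_mul_left, hurwitzSum]
  have hfin : hurwitzSum (n + 1) w -
      (C (n : ℂ)⁻¹ * (X ^ n - ∑ i ∈ Finset.range M, C (b i) * p i)).eval w⁻¹ =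
      (n : ℂ)⁻¹ * (-(∑ i ∈ Finset.range M, b i * (hurwitzSum (n + 1 + i + 1) w -
        (p i).eval w⁻¹)) - ∑' k, e k) := by
    rw [hmain]
    simp only [eval_mul, eval_C, eval_sub, eval_pow, eval_X, eval_finsetSum, mul_sub,
      Finset.sum_sub_distrib, inv_pow]
    field_simp
    ring
  rw [hfin, norm_mul, mul_assoc, add_mul, Finset.sum_mul]
  refine mul_le_mul_of_nonneg_left ?_ (norm_nonneg _)
  refine (norm_sub_le _ _).trans (add_le_add ?_ hebound)
  rw [norm_neg]
  refine (norm_sum_le _ _).trans (Finset.sum_le_sum fun i hiM => ?_)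
  rw [norm_mul, mul_assoc]
  exact mul_le_mul_of_nonneg_left (hi i w hw (hw3 i hiM)) (norm_nonneg _)

/-- Downward induction on the exponent: from `M + 2` on the zero polynomial suffices. The vanishing
of the two lowest coefficients is what later allows summation over the lattice. -/
theorem exists_approxHurwitz (M n : ℕ) (hn : 2 ≤ n) :
    ∃ p : ℂ[X], p.coeff 0 = 0 ∧ p.coeff 1 = 0 ∧ ApproxHurwitz M (n + 1) p := by
  suffices h : ∀ j n, 2 ≤ n → M + 2 ≤ n + 1 + j →
      ∃ p : ℂ[X], p.coeff 0 = 0 ∧ p.coeff 1 = 0 ∧ ApproxHurwitz M (n + 1) p from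
    h (M + 2) n hn (by omega)
  intro j
  induction j with
  | zero =>
    intro n hn hM
    refine ⟨0, by simp, by simp, fun δ hδ => ⟨1 * (δ ^ (n + 1))⁻¹ * ∑' k : ℕ, (((k : ℝ) + 1) ^ 2)⁻¹,
      1, fun w hw hw1 => ?_⟩⟩
    rw [eval_zero, sub_zero]
    exact (summable_and_norm_tsum_le_of_norm_le hδ zero_le_one hw hw1 (M := M) (by omega)
      (fun k => (one_mul _).ge)).2
  | succ j ih =>
    intro n hn hM
    exact ApproxHurwitz.of_succ hn fun m hm => ih m (by omega) (by omega)

/-- With `t = |m + kz|`, the imaginary part gives `k|z| ≤ (|C| + 1)t`, hence `|m| ≤ (|C| + 2)t`. The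
two bounds add up to the constant `2|C| + 3`. -/
theorem awayFromNegNat_div_of_mem_sector {C : ℝ} {z : ℂ} (hz : 0 < z.im)
    (h : |z.re - 0| ≤ C * z.im) (m : ℤ) : AwayFromNegNat (1 / (2 * |C| + 3)) ((m : ℂ) / z) := by
  intro k
  have hz0 : z ≠ 0 := fun h0 => by simp [h0] at hz
  have hzn : 0 < ‖z‖ := norm_pos_iff.2 hz0
  have h1 : ‖z‖ ≤ (|C| + 1) * z.im := by
    have := norm_sub_le_of_mem_sector hz h
    rw [Complex.ofReal_zero, sub_zero] at this
    refine this.trans ?_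
    gcongr
    exact le_abs_self C
  have h2 : (m : ℂ) / z + k = (m + k * z) / z := by field_simp
  rw [h2, norm_div, norm_div]
  set t := ‖(m : ℂ) + k * z‖
  have h3 : k * ‖z‖ ≤ (|C| + 1) * t := by
    have h4 : k * z.im ≤ t := by
      refine le_trans (le_of_eq ?_) (Complex.im_le_norm _)
      simp
    calc k * ‖z‖ ≤ k * ((|C| + 1) * z.im) := by gcongr
      _ = (|C| + 1) * (k * z.im) := by ring
      _ ≤ _ := by gcongr
  have h5 : ‖(m : ℂ)‖ ≤ t + k * ‖z‖ := by
    have := norm_sub_le ((m : ℂ) + k * z) (k * z)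
    rwa [add_sub_cancel_right, norm_mul, Complex.norm_natCast] at this
  rw [div_mul_eq_mul_div, one_mul, div_le_div_iff₀ (by positivity) hzn]
  rw [add_mul, div_mul_cancel₀ _ hzn.ne']
  linarith

end RealOrigami
end

noncomputable section

namespace RealOrigami

open Asymptotics Filter Topology

/-! ### The weight three Eisenstein series -/

theorem summable_prod_pnat_int_inv_cube (z : UpperHalfPlane) :
    Summable fun x : ℕ+ × ℤ => (((x.1 : ℂ) * z + x.2) ^ 3)⁻¹ := by
  have h1 := summable_prod_eisSummand (le_refl 3) z
  have hinj : Function.Injective fun x : ℕ+ × ℤ => (((x.1 : ℕ) : ℤ), x.2) := by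
    rintro ⟨a, b⟩ ⟨c, d⟩ h
    simp only [Prod.mk.injEq, Nat.cast_inj, PNat.coe_inj] at h
    exact Prod.ext h.1 h.2
  refine (h1.comp_injective hinj).congr fun x => ?_
  simp only [EisensteinSeries.eisSummand, Function.comp_apply]
  norm_cast

theorem qFun_map_E_three (z : UpperHalfPlane) :
    qFun (PowerSeries.map (algebraMap ℚ ℂ) (E 3)) z =
      2 * ((-2 * Real.pi * Complex.I) ^ 3)⁻¹ * ∑' (k : ℕ+) (m : ℤ), (((k : ℂ) * z + m) ^ 3)⁻¹ := by
  have H (b : ℕ+) := EisensteinSeries.qExpansion_identity_pnat (k := 2) one_le_two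
    ⟨b * z, by simpa using z.2⟩
  simp only [one_div] at H
  have h1 : ∀ k : ℕ+, ∑' m : ℤ, (((k : ℂ) * z + m) ^ 3)⁻¹ =
      (-2 * Real.pi * Complex.I) ^ 3 / 2 * ∑' n : ℕ+, ((n : ℕ) : ℂ) ^ 2 *
        Complex.exp (2 * Real.pi * Complex.I * z) ^ (k * n : ℕ) := by
    intro k
    refine (H k).trans ?_
    congr 1
    refine tsum_congr fun n => ?_
    rw [← Complex.exp_nat_mul, ← Complex.exp_nat_mul]
    push_cast
    ring_nf
  have h0 : (-2 * Real.pi * Complex.I : ℂ) ≠ 0 := by simp [Real.pi_ne_zero]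
  rw [qFun_map_E (by norm_num) z.2, tsum_congr h1, tsum_mul_left,
    tsum_prod_pow_eq_tsum_sigma 2 (UpperHalfPlane.norm_exp_two_pi_I_lt_one z)]
  field_simp

/-- The double series is summed over `k` first, after taking `z` out of each factor `kz + m`. -/
theorem qFun_map_E_three_eq_tsum_hurwitzSum (z : UpperHalfPlane) :
    (z : ℂ) ^ 3 * qFun (PowerSeries.map (algebraMap ℚ ℂ) (E 3)) z =
      2 * ((-2 * Real.pi * Complex.I) ^ 3)⁻¹ * ∑' m : ℤ, hurwitzSum 3 (m / z) := by
  have hz : (z : ℂ) ≠ 0 := z.ne_zero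
  have h1 : ∑' (k : ℕ+) (m : ℤ), (((k : ℂ) * z + m) ^ 3)⁻¹ =
      ∑' (m : ℤ) (k : ℕ+), (((k : ℂ) * z + m) ^ 3)⁻¹ :=
    (Summable.tsum_comm (f := fun (k : ℕ+) (m : ℤ) => (((k : ℂ) * z + m) ^ 3)⁻¹)
      (summable_prod_pnat_int_inv_cube z)).symm
  have h2 : ∀ m : ℤ, (z : ℂ) ^ 3 * ∑' k : ℕ+, (((k : ℂ) * z + m) ^ 3)⁻¹ =
      hurwitzSum 3 (m / z) := by
    intro m
    rw [tsum_pnat_eq_tsum_succ (f := fun k : ℕ => (((k : ℂ) * z + m) ^ 3)⁻¹), ← tsum_mul_left]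
    refine tsum_congr fun k => ?_
    have e : (m : ℂ) / z + (k + 1) = (((k + 1 : ℕ) : ℂ) * z + m) / z := by
      rw [add_div, mul_div_cancel_right₀ _ hz, Nat.cast_succ, add_comm]
    rw [e, div_pow, inv_div, div_eq_mul_inv]
  rw [qFun_map_E_three, h1, mul_left_comm, ← tsum_mul_left]
  congr 1
  exact tsum_congr h2

theorem summable_inv_int_pow {j : ℕ} (hj : 2 ≤ j) : Summable fun m : ℤ => ((m : ℂ) ^ j)⁻¹ := by
  have h := (Real.summable_one_div_int_pow (p := j)).2 (by omega)
  have h2 := Complex.summable_ofReal.2 h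
  simpa using h2

/-- The expansion of the Hurwitz sum at `m/z` is summed over `m ≠ 0` term by term, giving the
coefficients `∑ m⁻ʲ`; the term `m = 0` contributes the constant `hurwitzSum 3 0`. -/
theorem hasExpansion_E_three :
    HasExpansion (qFun (PowerSeries.map (algebraMap ℚ ℂ) (E 3))) 0 3 := by
  intro N
  -- Two orders beyond `N` make the errors `(z/m)^(N+2)` summable over `m`.
  obtain ⟨p, hp0, hp1, hp⟩ := exists_approxHurwitz (N + 2) 2 le_rfl
  set κ : ℂ := 2 * ((-2 * Real.pi * Complex.I) ^ 3)⁻¹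
  refine ⟨fun z => κ * (hurwitzSum 3 0 + ∑ j ∈ Finset.range (p.natDegree + 1),
    p.coeff j * (∑' m : ℤ, ((m : ℂ) ^ j)⁻¹) * z ^ j), by fun_prop, fun C => ?_⟩
  obtain ⟨K, R, hKR⟩ := hp (1 / (2 * |C| + 3)) (by positivity)
  have hZ := (summable_inv_int_pow (j := N + 2) (by omega)).norm
  refine IsBigO.of_bound (‖κ‖ * (|K| * ∑' m : ℤ, ‖((m : ℂ) ^ (N + 2))⁻¹‖)) ?_
  have hR0 : 0 < |R| + 1 := by positivity
  have hev : ∀ᶠ z : ℂ in sector 0 C, ‖z‖ ≤ (|R| + 1)⁻¹ := by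
    have h0 : Tendsto (fun z : ℂ => ‖z‖) (sector 0 C) (𝓝 0) := by
      have : Tendsto (fun z : ℂ => ‖z‖) (𝓝 0) (𝓝 0) := by
        simpa using (continuous_norm (E := ℂ)).tendsto 0
      exact this.mono_left (by simpa using sector_le_nhds 0 C)
    exact h0.eventually_le_const (by positivity)
  filter_upwards [hev, eventually_sector 0 C] with z hz1 ⟨hz2, hz3⟩
  have hz0 : z ≠ 0 := fun h => by simp [h] at hz2
  have hzn : 0 < ‖z‖ := norm_pos_iff.2 hz0
  have hz4 : ‖z‖ ≤ 1 := hz1.trans (inv_le_one_of_one_le₀ (by linarith [abs_nonneg R]))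
  have hmz : ∀ m : ℤ, m ≠ 0 → R ≤ ‖(m : ℂ) / z‖ := by
    intro m hm
    have h1 : (1 : ℝ) ≤ ‖(m : ℂ)‖ := by
      rw [Complex.norm_intCast]
      exact_mod_cast Int.one_le_abs hm
    rw [norm_div, le_div_iff₀ hzn]
    calc R * ‖z‖ ≤ (|R| + 1) * (|R| + 1)⁻¹ := by
          gcongr
          linarith [le_abs_self R]
      _ = 1 := mul_inv_cancel₀ hR0.ne'
      _ ≤ _ := h1
  set g : ℤ → ℂ := fun m => if m = 0 then 0 else hurwitzSum 3 (m / z) - p.eval ((m / z : ℂ)⁻¹)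
    with hg
  have hgb : ∀ m, ‖g m‖ ≤ |K| * ‖((m : ℂ) ^ (N + 2))⁻¹‖ * ‖z‖ ^ N := by
    intro m
    by_cases hm : m = 0
    · simp [hg, hm]
    · simp only [hg, if_neg hm]
      refine (hKR _ (awayFromNegNat_div_of_mem_sector hz2 hz3 m) (hmz m hm)).trans ?_
      rw [inv_div, div_pow, norm_div, norm_inv, norm_pow z, div_eq_inv_mul, mul_assoc]
      refine mul_le_mul (le_abs_self K) (mul_le_mul_of_nonneg_left ?_ (by positivity))
        (by positivity) (abs_nonneg K)
      exact pow_le_pow_of_le_one hzn.le hz4 (by omega)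
  have hgs := (hZ.mul_left |K|).mul_right (‖z‖ ^ N)
  have hgS : Summable g := hgs.of_norm_bounded hgb
  have hgn : ‖∑' m, g m‖ ≤ |K| * (∑' m : ℤ, ‖((m : ℂ) ^ (N + 2))⁻¹‖) * ‖z‖ ^ N := by
    rw [← tsum_mul_left, ← tsum_mul_right]
    exact tsum_of_norm_bounded hgs.hasSum hgb
  have hpe : ∀ m : ℤ, p.eval ((m / z : ℂ)⁻¹) = ∑ j ∈ Finset.range (p.natDegree + 1),
      p.coeff j * z ^ j * ((m : ℂ) ^ j)⁻¹ := by
    intro m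
    rw [Polynomial.eval_eq_sum_range, inv_div]
    refine Finset.sum_congr rfl fun j _ => ?_
    rw [div_pow, div_eq_mul_inv, mul_assoc]
  -- For `j = 0, 1` the sum over `m` diverges, but there the coefficient of `p` vanishes.
  have hps : ∀ j ∈ Finset.range (p.natDegree + 1),
      Summable fun m : ℤ => p.coeff j * z ^ j * ((m : ℂ) ^ j)⁻¹ := by
    intro j _
    by_cases hj : 2 ≤ j
    · exact (summable_inv_int_pow hj).mul_left _
    · have : p.coeff j = 0 := by
        obtain rfl | rfl : j = 0 ∨ j = 1 := by omega
        exacts [hp0, hp1]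
      simp [this]
  have hpt : HasSum (fun m : ℤ => p.eval ((m / z : ℂ)⁻¹)) (∑ j ∈ Finset.range (p.natDegree + 1),
      p.coeff j * (∑' m : ℤ, ((m : ℂ) ^ j)⁻¹) * z ^ j) := by
    have := hasSum_sum fun j hj => (hps j hj).hasSum
    simp only [hpe]
    convert this using 1
    refine Finset.sum_congr rfl fun j _ => ?_
    rw [tsum_mul_left]
    ring
  have h0 := hasSum_ite_eq (0 : ℤ) (hurwitzSum 3 0)
  have htot := ((hgS.hasSum.add hpt).add h0).tsum_eq
  have hcongr : ∀ m : ℤ, g m + p.eval ((m / z : ℂ)⁻¹) + (if m = 0 then hurwitzSum 3 0 else 0) =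
      hurwitzSum 3 (m / z) := by
    intro m
    by_cases hm : m = 0
    · subst hm
      simp [hg, ← Polynomial.coeff_zero_eq_eval_zero, hp0]
    · simp [hg, hm]
  rw [tsum_congr hcongr] at htot
  have hq := qFun_map_E_three_eq_tsum_hurwitzSum ⟨z, hz2⟩
  rw [UpperHalfPlane.coe_mk] at hq
  rw [Complex.ofReal_zero, sub_zero, hq, htot, norm_pow]
  have e : ∀ a b c : ℂ, κ * (a + b + c) - κ * (c + b) = κ * a := by intros; ring
  rw [e, norm_mul, mul_assoc]
  exact mul_le_mul_of_nonneg_left hgn (norm_nonneg _)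

/-- The summand of the function whose modularity defect is that of the weight three Eisenstein
series. -/
def signedSummand (v : Fin 2 → ℤ) (z : UpperHalfPlane) : ℂ :=
  (Int.sign (v 0) : ℂ) * EisensteinSeries.eisSummand 3 v z

theorem norm_sign_le_one (n : ℤ) : ‖(Int.sign n : ℂ)‖ ≤ 1 := by
  rw [Complex.norm_intCast, ← Int.cast_abs]
  rcases lt_trichotomy n 0 with h | h | h
  · simp [Int.sign_eq_neg_one_of_neg h]
  · simp [h]
  · simp [Int.sign_eq_one_of_pos h]

theorem summable_sign_mul_eisSummand (c : (Fin 2 → ℤ) → ℤ) (z : UpperHalfPlane) :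
    Summable fun v => (Int.sign (c v) : ℂ) * EisensteinSeries.eisSummand 3 v z := by
  refine (EisensteinSeries.summable_norm_eisSummand le_rfl z).of_norm_bounded fun v => ?_
  rw [norm_mul]
  exact mul_le_of_le_one_left (norm_nonneg _) (norm_sign_le_one _)

/-- In odd weight `v` and `-v` would cancel; the sign of the first coordinate makes them add up
instead, and kills the row where it is zero. -/
theorem qFun_map_E_three_eq_tsum_signedSummand (z : UpperHalfPlane) :
    qFun (PowerSeries.map (algebraMap ℚ ℂ) (E 3)) z =
      ((-2 * Real.pi * Complex.I) ^ 3)⁻¹ * ∑' v, signedSummand v z := by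
  have hs : Summable fun x : ℤ × ℤ => signedSummand ![x.1, x.2] z := by
    refine (finTwoArrowEquiv ℤ).summable_iff.mp ?_
    refine (summable_sign_mul_eisSummand (fun v => v 0) z).congr fun v => ?_
    simp [show ![v 0, v 1] = v from List.ofFn_inj.mp rfl, signedSummand]
  have h1 : ∑' v, signedSummand v z =
      2 * ∑' (k : ℕ+) (m : ℤ), (((k : ℂ) * z + m) ^ 3)⁻¹ := by
    rw [← (finTwoArrowEquiv ℤ).symm.tsum_eq, finTwoArrowEquiv_symm_apply, Summable.tsum_prod hs,
      tsum_int_eq_zero_add_two_mul_tsum_pnat (fun n => ?_) hs.prod]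
    · have h0 : ∑' m : ℤ, signedSummand ![0, m] z = 0 := by simp [signedSummand]
      rw [h0, zero_add, nsmul_eq_mul, Nat.cast_ofNat]
      congr 1
      refine tsum_congr fun k => tsum_congr fun m => ?_
      have hk : Int.sign ((k : ℕ) : ℤ) = 1 := Int.sign_eq_one_of_pos (by exact_mod_cast k.pos)
      simp only [signedSummand, EisensteinSeries.eisSummand, Matrix.cons_val_zero,
        Matrix.cons_val_one, hk]
      norm_cast
      simp
    · rw [← tsum_comp_neg]
      refine tsum_congr fun m => ?_
      have e : ((-n : ℤ) : ℂ) * z + ((-m : ℤ) : ℂ) = -(n * z + m) := by push_cast; ring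
      simp only [signedSummand, EisensteinSeries.eisSummand, Matrix.cons_val_zero,
        Matrix.cons_val_one, Int.sign_neg, e]
      rw [Odd.neg_zpow (by decide)]
      push_cast
      ring
  rw [qFun_map_E_three, h1]
  ring

/-- The segment from `1` to `w₀` stays in the slit plane and so keeps a positive distance from `0`.
Half of that distance survives small perturbations of `w₀`, and scaling by `a + b` gives the general
case. -/
theorem norm_add_ge_of_mem_slitPlane {w₀ : ℂ} (hw : w₀ ∈ Complex.slitPlane) :
    ∃ δ : ℝ, 0 < δ ∧ ∀ w, ‖w - w₀‖ < δ → ∀ a b : ℝ, 0 ≤ a → 0 ≤ b →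
      δ * (a + b) ≤ ‖a * w + b‖ := by
  obtain ⟨t₀, ht₀, hmin⟩ := isCompact_Icc.exists_isMinOn (s := Set.Icc (0 : ℝ) 1)
    (f := fun t : ℝ => ‖(t : ℂ) * w₀ + (1 - t : ℝ)‖) ⟨0, by simp⟩ (by fun_prop)
  have hne : ∀ t ∈ Set.Icc (0 : ℝ) 1, 0 < ‖(t : ℂ) * w₀ + (1 - t : ℝ)‖ := by
    intro t ht
    have h := Complex.starConvex_one_slitPlane hw (a := 1 - t) (b := t) (by linarith [ht.2]) ht.1
      (by ring)
    refine norm_pos_iff.2 (Complex.slitPlane_ne_zero ?_)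
    simpa [add_comm] using h
  set δ := ‖(t₀ : ℂ) * w₀ + (1 - t₀ : ℝ)‖ / 2
  have hδ : 0 < δ := half_pos (hne t₀ ht₀)
  refine ⟨δ, hδ, fun w hwδ a b ha hb => ?_⟩
  rcases (add_nonneg ha hb).eq_or_lt with h0 | h0
  · simp [← h0]
  set t := a / (a + b)
  have ht0 : 0 ≤ t := by positivity
  have ht1 : t ≤ 1 := (div_le_one h0).2 (by linarith)
  have hm : 2 * δ ≤ ‖(t : ℂ) * w₀ + (1 - t : ℝ)‖ := by
    have : 2 * δ = ‖(t₀ : ℂ) * w₀ + (1 - t₀ : ℝ)‖ := by simp only [δ]; ring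
    rw [this]
    exact hmin ⟨ht0, ht1⟩
  have h1 : δ ≤ ‖(t : ℂ) * w + (1 - t : ℝ)‖ := by
    have h2 : (t : ℂ) * w₀ + (1 - t : ℝ) = ((t : ℂ) * w + (1 - t : ℝ)) - t * (w - w₀) := by ring
    have h3 := norm_sub_le ((t : ℂ) * w + (1 - t : ℝ)) (t * (w - w₀))
    rw [← h2, norm_mul, Complex.norm_real, Real.norm_of_nonneg ht0] at h3
    have h4 : t * ‖w - w₀‖ ≤ 1 * δ := mul_le_mul ht1 hwδ.le (norm_nonneg _) zero_le_one
    linarith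
  have e : (a : ℂ) * w + b = ((a + b : ℝ) : ℂ) * ((t : ℂ) * w + (1 - t : ℝ)) := by
    have h5 : (a + b) * t = a := mul_div_cancel₀ _ h0.ne'
    have h6 : ((a + b : ℝ) : ℂ) * t = a := by exact_mod_cast h5
    have h7 : ((a + b : ℝ) : ℂ) = a + b := by push_cast; rfl
    push_cast at h6 ⊢
    linear_combination (1 - w) * h6
  rw [e, norm_mul, Complex.norm_real, Real.norm_of_nonneg h0.le, mul_comm]
  gcongr

/-- With `j = v₁c - v₀d` one has `c(v₀z + v₁) = v₀(cz + d) + j`. If the two signs differ, `v₀` and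
`j` do not have opposite signs, so `norm_add_ge_of_mem_slitPlane` applies to `cz + d`. For `c = 0`
one gets `d = 1`, and the signs never differ. -/
theorem norm_add_ge_of_sign_ne {c d : ℤ} (hcd : c = 0 → d ≤ 1) {z₀ : ℂ}
    (hz : (c : ℂ) * z₀ + d ∈ Complex.slitPlane) :
    ∃ δ : ℝ, 0 < δ ∧ ∀ z, ‖z - z₀‖ < δ → ∀ v : Fin 2 → ℤ,
      Int.sign (v 0) - Int.sign (v 0 * d - v 1 * c) ≠ 0 → δ * ‖v‖ ≤ ‖(v 0 : ℂ) * z + v 1‖ := by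
  by_cases hc : c = 0
  · refine ⟨1, one_pos, fun z _ v hv => absurd ?_ hv⟩
    have hd : 0 < d := by
      rw [hc, Int.cast_zero, zero_mul, zero_add] at hz
      have h1 : ((d : ℝ) : ℂ) ∈ Complex.slitPlane := by simpa using hz
      exact_mod_cast Complex.ofReal_mem_slitPlane.1 h1
    have : d = 1 := le_antisymm (hcd hc) hd
    simp [hc, this]
  obtain ⟨δ, hδ, h⟩ := norm_add_ge_of_mem_slitPlane hz
  have hc' : 0 < |(c : ℝ)| := abs_pos.2 (by exact_mod_cast hc)
  have hc1 : 1 ≤ |(c : ℝ)| := by exact_mod_cast Int.one_le_abs hc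
  have hD : 0 < |(c : ℝ)| * (1 + |(d : ℝ)|) := by positivity
  refine ⟨δ / (|(c : ℝ)| * (1 + |(d : ℝ)|)), by positivity, fun z hzz v hv => ?_⟩
  set k := v 0 with hk
  set m := v 1 with hm
  set j : ℤ := m * c - k * d with hj
  have hD1 : |(c : ℝ)| ≤ |(c : ℝ)| * (1 + |(d : ℝ)|) :=
    le_mul_of_one_le_right hc'.le (by linarith [abs_nonneg (d : ℝ)])
  have hw : ‖((c : ℂ) * z + d) - (c * z₀ + d)‖ < δ := by
    have e : ((c : ℂ) * z + d) - (c * z₀ + d) = c * (z - z₀) := by ring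
    rw [e, norm_mul, Complex.norm_intCast]
    rw [lt_div_iff₀ hD] at hzz
    refine lt_of_le_of_lt ?_ hzz
    rw [mul_comm]
    gcongr
  have hsign : (0 ≤ k ∧ 0 ≤ j) ∨ (k ≤ 0 ∧ j ≤ 0) := by
    by_contra hcon
    push Not at hcon
    have hjn : k * d - m * c = -j := by rw [hj]; ring
    rw [hjn, Int.sign_neg] at hv
    rcases lt_trichotomy k 0 with h1 | h1 | h1
    · have h2 : 0 < j := hcon.2 h1.le
      simp [Int.sign_eq_neg_one_of_neg h1, Int.sign_eq_one_of_pos h2] at hv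
    · have := hcon.1 h1.ge
      have := hcon.2 h1.le
      omega
    · have h2 : j < 0 := hcon.1 h1.le
      simp [Int.sign_eq_neg_one_of_neg h2, Int.sign_eq_one_of_pos h1] at hv
  have hkey : δ * (|(k : ℝ)| + |(j : ℝ)|) ≤ ‖(k : ℂ) * (c * z + d) + j‖ := by
    rcases hsign with ⟨h1, h2⟩ | ⟨h1, h2⟩
    · have h1' : (0 : ℝ) ≤ k := by exact_mod_cast h1
      have h2' : (0 : ℝ) ≤ j := by exact_mod_cast h2
      have := h _ hw k j h1' h2'
      rw [abs_of_nonneg h1', abs_of_nonneg h2']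
      simpa using this
    · have h1' : (k : ℝ) ≤ 0 := by exact_mod_cast h1
      have h2' : (j : ℝ) ≤ 0 := by exact_mod_cast h2
      have := h _ hw (-k) (-j) (by linarith) (by linarith)
      rw [abs_of_nonpos h1', abs_of_nonpos h2']
      refine this.trans (le_of_eq ?_)
      rw [← norm_neg]
      congr 1
      push_cast
      ring
  have he : (k : ℂ) * (c * z + d) + j = c * (k * z + m) := by
    rw [hj]
    push_cast
    ring
  rw [he, norm_mul, Complex.norm_intCast] at hkey
  have hv : ‖v‖ ≤ (1 + |(d : ℝ)|) * (|(k : ℝ)| + |(j : ℝ)|) := by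
    have hd0 := abs_nonneg (d : ℝ)
    have hk0 := abs_nonneg (k : ℝ)
    have hj0 := abs_nonneg (j : ℝ)
    refine (pi_norm_le_iff_of_nonneg (by positivity)).2 fun i => ?_
    fin_cases i
    · change ‖k‖ ≤ _
      rw [Int.norm_eq_abs]
      nlinarith
    · change ‖m‖ ≤ _
      rw [Int.norm_eq_abs]
      have h1 : (m : ℝ) * c = j + k * d := by rw [hj]; push_cast; ring
      have h2 : |(m : ℝ)| * |(c : ℝ)| ≤ |(j : ℝ)| + |(k : ℝ)| * |(d : ℝ)| := by
        rw [← abs_mul, ← abs_mul, h1]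
        exact abs_add_le _ _
      nlinarith [abs_nonneg (m : ℝ)]
  rw [div_mul_eq_mul_div, div_le_iff₀ hD]
  calc δ * ‖v‖ ≤ δ * ((1 + |(d : ℝ)|) * (|(k : ℝ)| + |(j : ℝ)|)) := by gcongr
    _ = (1 + |(d : ℝ)|) * (δ * (|(k : ℝ)| + |(j : ℝ)|)) := by ring
    _ ≤ (1 + |(d : ℝ)|) * (|(c : ℝ)| * ‖(k : ℂ) * z + m‖) := by gcongr
    _ = _ := by ring

/-- The failure of modularity of `∑ v, signedSummand v z`. -/
def signDefect (c d : ℤ) (z : ℂ) : ℂ :=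
  ∑' v : Fin 2 → ℤ, ((Int.sign (v 0) - Int.sign (v 0 * d - v 1 * c) : ℤ) : ℂ) *
    (((v 0 : ℂ) * z + v 1) ^ 3)⁻¹

/-- Near `z₀` the nonzero terms are dominated by a multiple of `‖v‖⁻³`, which is summable over the
lattice, so the series is holomorphic there even across the real axis. -/
theorem differentiableAt_signDefect {c d : ℤ} (hcd : c = 0 → d ≤ 1) {z₀ : ℂ}
    (hz : (c : ℂ) * z₀ + d ∈ Complex.slitPlane) : DifferentiableAt ℂ (signDefect c d) z₀ := by
  obtain ⟨δ, hδ, h⟩ := norm_add_ge_of_sign_ne hcd hz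
  have hu : Summable fun v : Fin 2 → ℤ => 2 * (δ ^ 3)⁻¹ * ‖v‖ ^ (-3 : ℝ) :=
    (EisensteinSeries.summable_one_div_norm_rpow (by norm_num)).mul_left _
  refine (Complex.differentiableOn_tsum_of_summable_norm hu (U := Metric.ball z₀ δ) (fun v => ?_)
    Metric.isOpen_ball fun v z hzb => ?_).differentiableAt (Metric.ball_mem_nhds z₀ hδ)
  · by_cases hv : Int.sign (v 0) - Int.sign (v 0 * d - v 1 * c) = 0
    · simp [hv]
    · intro z hzb
      have h1 := h z (by simpa [dist_eq_norm] using hzb) v hv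
      have hv0 : 0 < ‖v‖ := norm_pos_iff.2 fun h0 => hv (by simp [h0])
      have hne : (v 0 : ℂ) * z + v 1 ≠ 0 := norm_pos_iff.1 (lt_of_lt_of_le (by positivity) h1)
      refine DifferentiableAt.differentiableWithinAt ?_
      refine DifferentiableAt.const_mul (DifferentiableAt.fun_inv (by fun_prop) ?_) _
      exact pow_ne_zero 3 hne
  · by_cases hv : Int.sign (v 0) - Int.sign (v 0 * d - v 1 * c) = 0
    · rw [hv, Int.cast_zero, zero_mul, norm_zero]
      positivity
    · have h1 := h z (by simpa [dist_eq_norm] using hzb) v hv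
      have hv0 : 0 < ‖v‖ := norm_pos_iff.2 fun h0 => hv (by simp [h0])
      have h2 : ‖((Int.sign (v 0) - Int.sign (v 0 * d - v 1 * c) : ℤ) : ℂ)‖ ≤ 2 := by
        push_cast
        refine (norm_sub_le _ _).trans ?_
        linarith [norm_sign_le_one (v 0), norm_sign_le_one (v 0 * d - v 1 * c)]
      rw [norm_mul, norm_inv, norm_pow, mul_assoc]
      refine mul_le_mul h2 ?_ (by positivity) zero_le_two
      rw [Real.rpow_neg hv0.le, ← mul_inv]
      have h3 : ‖v‖ ^ (3 : ℝ) = ‖v‖ ^ 3 := by exact_mod_cast Real.rpow_natCast ‖v‖ 3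
      rw [h3, ← mul_pow]
      gcongr

/-- Reindexing by `v ↦ vγ` makes the unsigned summands match; only the sign changes, to that of the
first coordinate of `vγ⁻¹`. -/
theorem tsum_signedSummand_sub (γ : Matrix.SpecialLinearGroup (Fin 2) ℤ) (z : UpperHalfPlane) :
    ∑' v, signedSummand v z - UpperHalfPlane.denom γ z ^ (-3 : ℤ) *
      ∑' v, signedSummand v (γ • z) = signDefect (γ.1 1 0) (γ.1 1 1) z := by
  have hden : UpperHalfPlane.denom γ (z : ℂ) ≠ 0 := UpperHalfPlane.denom_ne_zero γ z
  let e : (Fin 2 → ℤ) ≃ (Fin 2 → ℤ) :=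
    { toFun := fun v => Matrix.vecMul v γ.1
      invFun := fun v => Matrix.vecMul v (γ⁻¹).1
      left_inv := fun v => by
        change Matrix.vecMul (Matrix.vecMul v γ.1) (γ⁻¹).1 = v
        rw [Matrix.vecMul_vecMul, show γ.1 * (γ⁻¹).1 = 1 from congrArg Subtype.val (mul_inv_cancel γ),
          Matrix.vecMul_one]
      right_inv := fun v => by
        change Matrix.vecMul (Matrix.vecMul v (γ⁻¹).1) γ.1 = v
        rw [Matrix.vecMul_vecMul, show (γ⁻¹).1 * γ.1 = 1 from congrArg Subtype.val (inv_mul_cancel γ),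
          Matrix.vecMul_one] }
  have hsymm : ∀ v, (e.symm v) 0 = v 0 * γ.1 1 1 - v 1 * γ.1 1 0 := by
    intro v
    change (Matrix.vecMul v (γ⁻¹).1) 0 = _
    rw [Matrix.SpecialLinearGroup.coe_inv, Matrix.adjugate_fin_two]
    simp [Matrix.vecMul, dotProduct, Fin.sum_univ_two]
    ring
  have h1 : UpperHalfPlane.denom γ z ^ (-3 : ℤ) * ∑' v, signedSummand v (γ • z) =
      ∑' v, (Int.sign (v 0 * γ.1 1 1 - v 1 * γ.1 1 0) : ℂ) *
        EisensteinSeries.eisSummand 3 v z := by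
    rw [← e.symm.tsum_eq, ← tsum_mul_left]
    refine tsum_congr fun v => ?_
    rw [signedSummand, EisensteinSeries.eisSummand_SL2_apply, hsymm]
    have : Matrix.vecMul (e.symm v) γ.1 = v := e.apply_symm_apply v
    rw [this, zpow_neg]
    have h3 := zpow_ne_zero 3 hden
    field_simp
  rw [h1]
  have hs1 := summable_sign_mul_eisSummand (fun v => v 0) z
  have hs2 := summable_sign_mul_eisSummand (fun v => v 0 * γ.1 1 1 - v 1 * γ.1 1 0) z
  have h2 := (hs1.tsum_sub hs2).symm
  refine h2.trans (tsum_congr fun v => ?_)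
  rw [← sub_mul, EisensteinSeries.eisSummand]
  push_cast
  norm_cast

theorem isQuantumModular_E_three :
    IsQuantumModular 3 (PowerSeries.map (algebraMap ℚ ℂ) (E 3)) := by
  refine IsQuantumModular.of_expansion_zero (fun z hz => summable_map_E (by norm_num) hz)
    hasExpansion_E_three fun γ =>
      ⟨fun z => ((-2 * Real.pi * Complex.I) ^ 3)⁻¹ * signDefect (γ.1 1 0) (γ.1 1 1) z, ?_,
        fun z hz _ => ?_⟩
  · intro z hz
    refine ((differentiableAt_signDefect (fun hc => ?_) hz).const_mul _).differentiableWithinAt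
    -- When `c = 0` the determinant forces `d = ±1`, hence `d ≤ 1`.
    have hdet := γ.2
    rw [Matrix.det_fin_two, hc, mul_zero, sub_zero] at hdet
    have := Int.isUnit_iff.1 (IsUnit.of_mul_eq_one_right _ hdet)
    omega
  · have h2 : ((γ • (⟨z, hz⟩ : UpperHalfPlane) : UpperHalfPlane) : ℂ) =
        ((γ.1 0 0 : ℂ) * z + (γ.1 0 1 : ℂ)) / ((γ.1 1 0 : ℂ) * z + (γ.1 1 1 : ℂ)) := by
      rw [UpperHalfPlane.coe_specialLinearGroup_apply]
      simp
    have h3 : UpperHalfPlane.denom γ (z : ℂ) = (γ.1 1 0 : ℂ) * z + (γ.1 1 1 : ℂ) := by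
      simp [UpperHalfPlane.denom]
    have h4 := tsum_signedSummand_sub γ ⟨z, hz⟩
    have h5 := qFun_map_E_three_eq_tsum_signedSummand ⟨z, hz⟩
    have h6 := qFun_map_E_three_eq_tsum_signedSummand (γ • ⟨z, hz⟩)
    rw [h2] at h6
    simp only at h4 h5
    rw [h3] at h4
    beta_reduce
    rw [h5, h6, ← h4]
    ring

theorem isMixedQuantumModular_F_two_of_eq {φ : PowerSeries ℚ}
    (h : φ = (1 / 2 : ℚ) • (E 3 - E 2)) :
    IsMixedQuantumModular {2, 3} (PowerSeries.map (algebraMap ℚ ℂ) φ) := by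
  refine ⟨fun k => if k = 2 then (-1 / 2 : ℂ) • PowerSeries.map (algebraMap ℚ ℂ) (E 2)
    else (1 / 2 : ℂ) • PowerSeries.map (algebraMap ℚ ℂ) (E 3), ?_, ?_⟩
  · intro k hk
    rw [Finset.mem_insert, Finset.mem_singleton] at hk
    obtain rfl | rfl := hk
    · simpa using isQuantumModular_E_two.smul (-1 / 2)
    · simpa using isQuantumModular_E_three.smul (1 / 2)
  · rw [Finset.sum_pair (by norm_num), h]
    ext n
    simp
    ring

end RealOrigami
end

theorem mainTheorem5 :
    RealOrigami.F 2 = (1 / 2 : ℚ) • (RealOrigami.E 3 - RealOrigami.E 2) ∧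
    RealOrigami.IsMixedQuantumModular {2, 3}
      (PowerSeries.map (algebraMap ℚ ℂ) (RealOrigami.F 2)) ∧
    RealOrigami.F 2 = RealOrigami.genFun RealOrigami.origamiCount := by
  exact ⟨RealOrigami.F_two_eq, RealOrigami.isMixedQuantumModular_F_two_of_eq RealOrigami.F_two_eq,
    RealOrigami.F_two_eq_origami⟩
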